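/- **Conventions.** For an ordinal $a$ and a regular cardinal $\chi$, $\mathcal H_{<\chi}(a)$ is the least $Y$ that contains every ordinal $i<a$ and every $x\subseteq Y$ with $|x|<\chi$. Cardinals are identified with initial ordinals, $(<\chi)^\theta=\sum_{\mu<\chi}\mu^\theta$, $\lambda^{<\chi}=\sup_{\mu<\chi}\lambda^\mu$. Let $\lambda,\theta,\chi$ be cardinals with $\theta<\chi$, $\theta$ and $\chi$ regular (infinite), $\lambda^\theta=\lambda^{<\chi}$ and $\operatorname{cf}\lambda\ge\chi+\theta^+$. All models below have the form $M=(N,A,B)$ where $N$ expands a submodel of $(\mathcal H_{<\chi}(\lambda),\in,<)$ ($<$ is the order of the ordinals), $A\neq B$ are subsets of $\lambda\cap|N|$, $M\in\mathcal H_{<\chi}(\lambda)$, the vocabulary of $N$ belongs to $\mathcal H_{<\chi}(\chi)$, $|N|\cap\chi$ is an ordinal, and $\mu+1\subseteq|N|$ in case $\chi=\mu^+$. We write $|M|=|N|$, and $x\in M$ for $x\in|M|$. A pair $(\langle M_i:i<\delta\rangle,\eta)$ is a *chain of length $\delta$* if the $M_i$ are such models, increasing and continuous (the vocabulary may increase),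 and $\langle M_j:j\le i\rangle\in M_{i+1}$, $\eta\restriction(i+1)\in M_{i+1}$ whenever $i+1<\delta$. **Theorem.** There are an ordinal $\alpha(*)$ and $\mathbf W=\langle(\bar M^\alpha,\eta^\alpha):\alpha<\alpha(*)\rangle$, $\bar M^\alpha=\langle M^\alpha_i:i\le\theta\rangle$, $M^\alpha_i=(N^\alpha_i,A^\alpha_i,B^\alpha_i)$, $\eta^\alpha\in{}^\theta\lambda$, such that each $(\bar M^\alpha,\eta^\alpha)$ is a chain of length $\theta+1$, and functions as follows. *If $\lambda$ is regular*: there are $\dot\zeta:\alpha(*)\to\{\delta<\lambda:\operatorname{cf}\delta=\theta\}$ and $h:\alpha(*)\to\lambda$ with - (a0) $h(\alpha)$ depends only on $\dot\zeta(\alpha)$, and $\dot\zeta$ is non-decreasing; - (a1) $\eta^\alpha$ is strictly increasing with limit $\dot\zeta(\alpha)$, and for $i<\theta$: $M^\alpha_i\in\mathcal H_{<\chi}(\eta^\alpha(i))$ and $|M^\alpha_i|\cap\lambda\subseteq\eta^\alpha(i)$. *If $\lambda$ is singular*: there are cardinals $\mu_i$ ($i<\operatorname{cf}\lambda$), regular,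 with $\chi+\theta^+<\mu_i<\lambda$ and $\sup_i\mu_i=\lambda$, and $\dot\zeta:\alpha(*)\to\operatorname{cf}\lambda$, $\dot\xi:\alpha(*)\to\lambda$, $h:\alpha(*)\to\lambda$ with - (a0) $h(\alpha)$ depends only on $(\dot\zeta(\alpha),\dot\xi(\alpha))$; $\dot\xi(\alpha)<\mu_{\dot\zeta(\alpha)}$; if $\alpha<\beta$ then $\dot\zeta(\alpha)\le\dot\zeta(\beta)$, and if moreover $\dot\zeta(\alpha)=\dot\zeta(\beta)$ then $\dot\xi(\alpha)\le\dot\xi(\beta)$; - (a1) $\langle\eta^\alpha(3i):i<\theta\rangle$ and $\langle\eta^\alpha(3i+1):i<\theta\rangle$ are strictly increasing with limits $\dot\zeta(\alpha)$ and $\dot\xi(\alpha)$; for $i<\theta$, $\sup(|M^\alpha_i|\cap\operatorname{cf}\lambda)<\dot\zeta(\alpha)=\sup(|M^\alpha_\theta|\cap\operatorname{cf}\lambda)$ and $\sup(|M^\alpha_i|\cap\mu_{\dot\zeta(\alpha)})<\dot\xi(\alpha)=\sup(|M^\alpha_\theta|\cap\mu_{\dot\zeta(\alpha)})$; and for the indices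 $k=3i+2$, $M^\alpha_k\in\mathcal H_{<\chi}(\eta^\alpha(k))$ and $|M^\alpha_k|\cap\lambda\subseteq\eta^\alpha(k)$. *In both cases*: - (a2) Player I has no winning strategy in the following game of $\theta$ moves. In the $i$-th move player I chooses a model $M_i$ and then player II chooses $\gamma_i<\lambda$; in the first move player I also chooses $\beta<\lambda$. Player II wins if either player I broke his rules or for some $\alpha<\alpha(*)$: $\eta^\alpha=\langle\gamma_i:i<\theta\rangle$, $M^\alpha_i=M_i$ for all $i<\theta$, and $h(\alpha)=\beta$. Player I's rules are that $(\langle M_i:i<\theta\rangle,\langle\gamma_i:i<\theta\rangle)$ is a chain of length $\theta$ and, for singular $\lambda$, that with $\zeta=\sup_i\gamma_{3i}$ each $\gamma_{3i}<\operatorname{cf}\lambda$ has an element of $\operatorname{cf}\lambda\cap\bigcup_j|M_j|$ above or equal to it, and each $\gamma_{3i+1}<\mu_\zeta$ has an element of $\mu_\zeta\cap\bigcup_j|M_j|$ above or equal to it. - (b0) $\eta^\alpha\ne\eta^\beta$ for $\alpha\neq\beta$. - (b1) If $\{\eta^\alpha\restriction i:i<\theta\}\subseteq M^\beta_\theta$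 then $\alpha<\beta+(<\chi)^\theta$ and $\dot\zeta(\alpha)\le\dot\zeta(\beta)$. - (b2) If $\lambda^{<\theta}=\lambda^{<\chi}$, there is a binary operation $F$ on $\mathcal H_{<\chi}(\lambda)$ such that for all $\alpha<\alpha(*)$ and $i<\theta$ there is $j<\theta$ such that for every $\beta<\alpha(*)$ with $|M^\beta_\theta|$ closed under $F$: $\eta^\alpha\restriction j\in M^\beta_\theta$ implies $M^\alpha_i\in M^\beta_\theta$ and $|M^\alpha_i|\subseteq|M^\beta_\theta|$. - (b1)$''$ If $\alpha\ne\beta$, $\{\eta^\alpha\restriction i:i<\theta\}\subseteq M^\beta_\theta$, and either $\beta<\alpha$ (so $\beta<\alpha<\beta+(<\chi)^\theta$ by (b1)) or $\dot\zeta(\alpha)=\dot\zeta(\beta)$ (for singular $\lambda$: and $\dot\xi(\alpha)=\dot\xi(\beta)$), then with $X=|M^\alpha_\theta|\cap|M^\beta_\theta|$ we have $A^\alpha_\theta\cap X\neq B^\beta_\theta\cap X$ and $B^\alpha_\theta\cap X\neq A^\beta_\theta\cap X$. -/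

import Mathlib

universe u

namespace BlackBox

/-- `InH χ a x` says `x ∈ H_{<χ}(a)`, the least class that contains every (von Neumann) ordinal
`i < a` and every one of its own subsets of cardinality `< χ`. -/
inductive InH (χ : Cardinal.{u}) (a : Ordinal.{u}) : ZFSet.{u} → Prop
  | ord (i : Ordinal.{u}) (hi : i < a) : InH χ a i.toZFSet
  | set (x : ZFSet.{u}) (hx : ∀ y ∈ x, InH χ a y) (hc : x.card < χ) : InH χ a x

/-- The set `⟨f j : j < i⟩`, i.e. the function `j ↦ f j` with domain `i`, as a set of pairs. -/
noncomputable def seqCode (f : Ordinal.{u} → ZFSet.{u}) (i : Ordinal.{u}) : ZFSet.{u} :=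
  ZFSet.range (fun j : Set.Iio i => ZFSet.pair (j : Ordinal.{u}).toZFSet (f j))

/-- The restriction `η ↾ i` of a sequence of ordinals, as a set. -/
noncomputable def initSeg (η : Ordinal.{u} → Ordinal.{u}) (i : Ordinal.{u}) : ZFSet.{u} :=
  seqCode (fun j => (η j).toZFSet) i

/-- The data of a triple `(N, A, B)` where `N` has universe `U`, vocabulary `voc` and
interpretation function `interp`.  In `N` the relations `∈` and `<` always have their true
meaning on `U`, hence are determined by `U`; `voc` lists only the additional symbols. -/
@[ext] structure PreModel : Type (u + 1) where
  U : ZFSet.{u}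
  voc : ZFSet.{u}
  interp : ZFSet.{u}
  A : ZFSet.{u}
  B : ZFSet.{u}

/-- The triple `(N, A, B)` as a set. -/
noncomputable def PreModel.code (M : PreModel.{u}) : ZFSet.{u} :=
  ZFSet.pair (ZFSet.pair M.U (ZFSet.pair M.voc M.interp)) (ZFSet.pair M.A M.B)

/-- The `n`-ary predicate symbol with name `s`. -/
noncomputable def predSym (s : ZFSet.{u}) (n : ℕ) : ZFSet.{u} :=
  ZFSet.pair s (ZFSet.pair (Ordinal.toZFSet 0) (Ordinal.toZFSet n))

/-- The `n`-ary function symbol with name `s`. -/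
noncomputable def funSym (s : ZFSet.{u}) (n : ℕ) : ZFSet.{u} :=
  ZFSet.pair s (ZFSet.pair (Ordinal.toZFSet 1) (Ordinal.toZFSet n))

/-- The set of `n`-tuples of elements of `X`. -/
noncomputable def tuples (n : ℕ) (X : ZFSet.{u}) : ZFSet.{u} :=
  ZFSet.funs (Ordinal.toZFSet n) X

/-- `voc` is a set of finitary predicate and function symbols, and `interp` is a function with
domain `voc` that interprets each of them on `U`. -/
structure PreModel.WellFormed (M : PreModel.{u}) : Prop where
  symbols : ∀ σ ∈ M.voc, ∃ (s : ZFSet.{u}) (n : ℕ), σ = predSym s n ∨ σ = funSym s n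
  interp_dom : ∀ z ∈ M.interp, ∃ σ ∈ M.voc, ∃ R, z = ZFSet.pair σ R
  interp_fun : ∀ σ ∈ M.voc, ∃! R, ZFSet.pair σ R ∈ M.interp
  interp_pred : ∀ s n R, ZFSet.pair (predSym s n) R ∈ M.interp → R ⊆ tuples n M.U
  interp_func : ∀ s n R, ZFSet.pair (funSym s n) R ∈ M.interp → ZFSet.IsFunc (tuples n M.U) M.U R

/-- `M` is a submodel of `N`, where the vocabulary of `N` may be larger. -/
structure PreModel.Sub (M N : PreModel.{u}) : Prop where
  univ : M.U ⊆ N.U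
  voc : M.voc ⊆ N.voc
  pred : ∀ s n R R', ZFSet.pair (predSym s n) R ∈ M.interp →
    ZFSet.pair (predSym s n) R' ∈ N.interp → ∀ t ∈ tuples n M.U, (t ∈ R ↔ t ∈ R')
  func : ∀ s n R R', ZFSet.pair (funSym s n) R ∈ M.interp →
    ZFSet.pair (funSym s n) R' ∈ N.interp →
      ∀ t ∈ tuples n M.U, ∀ v, (ZFSet.pair t v ∈ R ↔ ZFSet.pair t v ∈ R')
  A : ∀ x ∈ M.U, (x ∈ M.A ↔ x ∈ N.A)
  B : ∀ x ∈ M.U, (x ∈ M.B ↔ x ∈ N.B)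

/-- The demands on a single model `M = (N, A, B)`: it is in `H_{<χ}(lam)`, `N` expands a submodel
of `(H_{<χ}(lam), ∈, <)`, its vocabulary is in `H_{<χ}(χ)`, `|N| ∩ χ` is an ordinal,
`μ + 1 ⊆ |N|` in case `χ = μ⁺`, and `A ≠ B` are subsets of `lam ∩ |N|`. -/
structure PreModel.Admissible (lam χ : Cardinal.{u}) (M : PreModel.{u}) : Prop where
  wf : M.WellFormed
  univ : ∀ x ∈ M.U, InH χ lam.ord x
  mem : InH χ lam.ord M.code
  voc : InH χ χ.ord M.voc
  inter_ordinal : ∀ a b : Ordinal.{u}, a < b → b < χ.ord → b.toZFSet ∈ M.U → a.toZFSet ∈ M.U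
  succ : ∀ μ : Cardinal.{u}, χ = Order.succ μ → ∀ a ≤ μ.ord, a.toZFSet ∈ M.U
  A_sub : ∀ x ∈ M.A, x ∈ M.U ∧ ∃ a < lam.ord, a.toZFSet = x
  B_sub : ∀ x ∈ M.B, x ∈ M.U ∧ ∃ a < lam.ord, a.toZFSet = x
  ne : M.A ≠ M.B

/-- `⟨M i : i < δ⟩` is an increasing continuous chain of admissible models with
`⟨M j : j ≤ i⟩ ∈ M (i+1)` and `η ↾ (i+1) ∈ M (i+1)` for `i + 1 < δ`. -/
structure IsModelChain (lam χ : Cardinal.{u}) (δ : Ordinal.{u}) (M : Ordinal.{u} → PreModel.{u})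
    (η : Ordinal.{u} → Ordinal.{u}) : Prop where
  adm : ∀ i < δ, (M i).Admissible lam χ
  mono : ∀ j i, j ≤ i → i < δ → (M j).Sub (M i)
  cont_univ : ∀ i < δ, Order.IsSuccLimit i → ∀ x, (x ∈ (M i).U ↔ ∃ j < i, x ∈ (M j).U)
  cont_voc : ∀ i < δ, Order.IsSuccLimit i → ∀ x, (x ∈ (M i).voc ↔ ∃ j < i, x ∈ (M j).voc)
  models_mem : ∀ i, i + 1 < δ → seqCode (fun j => (M j).code) (i + 1) ∈ (M (i + 1)).U
  seq_mem : ∀ i, i + 1 < δ → initSeg η (i + 1) ∈ (M (i + 1)).U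

/-- A sequence `⟨(M̄^α, η^α) : α < len⟩`; only `M α i` for `α < len`, `i ≤ θ` and `η α i` for
`α < len`, `i < θ` matter. -/
structure Guesses : Type (u + 1) where
  len : Ordinal.{u}
  M : Ordinal.{u} → Ordinal.{u} → PreModel.{u}
  η : Ordinal.{u} → Ordinal.{u} → Ordinal.{u}

/-- A strategy for player I: the ordinal `β` of the first move, and the model played at move `i`
as a function of the moves `⟨γ_j : j < i⟩` of player II. -/
structure Strategy : Type (u + 1) where
  bid : Ordinal.{u}
  move : (i : Ordinal.{u}) → (Set.Iio i → Ordinal.{u}) → PreModel.{u}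

/-- The models that the strategy produces against the moves `γ` of player II. -/
def Strategy.play (σ : Strategy.{u}) (γ : Ordinal.{u} → Ordinal.{u}) (i : Ordinal.{u}) :
    PreModel.{u} :=
  σ.move i (fun j => γ j)

/-- Player II's moves `γ` were guessed: some `α` has `η^α = γ`, `M^α_i = P i` for `i < θ`, and
`h(α) = β`. -/
def Guessed (θ : Cardinal.{u}) (W : Guesses.{u}) (h : Ordinal.{u} → Ordinal.{u})
    (P : Ordinal.{u} → PreModel.{u}) (γ : Ordinal.{u} → Ordinal.{u}) (β : Ordinal.{u}) : Prop :=
  ∃ α < W.len, (∀ i < θ.ord, W.η α i = γ i) ∧ (∀ i < θ.ord, W.M α i = P i) ∧ h α = β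

/-- Player I has no winning strategy in the game of length `θ` in which player I plays `β < lam`
and models `M_i`, player II plays `γ_i < lam`, and player II wins when the play was guessed
or player I violated the demands `demand` on player I's moves. -/
def NoWinningStrategy (lam θ : Cardinal.{u}) (W : Guesses.{u}) (h : Ordinal.{u} → Ordinal.{u})
    (demand : (Ordinal.{u} → PreModel.{u}) → (Ordinal.{u} → Ordinal.{u}) → Prop) : Prop :=
  ¬ ∃ σ : Strategy.{u}, σ.bid < lam.ord ∧
    ∀ γ : Ordinal.{u} → Ordinal.{u}, (∀ i < θ.ord, γ i < lam.ord) →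
      ¬ (demand (σ.play γ) γ → Guessed θ W h (σ.play γ) γ σ.bid)

/-- `{η^α ↾ i : i < θ} ⊆ M^β_θ`. -/
def Trace (θ : Cardinal.{u}) (W : Guesses.{u}) (α β : Ordinal.{u}) : Prop :=
  ∀ i < θ.ord, initSeg (W.η α) i ∈ (W.M β θ.ord).U

/-- `(<χ)^θ`, the supremum (equivalently, the sum) of `μ ^ θ` over the cardinals `μ < χ`. -/
noncomputable def ltPow (χ θ : Cardinal.{u}) : Cardinal.{u} :=
  ⨆ μ : Set.Iio χ, (μ : Cardinal.{u}) ^ θ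

/-- On the common part of `|M^α_θ|` and `|M^β_θ|`: `A^α_θ` differs from `B^β_θ`, and `B^α_θ`
differs from `A^β_θ`. -/
def Disagree (θ : Cardinal.{u}) (W : Guesses.{u}) (α β : Ordinal.{u}) : Prop :=
  (W.M α θ.ord).A ∩ ((W.M α θ.ord).U ∩ (W.M β θ.ord).U) ≠
      (W.M β θ.ord).B ∩ ((W.M α θ.ord).U ∩ (W.M β θ.ord).U) ∧
    (W.M α θ.ord).B ∩ ((W.M α θ.ord).U ∩ (W.M β θ.ord).U) ≠
      (W.M β θ.ord).A ∩ ((W.M α θ.ord).U ∩ (W.M β θ.ord).U)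

/-- Distinct indices carry distinct sequences. -/
def ClauseB0 (θ : Cardinal.{u}) (W : Guesses.{u}) : Prop :=
  ∀ α < W.len, ∀ β < W.len, α ≠ β → ∃ i < θ.ord, W.η α i ≠ W.η β i

/-- If the initial segments of `η^α` lie in `M^β_θ`, then `α < β + (<χ)^θ` and `ζ(α) ≤ ζ(β)`. -/
def ClauseB1 (θ χ : Cardinal.{u}) (W : Guesses.{u}) (ζ : Ordinal.{u} → Ordinal.{u}) : Prop :=
  ∀ α < W.len, ∀ β < W.len, Trace θ W α β → α < β + (ltPow χ θ).ord ∧ ζ α ≤ ζ β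

/-- If `lam^{<θ} = lam^{<χ}`, then for all `α` and `i < θ` there is `j < θ` such that
`η^α ↾ j ∈ M^β_θ` implies `M^α_i ∈ M^β_θ` and `|M^α_i| ⊆ |M^β_θ|`, for every `β` such that
`|M^β_θ|` is a submodel of `(H_{<χ}(lam), ∈, <, F)`; here `F` is one fixed binary operation on
`H_{<χ}(lam)` (it decodes models from sequences). -/
def ClauseB2 (lam θ χ : Cardinal.{u}) (W : Guesses.{u}) : Prop :=
  Cardinal.powerlt lam θ = Cardinal.powerlt lam χ →
    ∃ F : ZFSet.{u} → ZFSet.{u} → ZFSet.{u},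
      (∀ x y, InH χ lam.ord x → InH χ lam.ord y → InH χ lam.ord (F x y)) ∧
      ∀ α < W.len, ∀ i < θ.ord, ∃ j < θ.ord, ∀ β < W.len,
        (∀ x ∈ (W.M β θ.ord).U, ∀ y ∈ (W.M β θ.ord).U, F x y ∈ (W.M β θ.ord).U) →
          initSeg (W.η α) j ∈ (W.M β θ.ord).U →
            (W.M α i).code ∈ (W.M β θ.ord).U ∧ (W.M α i).U ⊆ (W.M β θ.ord).U

/-- The black box for regular `lam`. -/
structure IsRegularBox (lam θ χ : Cardinal.{u}) (W : Guesses.{u})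
    (ζ h : Ordinal.{u} → Ordinal.{u}) : Prop where
  zeta_lt : ∀ α < W.len, ζ α < lam.ord ∧ (ζ α).cof = θ
  h_lt : ∀ α < W.len, h α < lam.ord
  -- (a0)
  h_dep : ∀ α < W.len, ∀ β < W.len, ζ α = ζ β → h α = h β
  zeta_mono : ∀ α β, α < β → β < W.len → ζ α ≤ ζ β
  -- (a1)
  chain : ∀ α < W.len, IsModelChain lam χ (θ.ord + 1) (W.M α) (W.η α)
  mem_H : ∀ α < W.len, ∀ i < θ.ord, InH χ (W.η α i) (W.M α i).code
  inter_lam : ∀ α < W.len, ∀ i < θ.ord, ∀ a < lam.ord, a.toZFSet ∈ (W.M α i).U → a < W.η α i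
  eta_lt : ∀ α < W.len, ∀ i < θ.ord, W.η α i < lam.ord
  eta_mono : ∀ α < W.len, ∀ j i, j < i → i < θ.ord → W.η α j < W.η α i
  eta_lim : ∀ α < W.len, IsLUB (W.η α '' Set.Iio θ.ord) (ζ α)
  -- (a2)
  game : NoWinningStrategy lam θ W h (IsModelChain lam χ θ.ord)
  b0 : ClauseB0 θ W
  b1 : ClauseB1 θ χ W ζ
  b2 : ClauseB2 lam θ χ W
  -- (b1)''
  b1' : ∀ α < W.len, ∀ β < W.len, α ≠ β → Trace θ W α β → (β < α ∨ ζ α = ζ β) →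
    Disagree θ W α β

/-- `sup (|M| ∩ κ)`. -/
noncomputable def PreModel.supBelow (M : PreModel.{u}) (κ : Ordinal.{u}) : Ordinal.{u} :=
  sSup {a : Ordinal.{u} | a < κ ∧ a.toZFSet ∈ M.U}

/-- If `v < κ` then `v` is bounded by an element of `κ ∩ ⋃_{j < θ} |P j|`. -/
def Covers (θ : Cardinal.{u}) (P : Ordinal.{u} → PreModel.{u}) (κ v : Ordinal.{u}) : Prop :=
  v < κ → ∃ j < θ.ord, ∃ x < κ, v ≤ x ∧ x.toZFSet ∈ (P j).U

/-- Player I's demands for singular `lam`: besides those on the chain, the union of the models has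
to be unbounded in the limit `ζ` of `⟨γ_{3i}⟩` and in the limit of `⟨γ_{3i+1}⟩` (as long as player
II keeps these below `cf lam` and `μ_ζ`). -/
def SingularDemand (lam θ χ : Cardinal.{u}) (μ : Ordinal.{u} → Cardinal.{u})
    (P : Ordinal.{u} → PreModel.{u}) (γ : Ordinal.{u} → Ordinal.{u}) : Prop :=
  IsModelChain lam χ θ.ord P γ ∧
    (∀ i < θ.ord, Covers θ P lam.ord.cof.ord (γ (3 * i))) ∧
    ∀ i < θ.ord, Covers θ P (μ (sSup ((fun j => γ (3 * j)) '' Set.Iio θ.ord))).ord (γ (3 * i + 1))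

/-- The black box for singular `lam`. -/
structure IsSingularBox (lam θ χ : Cardinal.{u}) (μ : Ordinal.{u} → Cardinal.{u}) (W : Guesses.{u})
    (ζ ξ h : Ordinal.{u} → Ordinal.{u}) : Prop where
  mu_reg : ∀ i < lam.ord.cof.ord, (μ i).IsRegular ∧ χ + Order.succ θ < μ i ∧ μ i < lam
  mu_sup : ∀ κ < lam, ∃ i < lam.ord.cof.ord, κ < μ i
  zeta_lt : ∀ α < W.len, ζ α < lam.ord.cof.ord
  h_lt : ∀ α < W.len, h α < lam.ord
  -- (a0)
  h_dep : ∀ α < W.len, ∀ β < W.len, ζ α = ζ β → ξ α = ξ β → h α = h β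
  zeta_mono : ∀ α β, α < β → β < W.len → ζ α ≤ ζ β
  xi_mono : ∀ α β, α < β → β < W.len → ζ α = ζ β → ξ α ≤ ξ β
  xi_lt : ∀ α < W.len, ξ α < (μ (ζ α)).ord
  -- (a1)
  chain : ∀ α < W.len, IsModelChain lam χ (θ.ord + 1) (W.M α) (W.η α)
  mem_H : ∀ α < W.len, ∀ i < θ.ord, InH χ (W.η α (3 * i + 2)) (W.M α (3 * i + 2)).code
  inter_lam : ∀ α < W.len, ∀ i < θ.ord, ∀ a < lam.ord,
    a.toZFSet ∈ (W.M α (3 * i + 2)).U → a < W.η α (3 * i + 2)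
  eta_lt : ∀ α < W.len, ∀ i < θ.ord, W.η α i < lam.ord
  eta_mono_zero : ∀ α < W.len, ∀ j i, j < i → i < θ.ord → W.η α (3 * j) < W.η α (3 * i)
  eta_lim_zero : ∀ α < W.len, IsLUB ((fun i => W.η α (3 * i)) '' Set.Iio θ.ord) (ζ α)
  eta_mono_one : ∀ α < W.len, ∀ j i, j < i → i < θ.ord → W.η α (3 * j + 1) < W.η α (3 * i + 1)
  eta_lim_one : ∀ α < W.len, IsLUB ((fun i => W.η α (3 * i + 1)) '' Set.Iio θ.ord) (ξ α)
  sup_xi_lt : ∀ α < W.len, ∀ i < θ.ord, (W.M α i).supBelow (μ (ζ α)).ord < ξ α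
  sup_xi : ∀ α < W.len, (W.M α θ.ord).supBelow (μ (ζ α)).ord = ξ α
  sup_zeta_lt : ∀ α < W.len, ∀ i < θ.ord, (W.M α i).supBelow lam.ord.cof.ord < ζ α
  sup_zeta : ∀ α < W.len, (W.M α θ.ord).supBelow lam.ord.cof.ord = ζ α
  -- (a2)
  game : NoWinningStrategy lam θ W h (SingularDemand lam θ χ μ)
  b0 : ClauseB0 θ W
  b1 : ClauseB1 θ χ W ζ
  b2 : ClauseB2 lam θ χ W
  -- (b1)''
  b1' : ∀ α < W.len, ∀ β < W.len, α ≠ β → Trace θ W α β → (β < α ∨ (ζ α = ζ β ∧ ξ α = ξ β)) →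
    Disagree θ W α β

end BlackBox

namespace BlackBox

open Cardinal Ordinal Order

theorem exists_bound {ι : Type*} [Small.{u} ι] {o : Ordinal.{u}} (hι : #(Shrink.{u} ι) < o.cof)
    (f : ι → Ordinal.{u}) (hf : ∀ i, f i < o) : ∃ b < o, ∀ i, f i < b := by
  refine ⟨⨆ i : Shrink.{u} ι, (f ((equivShrink ι).symm i) + 1), ?_, fun i => ?_⟩
  · exact iSup_add_one_lt_of_lt_cof hι (fun i => hf _)
  · refine lt_of_lt_of_le (Order.lt_add_one_iff.2 le_rfl) ?_
    have := Ordinal.le_iSup (fun i : Shrink.{u} ι => (f ((equivShrink ι).symm i) + 1))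
      (equivShrink ι i)
    simpa using this

theorem card_shrink_Iio (i : Ordinal.{u}) : #(Shrink.{u} (Set.Iio i)) = i.card := by
  rw [← Cardinal.lift_inj.{u, u + 1}, Cardinal.lift_mk_shrink'', Cardinal.mk_Iio_ordinal]

theorem exists_bound_Iio {o i : Ordinal.{u}} (hi : i.card < o.cof) (f : Ordinal.{u} → Ordinal.{u})
    (hf : ∀ j < i, f j < o) : ∃ b < o, ∀ j < i, f j < b := by
  obtain ⟨b, hb, h⟩ := exists_bound (ι := Set.Iio i) (o := o) (by rwa [card_shrink_Iio])
    (fun j => f j) (fun j => hf j j.2)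
  exact ⟨b, hb, fun j hj => h ⟨j, hj⟩⟩

theorem exists_bound_zf {o : Ordinal.{u}} {x : ZFSet.{u}} (hx : x.card < o.cof)
    (f : ZFSet.{u} → Ordinal.{u}) (hf : ∀ y ∈ x, f y < o) : ∃ b < o, ∀ y ∈ x, f y < b := by
  obtain ⟨b, hb, h⟩ := exists_bound (ι := x) (o := o) hx
    (fun j => f j) (fun j => hf j j.2)
  exact ⟨b, hb, fun j hj => h ⟨j, hj⟩⟩

theorem zf_card_range_le {α : Type*} [Small.{u} α] (f : α → ZFSet.{u}) :
    (ZFSet.range f).card ≤ #(Shrink.{u} α) := by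
  have := ZFSet.lift_card_range_le (f := fun i : Shrink.{u} α => f ((equivShrink α).symm i))
  simp only [Cardinal.lift_id] at this
  convert this using 2
  ext z
  simp only [ZFSet.mem_range]
  constructor
  · rintro ⟨i, rfl⟩; exact ⟨equivShrink α i, by simp⟩
  · rintro ⟨i, rfl⟩; exact ⟨_, rfl⟩

theorem zf_card_le_of_surj {x : ZFSet.{u}} {α : Type u} (f : α → ZFSet.{u})
    (h : ∀ y ∈ x, ∃ i, f i = y) : x.card ≤ #α := by
  have h1 : x ⊆ ZFSet.range f := fun y hy => ZFSet.mem_range.2 (h y hy)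
  refine (ZFSet.card_mono h1).trans ?_
  simpa using ZFSet.lift_card_range_le (f := f)

theorem zf_card_iUnion_lt {χ : Cardinal.{u}} (hχ : χ.IsRegular) {α : Type*} [Small.{u} α]
    (hα : #(Shrink.{u} α) < χ) (f : α → ZFSet.{u}) (hf : ∀ i, (f i).card < χ) :
    (ZFSet.iUnion f).card < χ := by
  have := ZFSet.lift_card_iUnion_le_sum_card
    (f := fun i : Shrink.{u} α => f ((equivShrink α).symm i))
  simp only [Cardinal.lift_id] at this
  have h2 : ZFSet.iUnion (fun i : Shrink.{u} α => f ((equivShrink α).symm i)) =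
      ZFSet.iUnion f := by
    ext z
    simp only [ZFSet.mem_iUnion]
    constructor
    · rintro ⟨i, h⟩; exact ⟨_, h⟩
    · rintro ⟨i, h⟩; exact ⟨equivShrink α i, by simpa using h⟩
  rw [h2] at this
  exact this.trans_lt (Cardinal.sum_lt_of_isRegular hχ hα (fun i => hf _))

theorem zf_card_fin_range {n : ℕ} (f : Fin n → ZFSet.{u}) : (ZFSet.range f).card < ℵ₀ := by
  refine (zf_card_range_le f).trans_lt ?_
  exact Cardinal.lt_aleph0_iff_finite.2 inferInstance

theorem zf_card_upair_lt (x y : ZFSet.{u}) : ({x, y} : ZFSet.{u}).card < ℵ₀ := by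
  refine (zf_card_le_of_surj (α := ULift Bool)
    (fun b => if b.down then x else y) ?_).trans_lt (Cardinal.lt_aleph0_iff_finite.2 inferInstance)
  intro z hz
  simp only [ZFSet.mem_pair] at hz
  rcases hz with rfl | rfl
  · exact ⟨⟨true⟩, by simp⟩
  · exact ⟨⟨false⟩, by simp⟩

theorem empty_mem_toZFSet {o : Ordinal.{u}} {x : ZFSet.{u}} (hx : x ∈ o.toZFSet) :
    ∅ ∈ o.toZFSet := by
  rw [Ordinal.mem_toZFSet_iff] at hx ⊢
  obtain ⟨a, ha, -⟩ := hx
  exact ⟨0, (zero_le).trans_lt ha, Ordinal.toZFSet_zero⟩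

theorem pair_ne_empty (x y : ZFSet.{u}) : ZFSet.pair x y ≠ ∅ := by
  intro h
  have : ({x} : ZFSet) ∈ ZFSet.pair x y := ZFSet.mem_pair.2 (Or.inl rfl)
  rw [h] at this
  exact ZFSet.notMem_empty _ this

theorem ne_toZFSet_of_pair_mem {x y s : ZFSet.{u}} (hs : ∀ z ∈ s, z ≠ ∅) (h : ZFSet.pair x y ∈ s)
    (o : Ordinal.{u}) : s ≠ o.toZFSet := by
  rintro rfl
  exact hs _ (empty_mem_toZFSet h) rfl

theorem mem_seqCode {f : Ordinal.{u} → ZFSet.{u}} {i : Ordinal.{u}} {z : ZFSet.{u}} :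
    z ∈ seqCode f i ↔ ∃ j < i, ZFSet.pair j.toZFSet (f j) = z := by
  simp [seqCode, ZFSet.mem_range]

theorem seqCode_ne_toZFSet {f : Ordinal.{u} → ZFSet.{u}} {i : Ordinal.{u}} (hi : 0 < i)
    (o : Ordinal.{u}) : seqCode f i ≠ o.toZFSet := by
  refine ne_toZFSet_of_pair_mem (x := (0 : Ordinal).toZFSet) (y := f 0) ?_ (mem_seqCode.2 ⟨0, hi, rfl⟩) o
  intro z hz
  obtain ⟨j, -, rfl⟩ := mem_seqCode.1 hz
  exact pair_ne_empty _ _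

theorem seqCode_eq_iff {f g : Ordinal.{u} → ZFSet.{u}} {i j : Ordinal.{u}} :
    seqCode f i = seqCode g j ↔ i = j ∧ ∀ k < i, f k = g k := by
  constructor
  · intro h
    have key : ∀ (f g : Ordinal.{u} → ZFSet.{u}) (i j : Ordinal.{u}), seqCode f i = seqCode g j →
        i ≤ j ∧ ∀ k < i, f k = g k := by
      intro f g i j h
      have : ∀ k < i, k < j ∧ f k = g k := by
        intro k hk
        have h1 : ZFSet.pair k.toZFSet (f k) ∈ seqCode g j := h ▸ mem_seqCode.2 ⟨k, hk, rfl⟩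
        obtain ⟨l, hl, e⟩ := mem_seqCode.1 h1
        obtain ⟨e1, e2⟩ := ZFSet.pair_injective e
        obtain rfl := Ordinal.toZFSet_injective e1
        exact ⟨hl, e2.symm⟩
      refine ⟨le_of_not_gt fun hj => (this j hj).1.false, fun k hk => (this k hk).2⟩
    exact ⟨(key f g i j h).1.antisymm (key g f j i h.symm).1, (key f g i j h).2⟩
  · rintro ⟨rfl, h⟩
    ext z
    simp only [mem_seqCode]
    constructor
    · rintro ⟨k, hk, rfl⟩; exact ⟨k, hk, by rw [h k hk]⟩
    · rintro ⟨k, hk, rfl⟩; exact ⟨k, hk, by rw [h k hk]⟩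

theorem initSeg_eq_iff {f g : Ordinal.{u} → Ordinal.{u}} {i j : Ordinal.{u}} :
    initSeg f i = initSeg g j ↔ i = j ∧ ∀ k < i, f k = g k := by
  simp only [initSeg, seqCode_eq_iff, Ordinal.toZFSet_injective.eq_iff]

section InH

variable {χ : Cardinal.{u}} {a : Ordinal.{u}} {x y : ZFSet.{u}}

theorem InH.of_mem (hx : InH χ a x) (hy : y ∈ x) : InH χ a y := by
  cases hx with
  | ord i hi =>
    obtain ⟨j, hj, rfl⟩ := Ordinal.mem_toZFSet_iff.1 hy
    exact InH.ord j (hj.trans hi)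
  | set x hx hc => exact hx y hy

theorem InH.card_lt_or (hx : InH χ a x) : x.card < χ ∨ ∃ i < a, x = i.toZFSet := by
  cases hx with
  | ord i hi => exact Or.inr ⟨i, hi, rfl⟩
  | set x hx hc => exact Or.inl hc

theorem InH.card_lt (hx : InH χ χ.ord x) : x.card < χ := by
  rcases hx.card_lt_or with h | ⟨i, hi, rfl⟩
  · exact h
  · rw [Ordinal.card_toZFSet]; exact Cardinal.lt_ord.1 hi

theorem InH.mono {b : Ordinal.{u}} (hab : a ≤ b) (hx : InH χ a x) : InH χ b x := by
  induction hx with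
  | ord i hi => exact InH.ord i (hi.trans_le hab)
  | set x hx hc ih => exact InH.set x ih hc

theorem InH.rank_lt (hχ : χ ≤ a.cof) (hx : InH χ a x) : x.rank < a := by
  induction hx with
  | ord i hi => simpa using hi
  | set x hx hc ih =>
    obtain ⟨b, hb, h⟩ := exists_bound_zf (hc.trans_le hχ) ZFSet.rank ih
    exact (ZFSet.rank_le_iff.2 fun y hy => h y hy).trans_lt hb

theorem InH.of_rank_lt (hx : InH χ a x) : ∀ b, x.rank < b → InH χ b x := by
  induction hx with
  | ord i hi => intro b hb; exact InH.ord i (by simpa using hb)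
  | set x hx hc ih =>
    intro b hb
    exact InH.set x (fun y hy => ih y hy b ((ZFSet.rank_lt_of_mem hy).trans hb)) hc

theorem InH.upair (hχ : ℵ₀ ≤ χ) (hx : InH χ a x) (hy : InH χ a y) :
    InH χ a ({x, y} : ZFSet.{u}) := by
  refine InH.set _ (fun z hz => ?_) ((zf_card_upair_lt x y).trans_le hχ)
  rcases ZFSet.mem_pair.1 hz with rfl | rfl
  exacts [hx, hy]

theorem InH.pair (hχ : ℵ₀ ≤ χ) (hx : InH χ a x) (hy : InH χ a y) : InH χ a (ZFSet.pair x y) := by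
  have := InH.upair hχ hx hx
  rw [ZFSet.pair_eq_singleton] at this
  exact this.upair hχ (hx.upair hχ hy)

theorem InH.of_pair (h : InH χ a (ZFSet.pair x y)) : InH χ a x ∧ InH χ a y := by
  have h1 : InH χ a ({x, y} : ZFSet.{u}) := h.of_mem (ZFSet.mem_pair.2 (Or.inr rfl))
  exact ⟨h1.of_mem (ZFSet.mem_pair.2 (Or.inl rfl)), h1.of_mem (ZFSet.mem_pair.2 (Or.inr rfl))⟩

end InH

theorem rank_lt_rank_pair_left (x y : ZFSet.{u}) : x.rank < (ZFSet.pair x y).rank := by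
  refine lt_trans (ZFSet.rank_lt_of_mem (y := x) (x := {x}) (ZFSet.mem_singleton.2 rfl)) ?_
  exact ZFSet.rank_lt_of_mem (ZFSet.mem_pair.2 (Or.inl rfl))

theorem rank_lt_rank_pair_right (x y : ZFSet.{u}) : y.rank < (ZFSet.pair x y).rank := by
  refine lt_trans (ZFSet.rank_lt_of_mem (y := y) (x := {x, y}) (ZFSet.mem_pair.2 (Or.inr rfl))) ?_
  exact ZFSet.rank_lt_of_mem (ZFSet.mem_pair.2 (Or.inr rfl))

theorem PreModel.code_injective {M N : PreModel.{u}} (h : M.code = N.code) : M = N := by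
  simp only [PreModel.code, ZFSet.pair_inj] at h
  obtain ⟨⟨h1, h2, h3⟩, h4, h5⟩ := h
  exact PreModel.ext h1 h2 h3 h4 h5

theorem PreModel.rank_lt_code {M : PreModel.{u}} {x : ZFSet.{u}} (hx : x ∈ M.U) :
    x.rank < M.code.rank :=
  (ZFSet.rank_lt_of_mem hx).trans
    ((rank_lt_rank_pair_left _ _).trans (rank_lt_rank_pair_left _ _))

theorem rank_lt_initSeg {f : Ordinal.{u} → Ordinal.{u}} {i j : Ordinal.{u}} (hj : j < i) :
    f j < (initSeg f i).rank := by
  have h1 : ZFSet.pair j.toZFSet (f j).toZFSet ∈ initSeg f i := mem_seqCode.2 ⟨j, hj, rfl⟩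
  have h2 := rank_lt_rank_pair_right j.toZFSet (f j).toZFSet
  rw [Ordinal.rank_toZFSet] at h2
  exact h2.trans (ZFSet.rank_lt_of_mem h1)

section LimitModel

theorem mem_tuples {n : ℕ} {X t : ZFSet.{u}} :
    t ∈ tuples n X ↔ ZFSet.IsFunc (Ordinal.toZFSet n) X t := by
  rw [tuples, ZFSet.mem_funs]

theorem mem_natCast_toZFSet {n : ℕ} {z : ZFSet.{u}} :
    z ∈ (Ordinal.toZFSet.{u} n) ↔ ∃ k < n, Ordinal.toZFSet (k : ℕ) = z := by
  rw [Ordinal.mem_toZFSet_iff]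
  constructor
  · rintro ⟨a, ha, rfl⟩
    obtain ⟨k, rfl⟩ := Ordinal.lt_omega0.1 (ha.trans (Ordinal.natCast_lt_omega0 n))
    exact ⟨k, by exact_mod_cast ha, rfl⟩
  · rintro ⟨k, hk, rfl⟩
    exact ⟨k, by exact_mod_cast hk, rfl⟩

theorem tuples_mono {n : ℕ} {X Y : ZFSet.{u}} (h : X ⊆ Y) : tuples n X ⊆ tuples n Y := by
  intro t ht
  rw [mem_tuples] at ht ⊢
  refine ⟨fun z hz => ?_, ht.2⟩
  obtain ⟨a, ha, b, hb, rfl⟩ := ZFSet.mem_prod.1 (ht.1 hz)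
  exact ZFSet.pair_mem_prod.2 ⟨ha, h hb⟩

/-- The tuple with entries `f k`. -/
noncomputable def mkTuple (n : ℕ) (f : Fin n → ZFSet.{u}) : ZFSet.{u} :=
  ZFSet.range (fun k : Fin n => ZFSet.pair (Ordinal.toZFSet (k : ℕ)) (f k))

theorem exists_eq_mkTuple {n : ℕ} {X t : ZFSet.{u}} (ht : t ∈ tuples n X) :
    ∃ f : Fin n → ZFSet.{u}, (∀ k, f k ∈ X) ∧ t = mkTuple n f := by
  rw [mem_tuples] at ht
  have h : ∀ k : Fin n, ∃ w, ZFSet.pair (Ordinal.toZFSet (k : ℕ)) w ∈ t := fun k =>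
    (ht.2 _ (mem_natCast_toZFSet.2 ⟨k, k.2, rfl⟩)).exists
  choose f hf using h
  refine ⟨f, fun k => (ZFSet.pair_mem_prod.1 (ht.1 (hf k))).2, ?_⟩
  ext z
  constructor
  · intro hz
    obtain ⟨a, ha, b, hb, rfl⟩ := ZFSet.mem_prod.1 (ht.1 hz)
    obtain ⟨k, hk, rfl⟩ := mem_natCast_toZFSet.1 ha
    have := (ht.2 _ ha).unique hz (hf ⟨k, hk⟩)
    exact ZFSet.mem_range.2 ⟨⟨k, hk⟩, by rw [this]⟩
  · intro hz
    obtain ⟨k, rfl⟩ := ZFSet.mem_range.1 hz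
    exact hf k

theorem mkTuple_mem {n : ℕ} {X : ZFSet.{u}} {f : Fin n → ZFSet.{u}} (h : ∀ k, f k ∈ X) :
    mkTuple n f ∈ tuples n X := by
  rw [mem_tuples]
  refine ⟨fun z hz => ?_, fun z hz => ?_⟩
  · obtain ⟨k, rfl⟩ := ZFSet.mem_range.1 hz
    exact ZFSet.pair_mem_prod.2 ⟨mem_natCast_toZFSet.2 ⟨k, k.2, rfl⟩, h k⟩
  · obtain ⟨k, hk, rfl⟩ := mem_natCast_toZFSet.1 hz
    refine ⟨f ⟨k, hk⟩, ZFSet.mem_range.2 ⟨⟨k, hk⟩, rfl⟩, fun w hw => ?_⟩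
    obtain ⟨l, hl⟩ := ZFSet.mem_range.1 hw
    obtain ⟨h1, h2⟩ := ZFSet.pair_inj.1 hl
    have h3 : (l : ℕ) = k := by exact_mod_cast Ordinal.toZFSet_injective h1
    have h4 : l = ⟨k, hk⟩ := Fin.ext h3
    rw [← h2, h4]

theorem card_tuples_lt {χ : Cardinal.{u}} (hχ : ℵ₀ ≤ χ) {n : ℕ} {X : ZFSet.{u}} (hX : X.card < χ) :
    (tuples n X).card < χ := by
  have h : (tuples n X).card ≤ #(Fin n → Shrink.{u} X) := by
    refine zf_card_le_of_surj
      (fun f => mkTuple n (fun k => ((equivShrink X).symm (f k)).1)) fun t ht => ?_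
    obtain ⟨f, hf, rfl⟩ := exists_eq_mkTuple ht
    exact ⟨fun k => equivShrink X ⟨f k, hf k⟩, by simp⟩
  refine h.trans_lt ?_
  have h2 : #(Fin n → Shrink.{u} X) = X.card ^ n := by
    simp only [mk_pi, prod_const, mk_fin, Cardinal.lift_natCast, Cardinal.lift_uzero, power_natCast]
    rfl
  rw [h2, ← power_natCast]
  rcases lt_or_ge X.card ℵ₀ with h1 | h1
  · exact (power_lt_aleph0 h1 (natCast_lt_aleph0)).trans_le hχ
  · exact (power_nat_le h1).trans_lt hX

theorem InH.mkTuple {χ : Cardinal.{u}} (hχ : ℵ₀ ≤ χ) {a : Ordinal.{u}} (ha : ω ≤ a) {n : ℕ}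
    {f : Fin n → ZFSet.{u}} (h : ∀ k, InH χ a (f k)) : InH χ a (mkTuple n f) := by
  refine InH.set _ (fun y hy => ?_) ((zf_card_fin_range _).trans_le hχ)
  obtain ⟨k, rfl⟩ := ZFSet.mem_range.1 hy
  exact InH.pair hχ (InH.ord _ ((natCast_lt_omega0 _).trans_le ha)) (h k)

/-- The interpretation of the symbol `σ`, and `∅` if there is none. -/
noncomputable def PreModel.val (M : PreModel.{u}) (σ : ZFSet.{u}) : ZFSet.{u} :=
  open Classical in if h : ∃ R, ZFSet.pair σ R ∈ M.interp then h.choose else ∅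

theorem PreModel.WellFormed.val_mem {M : PreModel.{u}} (h : M.WellFormed) {σ : ZFSet.{u}}
    (hσ : σ ∈ M.voc) : ZFSet.pair σ (M.val σ) ∈ M.interp := by
  have h' : ∃ R, ZFSet.pair σ R ∈ M.interp := (h.interp_fun σ hσ).exists
  rw [PreModel.val, dif_pos h']
  exact h'.choose_spec

theorem PreModel.WellFormed.mem_voc {M : PreModel.{u}} (h : M.WellFormed) {σ R : ZFSet.{u}}
    (hσ : ZFSet.pair σ R ∈ M.interp) : σ ∈ M.voc := by
  obtain ⟨τ, hτ, R', e⟩ := h.interp_dom _ hσ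
  rwa [(ZFSet.pair_inj.1 e).1]

theorem PreModel.WellFormed.eq_val {M : PreModel.{u}} (h : M.WellFormed) {σ R : ZFSet.{u}}
    (hσ : ZFSet.pair σ R ∈ M.interp) : R = M.val σ :=
  (h.interp_fun σ (h.mem_voc hσ)).unique hσ (h.val_mem (h.mem_voc hσ))

theorem PreModel.WellFormed.val_of_notMem {M : PreModel.{u}} (h : M.WellFormed) {σ : ZFSet.{u}}
    (hσ : σ ∉ M.voc) : M.val σ = ∅ := by
  rw [PreModel.val, dif_neg]
  rintro ⟨R, hR⟩
  exact hσ (h.mem_voc hR)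

/-- The union of the models `P j`, for `j < o`. -/
noncomputable def limitModel (o : Ordinal.{u}) (P : Ordinal.{u} → PreModel.{u}) : PreModel.{u} where
  U := ZFSet.iUnion fun j : Set.Iio o => (P j).U
  voc := ZFSet.iUnion fun j : Set.Iio o => (P j).voc
  interp := ZFSet.range fun σ : ZFSet.iUnion fun j : Set.Iio o => (P j).voc =>
    ZFSet.pair σ (ZFSet.iUnion fun j : Set.Iio o => (P j).val σ)
  A := ZFSet.iUnion fun j : Set.Iio o => (P j).A
  B := ZFSet.iUnion fun j : Set.Iio o => (P j).B

theorem mem_iUnion_Iio {o : Ordinal.{u}} {f : Ordinal.{u} → ZFSet.{u}} {x : ZFSet.{u}} :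
    x ∈ ZFSet.iUnion (fun j : Set.Iio o => f j) ↔ ∃ j < o, x ∈ f j := by
  rw [ZFSet.mem_iUnion]
  constructor
  · rintro ⟨j, h⟩; exact ⟨j, j.2, h⟩
  · rintro ⟨j, hj, h⟩; exact ⟨⟨j, hj⟩, h⟩

section limit

variable {lam θ χ : Cardinal.{u}} {P : Ordinal.{u} → PreModel.{u}} {η : Ordinal.{u} → Ordinal.{u}}

theorem mem_limitModel_interp {o : Ordinal.{u}} {σ R : ZFSet.{u}} :
    ZFSet.pair σ R ∈ (limitModel o P).interp ↔ σ ∈ (limitModel o P).voc ∧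
      R = ZFSet.iUnion fun j : Set.Iio o => (P j).val σ := by
  simp only [limitModel, ZFSet.mem_range]
  constructor
  · rintro ⟨⟨τ, hτ⟩, h⟩
    obtain ⟨h1, rfl⟩ := ZFSet.pair_inj.1 h
    cases h1
    exact ⟨hτ, rfl⟩
  · rintro ⟨h, rfl⟩
    exact ⟨⟨σ, h⟩, rfl⟩

theorem exists_tuple_stage (hθ : ℵ₀ ≤ θ)
    (hU : ∀ j i, j ≤ i → i < θ.ord → (P j).U ⊆ (P i).U) {n : ℕ} {t : ZFSet.{u}}
    (ht : t ∈ tuples n (limitModel θ.ord P).U) : ∃ j < θ.ord, t ∈ tuples n (P j).U := by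
  obtain ⟨f, hf, rfl⟩ := exists_eq_mkTuple ht
  have hf' : ∀ k, ∃ j < θ.ord, f k ∈ (P j).U := fun k => mem_iUnion_Iio (f := fun j => (P j).U).1 (hf k)
  choose g hg hfg using hf'
  have hθ0 : 0 < θ.ord := (isSuccLimit_ord hθ).bot_lt
  refine ⟨Finset.univ.sup g, (Finset.sup_lt_iff hθ0).2 fun k _ => hg k, mkTuple_mem fun k => ?_⟩
  exact hU _ _ (Finset.le_sup (Finset.mem_univ k)) ((Finset.sup_lt_iff hθ0).2 fun k _ => hg k) (hfg k)

theorem PreModel.Sub.val_pred {M N : PreModel.{u}} (h : M.Sub N) (hM : M.WellFormed)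
    (hN : N.WellFormed) {s : ZFSet.{u}} {n : ℕ} (hs : predSym s n ∈ M.voc) {t : ZFSet.{u}}
    (ht : t ∈ tuples n M.U) : t ∈ M.val (predSym s n) ↔ t ∈ N.val (predSym s n) :=
  h.pred s n _ _ (hM.val_mem hs) (hN.val_mem (h.voc hs)) t ht

theorem PreModel.Sub.val_func {M N : PreModel.{u}} (h : M.Sub N) (hM : M.WellFormed)
    (hN : N.WellFormed) {s : ZFSet.{u}} {n : ℕ} (hs : funSym s n ∈ M.voc) {t : ZFSet.{u}}
    (ht : t ∈ tuples n M.U) (v : ZFSet.{u}) :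
    ZFSet.pair t v ∈ M.val (funSym s n) ↔ ZFSet.pair t v ∈ N.val (funSym s n) :=
  h.func s n _ _ (hM.val_mem hs) (hN.val_mem (h.voc hs)) t ht v

/-- An admissible model after the first of a chain has size `< χ`. -/
theorem IsModelChain.card_lt {δ : Ordinal.{u}} (h : IsModelChain lam χ δ P η)
    (hδ : IsSuccLimit δ) {i : Ordinal.{u}} (hi : i < δ) : (P i).U.card < χ := by
  have hi1 : i + 1 < δ := hδ.add_one_lt hi
  have hsub : (P i).U ⊆ (P (i + 1)).U := (h.mono i (i + 1) le_self_add hi1).univ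
  refine (ZFSet.card_mono hsub).trans_lt ?_
  have hin : InH χ lam.ord (P (i + 1)).U := (h.adm _ hi1).mem.of_pair.1.of_pair.1
  rcases hin.card_lt_or with h1 | ⟨a, -, ha⟩
  · exact h1
  · exfalso
    have hm := h.models_mem i hi1
    rw [ha] at hm
    obtain ⟨b, -, hb⟩ := Ordinal.mem_toZFSet_iff.1 hm
    exact seqCode_ne_toZFSet (zero_le.trans_lt (lt_add_one i)) b hb.symm

theorem card_prod_lt (hχ : ℵ₀ ≤ χ) {x y : ZFSet.{u}} (hx : x.card < χ) (hy : y.card < χ) :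
    (ZFSet.prod x y).card < χ := by
  have h : (ZFSet.prod x y).card ≤ #(Shrink.{u} x × Shrink.{u} y) := by
    refine zf_card_le_of_surj
      (fun p => ZFSet.pair ((equivShrink x).symm p.1).1 ((equivShrink y).symm p.2).1) fun z hz => ?_
    obtain ⟨a, ha, b, hb, rfl⟩ := ZFSet.mem_prod.1 hz
    exact ⟨(equivShrink x ⟨a, ha⟩, equivShrink y ⟨b, hb⟩), by simp⟩
  refine h.trans_lt ?_
  rw [mk_prod, Cardinal.lift_id, Cardinal.lift_id]
  exact mul_lt_of_lt hχ hx hy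

theorem mem_limitModel_val_pred (h : IsModelChain lam χ θ.ord P η) {i : Ordinal.{u}}
    (hi : i < θ.ord) {s : ZFSet.{u}} {n : ℕ} (hs : predSym s n ∈ (P i).voc) {t : ZFSet.{u}}
    (ht : t ∈ tuples n (P i).U) :
    t ∈ (ZFSet.iUnion fun j : Set.Iio θ.ord => (P j).val (predSym s n)) ↔
      t ∈ (P i).val (predSym s n) := by
  rw [mem_iUnion_Iio (f := fun j => (P j).val (predSym s n))]
  constructor
  · rintro ⟨j, hj, htj⟩
    have wf := fun k hk => (h.adm k hk).wf
    have hsj : predSym s n ∈ (P j).voc := by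
      by_contra hc
      rw [(wf j hj).val_of_notMem hc] at htj
      exact ZFSet.notMem_empty _ htj
    have htj' := (wf j hj).interp_pred s n _ ((wf j hj).val_mem hsj) htj
    have hk : max i j < θ.ord := max_lt hi hj
    rw [(h.mono j _ (le_max_right i j) hk).val_pred (wf j hj) (wf _ hk) hsj htj'] at htj
    exact ((h.mono i _ (le_max_left i j) hk).val_pred (wf i hi) (wf _ hk) hs ht).2 htj
  · exact fun h' => ⟨i, hi, h'⟩

theorem mem_limitModel_val_func (h : IsModelChain lam χ θ.ord P η) {i : Ordinal.{u}}
    (hi : i < θ.ord) {s : ZFSet.{u}} {n : ℕ} (hs : funSym s n ∈ (P i).voc) {t : ZFSet.{u}}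
    (ht : t ∈ tuples n (P i).U) (v : ZFSet.{u}) :
    ZFSet.pair t v ∈ (ZFSet.iUnion fun j : Set.Iio θ.ord => (P j).val (funSym s n)) ↔
      ZFSet.pair t v ∈ (P i).val (funSym s n) := by
  rw [mem_iUnion_Iio (f := fun j => (P j).val (funSym s n))]
  constructor
  · rintro ⟨j, hj, htj⟩
    have wf := fun k hk => (h.adm k hk).wf
    have hsj : funSym s n ∈ (P j).voc := by
      by_contra hc
      rw [(wf j hj).val_of_notMem hc] at htj
      exact ZFSet.notMem_empty _ htj
    have htj' := (ZFSet.pair_mem_prod.1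
      (((wf j hj).interp_func s n _ ((wf j hj).val_mem hsj)).1 htj)).1
    have hk : max i j < θ.ord := max_lt hi hj
    rw [(h.mono j _ (le_max_right i j) hk).val_func (wf j hj) (wf _ hk) hsj htj'] at htj
    exact ((h.mono i _ (le_max_left i j) hk).val_func (wf i hi) (wf _ hk) hs ht v).2 htj
  · exact fun h' => ⟨i, hi, h'⟩

theorem subset_limitModel {i : Ordinal.{u}} (hi : i < θ.ord) :
    (P i).U ⊆ (limitModel θ.ord P).U :=
  fun _ hx => mem_iUnion_Iio (f := fun j => (P j).U).2 ⟨i, hi, hx⟩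

theorem mem_limitModel_U {x : ZFSet.{u}} :
    x ∈ (limitModel θ.ord P).U ↔ ∃ j < θ.ord, x ∈ (P j).U :=
  mem_iUnion_Iio (f := fun j => (P j).U)

theorem mem_limitModel_voc {x : ZFSet.{u}} :
    x ∈ (limitModel θ.ord P).voc ↔ ∃ j < θ.ord, x ∈ (P j).voc :=
  mem_iUnion_Iio (f := fun j => (P j).voc)

theorem mem_limitModel_A {x : ZFSet.{u}} :
    x ∈ (limitModel θ.ord P).A ↔ ∃ j < θ.ord, x ∈ (P j).A :=
  mem_iUnion_Iio (f := fun j => (P j).A)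

theorem mem_limitModel_B {x : ZFSet.{u}} :
    x ∈ (limitModel θ.ord P).B ↔ ∃ j < θ.ord, x ∈ (P j).B :=
  mem_iUnion_Iio (f := fun j => (P j).B)

theorem limitModel_wellFormed (hθ : ℵ₀ ≤ θ) (h : IsModelChain lam χ θ.ord P η) :
    (limitModel θ.ord P).WellFormed := by
  have wf := fun k hk => (h.adm k hk).wf
  have hU : ∀ j i, j ≤ i → i < θ.ord → (P j).U ⊆ (P i).U := fun j i hji hi =>
    (h.mono j i hji hi).univ
  refine ⟨?_, ?_, ?_, ?_, ?_⟩
  · intro σ hσ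
    obtain ⟨j, hj, hσ⟩ := mem_limitModel_voc.1 hσ
    exact (wf j hj).symbols σ hσ
  · intro z hz
    obtain ⟨σ, rfl⟩ := ZFSet.mem_range.1 hz
    exact ⟨σ, σ.2, _, rfl⟩
  · intro σ hσ
    exact ⟨_, mem_limitModel_interp.2 ⟨hσ, rfl⟩, fun R hR => (mem_limitModel_interp.1 hR).2⟩
  · intro s n R hR t ht
    obtain ⟨-, rfl⟩ := mem_limitModel_interp.1 hR
    obtain ⟨j, hj, htj⟩ := (mem_iUnion_Iio (f := fun j => (P j).val (predSym s n))).1 ht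
    have hsj : predSym s n ∈ (P j).voc := by
      by_contra hc
      rw [(wf j hj).val_of_notMem hc] at htj
      exact ZFSet.notMem_empty _ htj
    exact tuples_mono (subset_limitModel hj) ((wf j hj).interp_pred s n _ ((wf j hj).val_mem hsj) htj)
  · intro s n R hR
    obtain ⟨hs, rfl⟩ := mem_limitModel_interp.1 hR
    refine ⟨fun z hz => ?_, fun t ht => ?_⟩
    · obtain ⟨j, hj, hzj⟩ := (mem_iUnion_Iio (f := fun j => (P j).val (funSym s n))).1 hz
      have hsj : funSym s n ∈ (P j).voc := by
        by_contra hc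
        rw [(wf j hj).val_of_notMem hc] at hzj
        exact ZFSet.notMem_empty _ hzj
      obtain ⟨t, ht, v, hv, rfl⟩ := ZFSet.mem_prod.1
        (((wf j hj).interp_func s n _ ((wf j hj).val_mem hsj)).1 hzj)
      exact ZFSet.pair_mem_prod.2 ⟨tuples_mono (subset_limitModel hj) ht, subset_limitModel hj hv⟩
    · obtain ⟨i, hi, hti⟩ := exists_tuple_stage hθ hU ht
      obtain ⟨j, hj, hsj⟩ := mem_limitModel_voc.1 hs
      have hk : max i j < θ.ord := max_lt hi hj
      have hsk := (h.mono j _ (le_max_right i j) hk).voc hsj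
      have htk := tuples_mono (hU i _ (le_max_left i j) hk) hti
      simp only [mem_limitModel_val_func h hk hsk htk]
      exact ((wf _ hk).interp_func s n _ ((wf _ hk).val_mem hsk)).2 t htk

theorem sub_limitModel (h : IsModelChain lam χ θ.ord P η) {i : Ordinal.{u}}
    (hi : i < θ.ord) : (P i).Sub (limitModel θ.ord P) := by
  have wf := fun k hk => (h.adm k hk).wf
  have key : ∀ j < θ.ord, ∀ x ∈ (P i).U, x ∈ (P j).U →
      ((x ∈ (P j).A → x ∈ (P i).A) ∧ (x ∈ (P j).B → x ∈ (P i).B)) := by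
    intro j hj x hx hxj
    have hk : max i j < θ.ord := max_lt hi hj
    have h1 := h.mono i _ (le_max_left i j) hk
    have h2 := h.mono j _ (le_max_right i j) hk
    exact ⟨fun h' => (h1.A x hx).2 ((h2.A x hxj).1 h'), fun h' => (h1.B x hx).2 ((h2.B x hxj).1 h')⟩
  refine ⟨subset_limitModel hi, fun x hx => mem_limitModel_voc.2 ⟨i, hi, hx⟩, ?_, ?_, ?_, ?_⟩
  · intro s n R R' hR hR' t ht
    obtain ⟨-, rfl⟩ := mem_limitModel_interp.1 hR'
    obtain rfl := (wf i hi).eq_val hR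
    exact (mem_limitModel_val_pred h hi ((wf i hi).mem_voc hR) ht).symm
  · intro s n R R' hR hR' t ht v
    obtain ⟨-, rfl⟩ := mem_limitModel_interp.1 hR'
    obtain rfl := (wf i hi).eq_val hR
    exact (mem_limitModel_val_func h hi ((wf i hi).mem_voc hR) ht v).symm
  · intro x hx
    refine ⟨fun h' => mem_limitModel_A.2 ⟨i, hi, h'⟩, fun h' => ?_⟩
    obtain ⟨j, hj, hxj⟩ := mem_limitModel_A.1 h'
    exact (key j hj x hx ((h.adm j hj).A_sub x hxj).1).1 hxj
  · intro x hx
    refine ⟨fun h' => mem_limitModel_B.2 ⟨i, hi, h'⟩, fun h' => ?_⟩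
    obtain ⟨j, hj, hxj⟩ := mem_limitModel_B.1 h'
    exact (key j hj x hx ((h.adm j hj).B_sub x hxj).1).2 hxj

theorem limitModel_admissible (hθ : ℵ₀ ≤ θ) (hχ : χ.IsRegular) (hθχ : θ < χ)
    (hχl : χ ≤ lam) (h : IsModelChain lam χ θ.ord P η) :
    (limitModel θ.ord P).Admissible lam χ := by
  have hθl := isSuccLimit_ord hθ
  have hχ0 := hχ.aleph0_le
  have hω : ω ≤ lam.ord := by
    rw [← ord_aleph0, ord_le_ord]; exact hχ0.trans hχl
  have hχl' : χ.ord ≤ lam.ord := ord_le_ord.2 hχl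
  have hwf := limitModel_wellFormed hθ h
  have hcθ : #(Shrink.{u} (Set.Iio θ.ord)) < χ := by rwa [card_shrink_Iio, card_ord]
  have hUc : (limitModel θ.ord P).U.card < χ :=
    zf_card_iUnion_lt hχ hcθ _ fun j => h.card_lt hθl j.2
  have hUH : ∀ x ∈ (limitModel θ.ord P).U, InH χ lam.ord x := by
    intro x hx
    obtain ⟨j, hj, hx⟩ := mem_limitModel_U.1 hx
    exact (h.adm j hj).univ x hx
  have hvocc : (limitModel θ.ord P).voc.card < χ :=
    zf_card_iUnion_lt hχ hcθ _ fun j => (h.adm j j.2).voc.card_lt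
  have hvocH : InH χ χ.ord (limitModel θ.ord P).voc := by
    refine InH.set _ (fun x hx => ?_) hvocc
    obtain ⟨j, hj, hx⟩ := mem_limitModel_voc.1 hx
    exact (h.adm j hj).voc.of_mem hx
  have hA : ∀ x ∈ (limitModel θ.ord P).A, x ∈ (limitModel θ.ord P).U ∧
      ∃ a < lam.ord, a.toZFSet = x := by
    intro x hx
    obtain ⟨j, hj, hx⟩ := mem_limitModel_A.1 hx
    exact ⟨subset_limitModel hj ((h.adm j hj).A_sub x hx).1, ((h.adm j hj).A_sub x hx).2⟩
  have hB : ∀ x ∈ (limitModel θ.ord P).B, x ∈ (limitModel θ.ord P).U ∧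
      ∃ a < lam.ord, a.toZFSet = x := by
    intro x hx
    obtain ⟨j, hj, hx⟩ := mem_limitModel_B.1 hx
    exact ⟨subset_limitModel hj ((h.adm j hj).B_sub x hx).1, ((h.adm j hj).B_sub x hx).2⟩
  have hsub : ∀ X : ZFSet.{u}, X ⊆ (limitModel θ.ord P).U → InH χ lam.ord X := fun X hX =>
    InH.set _ (fun x hx => hUH x (hX hx)) ((ZFSet.card_mono hX).trans_lt hUc)
  have htup : ∀ n, ∀ t ∈ tuples n (limitModel θ.ord P).U, InH χ lam.ord t := by
    intro n t ht
    obtain ⟨f, hf, rfl⟩ := exists_eq_mkTuple ht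
    exact InH.mkTuple hχ0 hω fun k => hUH _ (hf k)
  have hinterp : InH χ lam.ord (limitModel θ.ord P).interp := by
    refine InH.set _ (fun z hz => ?_) ((zf_card_range_le _).trans_lt hvocc)
    obtain ⟨σ, hσ, R, rfl⟩ := hwf.interp_dom z hz
    refine InH.pair hχ0 ((hvocH.of_mem hσ).mono hχl') ?_
    obtain ⟨s, n, rfl | rfl⟩ := hwf.symbols σ hσ
    · have hR := hwf.interp_pred s n R hz
      exact InH.set _ (fun t ht => htup n t (hR ht))
        ((ZFSet.card_mono hR).trans_lt (card_tuples_lt hχ0 hUc))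
    · have hR := (hwf.interp_func s n R hz).1
      refine InH.set _ (fun y hy => ?_)
        ((ZFSet.card_mono hR).trans_lt (card_prod_lt hχ0 (card_tuples_lt hχ0 hUc) hUc))
      obtain ⟨t, ht, v, hv, rfl⟩ := ZFSet.mem_prod.1 (hR hy)
      exact InH.pair hχ0 (htup n t ht) (hUH v hv)
  refine ⟨hwf, hUH, ?_, hvocH, ?_, ?_, hA, hB, ?_⟩
  · exact InH.pair hχ0
      (InH.pair hχ0 (hsub _ fun _ hx => hx) (InH.pair hχ0 (hvocH.mono hχl') hinterp))
      (InH.pair hχ0 (hsub _ fun x hx => (hA x hx).1) (hsub _ fun x hx => (hB x hx).1))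
  · intro a b hab hb hbU
    obtain ⟨j, hj, hbj⟩ := mem_limitModel_U.1 hbU
    exact subset_limitModel hj ((h.adm j hj).inter_ordinal a b hab hb hbj)
  · intro μ hμ a ha
    exact subset_limitModel hθl.bot_lt ((h.adm _ hθl.bot_lt).succ μ hμ a ha)
  · intro heq
    have h0 := h.adm _ hθl.bot_lt
    have hs := sub_limitModel h hθl.bot_lt
    refine h0.ne ?_
    ext x
    constructor
    · intro hx
      have hxU := (h0.A_sub x hx).1
      exact (hs.B x hxU).2 (heq ▸ (hs.A x hxU).1 hx)
    · intro hx
      have hxU := (h0.B_sub x hx).1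
      exact (hs.A x hxU).2 (heq.symm ▸ (hs.B x hxU).1 hx)

/-- The chain `P` of length `θ`, prolonged by its union at `θ`. -/
noncomputable def closeChain (θ : Cardinal.{u}) (P : Ordinal.{u} → PreModel.{u})
    (i : Ordinal.{u}) : PreModel.{u} :=
  open Classical in if i < θ.ord then P i else limitModel θ.ord P

theorem closeChain_of_lt {i : Ordinal.{u}} (hi : i < θ.ord) : closeChain θ P i = P i := if_pos hi

theorem closeChain_self : closeChain θ P θ.ord = limitModel θ.ord P := if_neg (lt_irrefl _)

theorem IsModelChain.close (hθ : ℵ₀ ≤ θ) (hχ : χ.IsRegular) (hθχ : θ < χ)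
    (hχl : χ ≤ lam) (h : IsModelChain lam χ θ.ord P η) :
    IsModelChain lam χ (θ.ord + 1) (closeChain θ P) η := by
  have hθl := isSuccLimit_ord hθ
  have hcase : ∀ i < θ.ord + 1, i < θ.ord ∨ i = θ.ord := fun i hi =>
    (lt_add_one_iff.1 hi).lt_or_eq
  have hsucc : ∀ i, i + 1 < θ.ord + 1 → i + 1 < θ.ord := fun i hi =>
    hθl.add_one_lt (lt_of_lt_of_le (lt_add_one i) (lt_add_one_iff.1 hi))
  refine ⟨?_, ?_, ?_, ?_, ?_, ?_⟩
  · intro i hi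
    rcases hcase i hi with hi | rfl
    · rw [closeChain_of_lt hi]; exact h.adm i hi
    · rw [closeChain_self]; exact limitModel_admissible hθ hχ hθχ hχl h
  · intro j i hji hi
    rcases hcase i hi with hi | rfl
    · rw [closeChain_of_lt hi, closeChain_of_lt (hji.trans_lt hi)]; exact h.mono j i hji hi
    · rcases hji.lt_or_eq with hj | rfl
      · rw [closeChain_of_lt hj, closeChain_self]; exact sub_limitModel h hj
      · have hwf := limitModel_wellFormed hθ h
        rw [closeChain_self]
        refine ⟨fun _ h => h, fun _ h => h, ?_, ?_, fun _ _ => Iff.rfl, fun _ _ => Iff.rfl⟩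
        · intro s n R R' hR hR' t _
          rw [hwf.eq_val hR, hwf.eq_val hR']
        · intro s n R R' hR hR' t _ v
          rw [hwf.eq_val hR, hwf.eq_val hR']
  · intro i hi hil x
    rcases hcase i hi with hi | rfl
    · rw [closeChain_of_lt hi, h.cont_univ i hi hil]
      exact ⟨fun ⟨j, hj, hx⟩ => ⟨j, hj, by rwa [closeChain_of_lt (hj.trans hi)]⟩,
        fun ⟨j, hj, hx⟩ => ⟨j, hj, by rwa [closeChain_of_lt (hj.trans hi)] at hx⟩⟩
    · rw [closeChain_self, mem_limitModel_U]
      exact ⟨fun ⟨j, hj, hx⟩ => ⟨j, hj, by rwa [closeChain_of_lt hj]⟩,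
        fun ⟨j, hj, hx⟩ => ⟨j, hj, by rwa [closeChain_of_lt hj] at hx⟩⟩
  · intro i hi hil x
    rcases hcase i hi with hi | rfl
    · rw [closeChain_of_lt hi, h.cont_voc i hi hil]
      exact ⟨fun ⟨j, hj, hx⟩ => ⟨j, hj, by rwa [closeChain_of_lt (hj.trans hi)]⟩,
        fun ⟨j, hj, hx⟩ => ⟨j, hj, by rwa [closeChain_of_lt (hj.trans hi)] at hx⟩⟩
    · rw [closeChain_self, mem_limitModel_voc]
      exact ⟨fun ⟨j, hj, hx⟩ => ⟨j, hj, by rwa [closeChain_of_lt hj]⟩,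
        fun ⟨j, hj, hx⟩ => ⟨j, hj, by rwa [closeChain_of_lt hj] at hx⟩⟩
  · intro i hi
    have hi' := hsucc i hi
    rw [closeChain_of_lt hi', seqCode_eq_iff.2 ⟨rfl, fun k hk => by
      rw [closeChain_of_lt (hk.trans hi')]⟩]
    exact h.models_mem i hi'
  · intro i hi
    have hi' := hsucc i hi
    rw [closeChain_of_lt hi']
    exact h.seq_mem i hi'

end limit

end LimitModel

/-- The ordinal below `o` that corresponds to an element of `o.ToType`. -/
noncomputable def ordVal {o : Ordinal.{u}} (z : o.ToType) : Ordinal.{u} := (ToType.toOrd z).1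

theorem ordVal_lt {o : Ordinal.{u}} (z : o.ToType) : ordVal z < o := (ToType.toOrd z).2

theorem ordVal_injective {o : Ordinal.{u}} : Function.Injective (ordVal (o := o)) :=
  fun _ _ h => ToType.mk.symm.injective (Subtype.ext h)

theorem ordVal_lt_ordVal {o : Ordinal.{u}} {y z : o.ToType} : ordVal y < ordVal z ↔ y < z :=
  ToType.mk.symm.lt_iff_lt (x := y) (y := z)

theorem exists_ordVal_eq {o a : Ordinal.{u}} (h : a < o) : ∃ z : o.ToType, ordVal z = a :=
  ⟨ToType.mk ⟨a, h⟩, congrArg Subtype.val (ToType.mk.symm_apply_apply ⟨a, h⟩)⟩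

/-- Extension of a function on `o.ToType` to all ordinals. -/
noncomputable def ordLift {o : Ordinal.{u}} {α : Type*} (f : o.ToType → α) (d : α)
    (i : Ordinal.{u}) : α :=
  open Classical in if h : ∃ z : o.ToType, ordVal z = i then f h.choose else d

theorem ordLift_ordVal {o : Ordinal.{u}} {α : Type*} (f : o.ToType → α) (d : α) (z : o.ToType) :
    ordLift f d (ordVal z) = f z := by
  have h : ∃ y : o.ToType, ordVal y = ordVal z := ⟨z, rfl⟩
  rw [ordLift, dif_pos h, ordVal_injective h.choose_spec]

theorem ordLift_mem {o : Ordinal.{u}} {α : Type*} {f : o.ToType → α} {d : α} {p : α → Prop}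
    (hf : ∀ z, p (f z)) (hd : p d) (i : Ordinal.{u}) : p (ordLift f d i) := by
  rw [ordLift]; split_ifs
  exacts [hf _, hd]

theorem pow_lt_self_le {lam θ χ : Cardinal.{u}} (hχ : χ.IsRegular) (hθχ : θ < χ)
    (hpow : lam ^ θ = powerlt lam χ) {μ : Cardinal.{u}} (hμ : μ < χ) :
    (lam ^ θ) ^ μ ≤ lam ^ θ := by
  rw [← power_mul]
  conv_rhs => rw [hpow]
  exact le_powerlt lam (mul_lt_of_lt hχ.aleph0_le hθχ hμ)

/-- The sets in `H_{<χ}(lam)` can be enumerated by a type of size `lam ^ θ`. -/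
theorem exists_enum_InH {lam θ χ : Cardinal.{u}} (hθ : θ.IsRegular) (hχ : χ.IsRegular)
    (hθχ : θ < χ) (hχl : χ ≤ lam) (hpow : lam ^ θ = powerlt lam χ) :
    ∃ (T : Type u) (D : T → ZFSet.{u}), #T ≤ lam ^ θ ∧ ∀ x, InH χ lam.ord x → ∃ t, D t = x := by
  classical
  set κ := lam ^ θ with hκ
  have hlamκ : lam ≤ κ := self_le_power lam (one_le_aleph0.trans hθ.aleph0_le)
  have hχκ : χ ≤ κ := hχl.trans hlamκ
  have hκ0 : ℵ₀ ≤ κ := hχ.aleph0_le.trans hχκ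
  let X := χ.ord.ToType
  let A := κ.ord.ToType
  have hX : #X = χ := by simp [X]
  have hA : #A = κ := by simp [A]
  have hXA : #(X × A) = κ := by
    rw [mk_prod, Cardinal.lift_id, Cardinal.lift_id, hX, hA]
    exact mul_eq_right hκ0 hχκ hχ.pos.ne'
  let C := lam.ord.ToType ⊕ (Σ c : X, ((ordVal c).ToType → X × A))
  have hC : #C ≤ #A := by
    rw [hA]
    simp only [C, mk_sum, Cardinal.lift_id, mk_sigma]
    refine add_le_of_le hκ0 (by simpa using hlamκ) ?_
    refine (sum_le_mk_mul_iSup _).trans ?_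
    rw [hX]
    refine (mul_le_mul' hχκ (ciSup_le' fun c => ?_)).trans (mul_eq_self hκ0).le
    simp only [mk_pi, prod_const, Cardinal.lift_id, hXA, mk_toType]
    exact pow_lt_self_le hχ hθχ hpow (lt_ord.1 (ordVal_lt c))
  have : Nonempty C := ⟨Sum.inl (exists_ordVal_eq
    (lt_ord.2 (by rw [card_zero]; exact hχ.pos.trans_le hχl) : 0 < lam.ord)).choose⟩
  obtain ⟨emb⟩ := (Cardinal.le_def _ _).1 hC
  let e : A → C := Function.invFun emb
  have he : Function.Surjective e := Function.invFun_surjective emb.injective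
  let G : (i : X) → ((j : X) → j < i → A → ZFSet.{u}) → A → ZFSet.{u} := fun i f a =>
    match e a with
    | Sum.inl o => (ordVal o).toZFSet
    | Sum.inr ⟨_, g⟩ => ZFSet.range fun y => if h : (g y).1 < i then f (g y).1 h (g y).2 else ∅
  let f : X → A → ZFSet.{u} := WellFounded.fix (C := fun _ => A → ZFSet.{u}) wellFounded_lt G
  have hf : ∀ i a, f i a = G i (fun j _ => f j) a := fun i a => by
    simp only [f]; rw [WellFounded.fix_eq]
  refine ⟨X × A, fun t => f t.1 t.2, hXA.le, fun x hx => ?_⟩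
  induction hx with
  | ord i hi =>
    obtain ⟨o, rfl⟩ := exists_ordVal_eq hi
    obtain ⟨z, -⟩ := exists_ordVal_eq hχ.ord_pos
    obtain ⟨a, ha⟩ := he (Sum.inl o)
    exact ⟨(z, a), by simp only [hf, G, ha]⟩
  | set x hx hc ih =>
    have : Nonempty (X × A) := mk_ne_zero_iff.1 (by rw [hXA]; exact (aleph0_pos.trans_le hκ0).ne')
    choose! t ht using ih
    have ht' : ∀ y ∈ x, f (t y).1 (t y).2 = y := ht
    obtain ⟨b, hb, hbt⟩ := exists_bound_zf (o := χ.ord) (by rwa [hχ.cof_ord])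
      (fun y => ordVal (t y).1) (fun y _ => ordVal_lt (t y).1)
    obtain ⟨b, rfl⟩ := exists_ordVal_eq hb
    obtain ⟨c, hcx⟩ := exists_ordVal_eq (ord_lt_ord.2 hc)
    have hcc : #((ordVal c).ToType) = #(Shrink.{u} x) := by
      rw [mk_toType, hcx, card_ord]
      rfl
    obtain ⟨E⟩ := Cardinal.eq.1 hcc
    obtain ⟨a, ha⟩ := he (Sum.inr ⟨c, fun y => t ((equivShrink x).symm (E y)).1⟩)
    refine ⟨(b, a), ?_⟩
    have hlt : ∀ y ∈ x, (t y).1 < b := fun y hy => ordVal_lt_ordVal.1 (hbt y hy)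
    change f b a = x
    rw [hf]
    simp only [G, ha]
    ext z
    rw [ZFSet.mem_range]
    constructor
    · rintro ⟨y, rfl⟩
      have hy := ((equivShrink x).symm (E y)).2
      rw [dif_pos (hlt _ hy), ht' _ hy]
      exact hy
    · intro hz
      refine ⟨E.symm (equivShrink x ⟨z, hz⟩), ?_⟩
      simp only [Equiv.apply_symm_apply, Equiv.symm_apply_apply]
      rw [dif_pos (hlt z hz), ht' z hz]

/-- An injective coding of the sets in `H_{<χ}(lam)` by sequences of length `θ` of ordinals below
`lam`. -/
structure IsCoding (lam θ χ : Cardinal.{u}) (K : ZFSet.{u} → Ordinal.{u} → Ordinal.{u}) : Prop where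
  lt : ∀ x i, K x i < lam.ord
  inj : ∀ x y, InH χ lam.ord x → InH χ lam.ord y → (∀ i < θ.ord, K x i = K y i) → x = y
  bounded : powerlt lam θ = powerlt lam χ → ∀ x, InH χ lam.ord x → ∃ l < θ.ord,
    ∀ y, InH χ lam.ord y → (∀ i < l, K x i = K y i) → x = y

theorem exists_coding {lam θ χ : Cardinal.{u}} (hθ : θ.IsRegular) (hχ : χ.IsRegular)
    (hθχ : θ < χ) (hχl : χ ≤ lam) (hpow : lam ^ θ = powerlt lam χ) :
    ∃ K, IsCoding lam θ χ K := by
  classical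
  obtain ⟨T, D, hT, hD⟩ := exists_enum_InH hθ hχ hθχ hχl hpow
  have hlam0 : 0 < lam.ord := (isSuccLimit_ord (hχ.aleph0_le.trans hχl)).bot_lt
  have : Nonempty T := ⟨(hD ∅ (InH.set _ (fun y hy => absurd hy (ZFSet.notMem_empty y))
    (by rw [ZFSet.card_empty]; exact hχ.pos))).choose⟩
  choose! c hc using hD
  by_cases hb : powerlt lam θ = powerlt lam χ
  · have hT' : #T ≤ #(Σ l : θ.ord.ToType, ((ordVal l).ToType → lam.ord.ToType)) := by
      refine hT.trans ?_
      rw [hpow, ← hb, powerlt_le]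
      intro μ hμ
      obtain ⟨l, hl⟩ := exists_ordVal_eq (ord_lt_ord.2 hμ)
      rw [mk_sigma]
      refine le_trans ?_ (le_sum _ l)
      simp [hl]
    obtain ⟨φ⟩ := (Cardinal.le_def _ _).1 hT'
    let l : ZFSet.{u} → Ordinal.{u} := fun x => ordVal (φ (c x)).1
    let g : ZFSet.{u} → Ordinal.{u} → Ordinal.{u} := fun x =>
      ordLift (fun z => ordVal ((φ (c x)).2 z)) 0
    have hl : ∀ x, l x < θ.ord := fun x => ordVal_lt (φ (c x)).1
    have hg : ∀ x i, g x i < lam.ord := fun x => ordLift_mem (fun z => ordVal_lt _) hlam0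
    have hsig : ∀ p q : (Σ l : θ.ord.ToType, ((ordVal l).ToType → lam.ord.ToType)),
        ordVal p.1 = ordVal q.1 → (∀ i < ordVal p.1,
          ordLift (fun z => ordVal (p.2 z)) 0 i = ordLift (fun z => ordVal (q.2 z)) 0 i) →
          p = q := by
      rintro ⟨p1, p2⟩ ⟨q1, q2⟩ h1 h2
      obtain rfl := ordVal_injective h1
      congr 1
      funext z
      have h4 := h2 (ordVal z) (ordVal_lt z)
      rw [ordLift_ordVal, ordLift_ordVal] at h4
      exact ordVal_injective h4
    have hlg : ∀ x y, InH χ lam.ord x → InH χ lam.ord y → l x = l y → (∀ i < l x, g x i = g y i) →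
        x = y := by
      intro x y hx hy h1 h2
      rw [← hc x hx, ← hc y hy]
      congr 1
      exact φ.injective (hsig _ _ h1 h2)
    let K : ZFSet.{u} → Ordinal.{u} → Ordinal.{u} := fun x i => if i < l x then g x i + 1 else 0
    have hK1 : ∀ x i, i < l x → K x i = g x i + 1 := fun x i h => if_pos h
    have hK0 : ∀ x i, l x ≤ i → K x i = 0 := fun x i h => if_neg h.not_gt
    have hne : ∀ o : Ordinal.{u}, o + 1 ≠ 0 := fun o => (zero_le.trans_lt (lt_add_one o)).ne'
    have hdet : ∀ x, InH χ lam.ord x → ∀ y, InH χ lam.ord y →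
        (∀ i < l x + 1, K x i = K y i) → x = y := by
      intro x hx y hy h
      have hxy : l x = l y := by
        rcases lt_trichotomy (l x) (l y) with h1 | h1 | h1
        · have := h (l x) (lt_add_one _)
          rw [hK0 x _ le_rfl, hK1 y _ h1] at this
          exact absurd this.symm (hne _)
        · exact h1
        · have := h (l y) (h1.trans (lt_add_one _))
          rw [hK0 y _ le_rfl, hK1 x _ h1] at this
          exact absurd this (hne _)
      refine hlg x y hx hy hxy fun i hi => ?_
      have := h i (hi.trans (lt_add_one _))
      rw [hK1 x i hi, hK1 y i (hxy ▸ hi)] at this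
      exact add_one_inj.1 this
    have hθl := isSuccLimit_ord hθ.aleph0_le
    refine ⟨K, fun x i => ?_, fun x y hx hy h => hdet x hx y hy fun i hi =>
      h i (hi.trans (hθl.add_one_lt (hl x))), fun _ x hx =>
      ⟨l x + 1, hθl.add_one_lt (hl x), hdet x hx⟩⟩
    by_cases hi : i < l x
    · rw [hK1 x i hi]
      exact (isSuccLimit_ord (hχ.aleph0_le.trans hχl)).add_one_lt (hg x i)
    · rw [hK0 x i (not_lt.1 hi)]; exact hlam0
  · have hT' : #T ≤ #(θ.ord.ToType → lam.ord.ToType) := by simpa using hT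
    obtain ⟨φ⟩ := (Cardinal.le_def _ _).1 hT'
    refine ⟨fun x => ordLift (fun z => ordVal (φ (c x) z)) 0,
      fun x => ordLift_mem (fun z => ordVal_lt _) hlam0, fun x y hx hy h => ?_, fun h => absurd h hb⟩
    rw [← hc x hx, ← hc y hy]
    congr 1
    apply φ.injective
    funext z
    have h4 := h (ordVal z) (ordVal_lt z)
    rw [ordLift_ordVal, ordLift_ordVal] at h4
    exact ordVal_injective h4

/-- A map on `lam` with unbounded fibres. -/
theorem exists_unbounded_fibres {lam : Cardinal.{u}} (h : ℵ₀ ≤ lam) :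
    ∃ cd : Ordinal.{u} → Ordinal.{u}, ∀ a < lam.ord, ∀ b < lam.ord, ∃ x < lam.ord,
      b < x ∧ cd x = a := by
  classical
  have h1 : #(lam.ord.ToType) = #(lam.ord.ToType × lam.ord.ToType) := by
    simp [mul_eq_self h]
  obtain ⟨e⟩ := Cardinal.eq.1 h1
  refine ⟨ordLift (fun z => ordVal (e z).1) 0, fun a ha b hb => ?_⟩
  obtain ⟨a, rfl⟩ := exists_ordVal_eq ha
  by_contra! hcon
  have hle : ∀ y : lam.ord.ToType, ordVal (e.symm (a, y)) < b + 1 := by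
    intro y
    by_contra! hlt
    refine hcon _ (ordVal_lt _) ((lt_add_one b).trans_le hlt) ?_
    rw [ordLift_ordVal, Equiv.apply_symm_apply]
  choose g hg using fun y => exists_ordVal_eq (hle y)
  have hg : Function.Injective g := by
    intro y y' hy
    have h2 := ordVal_injective (((hg y).symm.trans (congrArg ordVal hy)).trans (hg y'))
    exact (Prod.ext_iff.1 (e.symm.injective h2)).2
  have h5 := Cardinal.mk_le_of_injective hg
  rw [mk_toType, mk_toType, card_ord] at h5
  exact h5.not_gt (lt_ord.1 ((isSuccLimit_ord h).add_one_lt hb))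

/-- A map from `lam` onto `lam × lam × 2`. -/
theorem exists_triple_surj {lam : Cardinal.{u}} (h : ℵ₀ ≤ lam) :
    ∃ d : Ordinal.{u} → Ordinal.{u} × Ordinal.{u} × Prop,
      (∀ t, (d t).1 < lam.ord) ∧
      ∀ b < lam.ord, ∀ a < lam.ord, ∀ p : Prop, ∃ t < lam.ord, d t = (b, a, p) := by
  classical
  have h1 : #(lam.ord.ToType) = #(lam.ord.ToType × lam.ord.ToType × ULift.{u} Bool) := by
    simp only [mk_prod, Cardinal.lift_id, mk_toType, card_ord, mk_uLift]
    have h2 : Cardinal.lift.{u, 0} #Bool ≤ lam := by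
      simpa using (natCast_lt_aleph0 (n := 2)).le.trans h
    rw [mul_eq_left h h2 (by simp), mul_eq_self h]
  obtain ⟨e⟩ := Cardinal.eq.1 h1
  refine ⟨ordLift (fun z => (ordVal (e z).1, ordVal (e z).2.1, (e z).2.2.down = true)) (0, 0, True),
    ordLift_mem (p := fun x : Ordinal.{u} × Ordinal.{u} × Prop => x.1 < lam.ord) (fun z => ordVal_lt _) (isSuccLimit_ord h).bot_lt,
    fun b hb a ha p => ?_⟩
  obtain ⟨b, rfl⟩ := exists_ordVal_eq hb
  obtain ⟨a, rfl⟩ := exists_ordVal_eq ha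
  refine ⟨ordVal (e.symm (b, a, ⟨decide p⟩)), ordVal_lt _, ?_⟩
  simp [ordLift_ordVal]

/-- A map from `θ` onto `θ × θ` whose first coordinate does not exceed the argument, with unbounded
fibres. -/
theorem exists_pairing {θ : Cardinal.{u}} (h : ℵ₀ ≤ θ) :
    ∃ p q : Ordinal.{u} → Ordinal.{u}, (∀ m, p m ≤ m) ∧
      ∀ i < θ.ord, ∀ l < θ.ord, ∀ b < θ.ord, ∃ m < θ.ord, b < m ∧ p m = i ∧ q m = l := by
  classical
  obtain ⟨cd, hcd⟩ := exists_unbounded_fibres h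
  obtain ⟨d, -, hd⟩ := exists_triple_surj h
  refine ⟨fun m => if (d (cd m)).1 ≤ m then (d (cd m)).1 else 0, fun m => (d (cd m)).2.1,
    fun m => ?_, fun i hi l hl b hb => ?_⟩
  · dsimp only
    split_ifs with h'
    · exact h'
    · exact zero_le
  · obtain ⟨t, ht, e⟩ := hd i hi l hl True
    obtain ⟨m, hm, hbm, rfl⟩ := hcd t ht (max b i) (max_lt hb hi)
    refine ⟨m, hm, (le_max_left _ _).trans_lt hbm, ?_, by simp only [e]⟩
    simp only [e]
    rw [if_pos ((le_max_right _ _).trans_lt hbm).le]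

theorem card_reachable_le {T : Type u} {R : T → T → Prop} {τ : Cardinal.{u}} (hτ : ℵ₀ ≤ τ)
    (hR : ∀ b, #{a // R a b} ≤ τ) (b : T) : #{a // Relation.ReflTransGen R a b} ≤ τ := by
  obtain ⟨L, hL0, hL1⟩ : ∃ L : ℕ → Set T, L 0 = {b} ∧ ∀ n, L (n + 1) = ⋃ y ∈ L n, {a | R a y} :=
    ⟨fun n => Nat.rec {b} (fun _ s => ⋃ y ∈ s, {a | R a y}) n, rfl, fun _ => rfl⟩
  have hcard : ∀ n, #(↥(L n)) ≤ τ := by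
    intro n
    induction n with
    | zero => rw [hL0, mk_singleton]; exact one_le_aleph0.trans hτ
    | succ n ih =>
      rw [hL1, Set.biUnion_eq_iUnion]
      refine (mk_iUnion_le _).trans ((mul_le_mul' ih (ciSup_le' fun y => ?_)).trans
        (mul_eq_self hτ).le)
      exact hR y.1
  have hsub : {a | Relation.ReflTransGen R a b} ⊆ ⋃ n : ULift.{u} ℕ, L n.down := by
    intro a ha
    induction ha using Relation.ReflTransGen.head_induction_on with
    | refl => exact Set.mem_iUnion.2 ⟨⟨0⟩, hL0 ▸ rfl⟩
    | head hac _ ih =>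
      obtain ⟨n, hn⟩ := Set.mem_iUnion.1 ih
      refine Set.mem_iUnion.2 ⟨⟨n.down + 1⟩, ?_⟩
      rw [hL1]
      exact Set.mem_biUnion hn hac
  have h1 : #(⋃ n : ULift.{u} ℕ, L n.down) ≤ τ := by
    have h2 : (⨆ n : ULift.{u} ℕ, #(↥(L n.down))) ≤ τ := ciSup_le' fun n => hcard n.down
    refine (mk_iUnion_le (fun n : ULift.{u} ℕ => L n.down)).trans ((mul_le_mul' ?_ h2).trans
      (mul_eq_self hτ).le)
    rw [mk_uLift, mk_nat, lift_aleph0]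
    exact hτ
  exact (mk_le_mk_of_subset hsub).trans h1

/-- A relation with at most `τ` predecessors at each point, along which `key` increases, is
compatible up to `τ` with an enumeration in which `key` is non-decreasing. -/
theorem exists_enumeration {T : Type u} {R : T → T → Prop} {τ : Cardinal.{u}} (hτ : ℵ₀ ≤ τ)
    (hR : ∀ b, #{a // R a b} ≤ τ) (key : T → Ordinal.{u}) (hkey : ∀ a b, R a b → key a ≤ key b) :
    ∃ (len : Ordinal.{u}) (idx : T → Ordinal.{u}), Function.Injective idx ∧ (∀ a, idx a < len) ∧
      (∀ α < len, ∃ a, idx a = α) ∧ (∀ a b, idx a < idx b → key a ≤ key b) ∧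
      ∀ a b, R a b → idx a < idx b + τ.ord := by
  classical
  let c : T → Ordinal.{u} := typein (WellOrderingRel (α := T))
  have hc : Function.Injective c := typein_injective _
  let blk : T → Ordinal.{u} := fun a => sInf {o | ∃ b, Relation.ReflTransGen R a b ∧ c b = o}
  have hrep : ∀ a, ∃ b, Relation.ReflTransGen R a b ∧ c b = blk a := fun a =>
    csInf_mem (s := {o | ∃ b, Relation.ReflTransGen R a b ∧ c b = o}) ⟨c a, a, .refl, rfl⟩
  choose rep hrep hcrep using hrep
  have hblk : ∀ a b, R a b → blk a ≤ blk b := fun a b hab =>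
    csInf_le' ⟨rep b, .head hab (hrep b), hcrep b⟩
  have hinj : ∀ b, ∃ g : {a // Relation.ReflTransGen R a b} → τ.ord.ToType, Function.Injective g := by
    intro b
    have : #{a // Relation.ReflTransGen R a b} ≤ #(τ.ord.ToType) := by
      rw [mk_toType, card_ord]; exact card_reachable_le hτ hR b
    obtain ⟨g⟩ := (Cardinal.le_def _ _).1 this
    exact ⟨g, g.injective⟩
  choose g hg using hinj
  let pos : T → Ordinal.{u} := fun a => ordVal (g (rep a) ⟨a, hrep a⟩)
  have hposlt : ∀ a, pos a < τ.ord := fun a => ordVal_lt _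
  have hpos : ∀ a b, blk a = blk b → pos a = pos b → a = b := by
    intro a b h1 h2
    have h3 : rep a = rep b := hc (by rw [hcrep, hcrep, h1])
    have h4 : ∀ x y (hx : Relation.ReflTransGen R a x) (hy : Relation.ReflTransGen R b y), x = y →
        ordVal (g x ⟨a, hx⟩) = ordVal (g y ⟨b, hy⟩) → a = b := by
      rintro x y hx hy rfl h
      exact congrArg Subtype.val (hg _ (ordVal_injective h))
    exact h4 _ _ (hrep a) (hrep b) h3 h2
  let f : T → Ordinal.{u} ×ₗ (Ordinal.{u} ×ₗ Ordinal.{u}) := fun a =>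
    toLex (key a, toLex (blk a, pos a))
  have hf : Function.Injective f := by
    intro a b hab
    have h1 := congrArg ofLex hab
    simp only [f, ofLex_toLex, Prod.mk.injEq, EmbeddingLike.apply_eq_iff_eq] at h1
    exact hpos a b h1.2.1 h1.2.2
  let _ : LinearOrder T := LinearOrder.lift' f hf
  have : WellFoundedLT T := ⟨InvImage.wf f wellFounded_lt⟩
  have hlt : ∀ a b : T, a < b ↔ key a < key b ∨ (key a = key b ∧ (blk a < blk b ∨
      (blk a = blk b ∧ pos a < pos b))) := by
    intro a b
    change f a < f b ↔ _
    simp only [f, Prod.Lex.toLex_lt_toLex]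
  let idx : T → Ordinal.{u} := typein (α := T) (· < ·)
  have hidx : ∀ a b, idx a < idx b ↔ a < b := fun a b => typein_lt_typein _
  have hidx' : ∀ a b, idx a ≤ idx b ↔ a ≤ b := fun a b => by
    rw [← not_lt, hidx, not_lt]
  have hsurj : ∀ α < type (α := T) (· < ·), ∃ a, idx a = α := fun α hα => typein_surj _ hα
  have hkle : ∀ a b : T, a ≤ b → key a ≤ key b := by
    intro a b hab
    rcases hab.lt_or_eq with h | rfl
    · rcases (hlt a b).1 h with h | h
      exacts [h.le, h.1.le]
    · exact le_rfl
  have hble : ∀ a b : T, a ≤ b → key a = key b → blk a ≤ blk b := by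
    intro a b hab hk
    rcases hab.lt_or_eq with h | rfl
    · rcases (hlt a b).1 h with h | ⟨-, h | h⟩
      exacts [absurd hk h.ne, h.le, h.1.le]
    · exact le_rfl
  refine ⟨type (α := T) (· < ·), idx, typein_injective _, fun a => typein_lt_type _ a, hsurj,
    fun a b hab => hkle a b ((hidx a b).1 hab).le, fun a b hab => ?_⟩
  by_contra! hcon
  have hx : ∀ ε < τ.ord, ∃ x, idx x = idx b + ε ∧ blk x = blk a ∧ key x = key a ∧ x < a := by
    intro ε hε
    have h1 : idx b + ε < idx a := (add_lt_add_right hε _).trans_le hcon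
    obtain ⟨x, hx⟩ := hsurj _ (h1.trans (typein_lt_type _ a))
    have hxa : x < a := (hidx x a).1 (hx ▸ h1)
    have hbx : b ≤ x := (hidx' b x).1 (hx ▸ le_self_add)
    have hk1 : key x = key a := (hkle _ _ hxa.le).antisymm ((hkey a b hab).trans (hkle _ _ hbx))
    have hk2 : key b = key x := (hkle _ _ hbx).antisymm (hk1.le.trans (hkey a b hab))
    exact ⟨x, hx, (hble _ _ hxa.le hk1).antisymm ((hblk a b hab).trans (hble _ _ hbx hk2)), hk1, hxa⟩
  have : Nonempty T := ⟨a⟩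
  choose! x hxi hxb hxk hxa using hx
  have hpx : ∀ ε < τ.ord, pos (x ε) < pos a := by
    intro ε hε
    rcases (hlt _ _).1 (hxa ε hε) with h | ⟨-, h | h⟩
    exacts [absurd (hxk ε hε) h.ne, absurd (hxb ε hε) h.ne, h.2]
  have hmono : ∀ ε < τ.ord, ε ≤ pos (x ε) := by
    intro ε
    induction ε using WellFoundedLT.induction with
    | _ ε ih =>
      intro hε
      by_contra! hlt'
      have h1 := hlt'.trans hε
      have h2 := ih _ hlt' h1
      have h3 : x (pos (x ε)) < x ε := by
        rw [← hidx, hxi _ h1, hxi _ hε]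
        exact add_lt_add_right hlt' _
      rcases (hlt _ _).1 h3 with h | ⟨-, h | h⟩
      · exact absurd ((hxk _ h1).trans (hxk _ hε).symm) h.ne
      · exact absurd ((hxb _ h1).trans (hxb _ hε).symm) h.ne
      · exact (h2.trans_lt h.2).false
  exact ((hmono _ (hposlt a)).trans_lt (hpx _ (hposlt a))).false

/-- The sequence that agrees with `η` below `m` and is constantly `0` from `m` on. -/
noncomputable def mask (m : Ordinal.{u}) (η : Ordinal.{u} → Ordinal.{u}) (j : Ordinal.{u}) :
    Ordinal.{u} :=
  open Classical in if j < m then η j else 0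

theorem mask_of_lt {m j : Ordinal.{u}} {η : Ordinal.{u} → Ordinal.{u}} (h : j < m) :
    mask m η j = η j := if_pos h

theorem mask_of_le {m j : Ordinal.{u}} {η : Ordinal.{u} → Ordinal.{u}} (h : m ≤ j) :
    mask m η j = 0 := if_neg h.not_gt

theorem mask_congr {m : Ordinal.{u}} {η η' : Ordinal.{u} → Ordinal.{u}}
    (h : ∀ j < m, η j = η' j) : mask m η = mask m η' := by
  funext j
  by_cases hj : j < m
  · rw [mask_of_lt hj, mask_of_lt hj, h j hj]
  · rw [mask_of_le (not_lt.1 hj), mask_of_le (not_lt.1 hj)]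

theorem mask_lt {m j b : Ordinal.{u}} {η : Ordinal.{u} → Ordinal.{u}} (hb : 0 < b)
    (h : ∀ j < m, η j < b) : mask m η j < b := by
  by_cases hj : j < m
  · rw [mask_of_lt hj]; exact h j hj
  · rwa [mask_of_le (not_lt.1 hj)]

theorem mask_mask {m n : Ordinal.{u}} (h : m ≤ n) (η : Ordinal.{u} → Ordinal.{u}) :
    mask m (mask n η) = mask m η :=
  mask_congr fun _ hj => mask_of_lt (hj.trans_le h)

/-- Recursion along the ordinals, where step `m` sees the earlier values. -/
theorem exists_recursion {α : Type*} (z : α) (F : Ordinal.{u} → (Ordinal.{u} → α) → α) :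
    ∃ η : Ordinal.{u} → α, ∀ m, η m = F m (open Classical in fun j => if j < m then η j else z) := by
  classical
  let G : (m : Ordinal.{u}) → ((j : Ordinal.{u}) → j < m → α) → α :=
    fun m f => F m (fun j => if h : j < m then f j h else z)
  refine ⟨WellFounded.fix (C := fun _ => α) Ordinal.lt_wf G, fun m => ?_⟩
  rw [WellFounded.fix_eq]
  simp only [G]
  congr 1

/-- A lower bound for the next pair of moves, as a function of the stage and the earlier moves. -/
abbrev Bound := Ordinal.{u} → (Ordinal.{u} → Ordinal.{u}) → (Ordinal.{u} → Ordinal.{u}) → Ordinal.{u}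

/-- The sequences `a`, `b` of length `θ` are increasing in `κ`, `ν` and pass the bounds `F`, `G`. -/
structure IsBranch (θ κ ν : Ordinal.{u}) (F G : Bound.{u}) (a b : Ordinal.{u} → Ordinal.{u}) :
    Prop where
  lt_left : ∀ m < θ, a m < κ
  lt_right : ∀ m < θ, b m < ν
  mono_left : ∀ j m, j < m → m < θ → a j < a m
  mono_right : ∀ j m, j < m → m < θ → b j < b m
  bound_left : ∀ m < θ, F m (mask m a) (mask m b) < a m
  bound_right : ∀ m < θ, G m (mask m a) (mask m b) < b m

/-- `F` maps sequences in `κ`, `ν` to values below `o`. -/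
def BoundedBy (θ κ ν o : Ordinal.{u}) (F : Bound.{u}) : Prop :=
  ∀ m < θ, ∀ a b : Ordinal.{u} → Ordinal.{u}, (∀ j, a j < κ) → (∀ j, b j < ν) → F m a b < o

/-- The supremum of the first `θ` values. -/
noncomputable def limSup (θ : Ordinal.{u}) (a : Ordinal.{u} → Ordinal.{u}) : Ordinal.{u} :=
  sSup (a '' Set.Iio θ)

theorem bddAbove_image_Iio (θ : Ordinal.{u}) (a : Ordinal.{u} → Ordinal.{u}) :
    BddAbove (a '' Set.Iio θ) := Ordinal.bddAbove_of_small

theorem le_limSup {θ j : Ordinal.{u}} {a : Ordinal.{u} → Ordinal.{u}} (hj : j < θ) :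
    a j ≤ limSup θ a := le_csSup (bddAbove_image_Iio θ a) ⟨j, hj, rfl⟩

theorem limSup_le {θ c : Ordinal.{u}} {a : Ordinal.{u} → Ordinal.{u}}
    (h : ∀ j < θ, a j ≤ c) : limSup θ a ≤ c := csSup_le' (by rintro _ ⟨j, hj, rfl⟩; exact h j hj)

theorem lt_limSup_iff {θ c : Ordinal.{u}} {a : Ordinal.{u} → Ordinal.{u}} :
    c < limSup θ a ↔ ∃ j < θ, c < a j := by
  constructor
  · intro h
    by_contra! h'
    exact (limSup_le h').not_gt h
  · rintro ⟨j, hj, h⟩; exact h.trans_le (le_limSup hj)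

theorem isLUB_limSup {θ : Ordinal.{u}} (hθ : 0 < θ) (a : Ordinal.{u} → Ordinal.{u}) :
    IsLUB (a '' Set.Iio θ) (limSup θ a) :=
  isLUB_csSup ⟨_, 0, hθ, rfl⟩ (bddAbove_image_Iio θ a)

theorem limSup_congr {θ : Ordinal.{u}} {a b : Ordinal.{u} → Ordinal.{u}}
    (h : ∀ j < θ, a j = b j) : limSup θ a = limSup θ b :=
  (limSup_le fun j hj => h j hj ▸ le_limSup hj).antisymm
    (limSup_le fun j hj => h j hj ▸ le_limSup hj)

theorem limSup_lt {θ κ : Ordinal.{u}} (hθ : θ.card < κ.cof) {a : Ordinal.{u} → Ordinal.{u}}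
    (h : ∀ j < θ, a j < κ) : limSup θ a < κ := by
  obtain ⟨b, hb, hb'⟩ := exists_bound_Iio hθ a h
  exact (limSup_le fun j hj => (hb' j hj).le).trans_lt hb

/-- Whatever the bounds, some branch has its pair of limits in `P`. -/
def Pos (θ κ ν : Ordinal.{u}) (P : Ordinal.{u} → Ordinal.{u} → Prop) : Prop :=
  ∀ F G : Bound.{u}, BoundedBy θ κ ν κ F → BoundedBy θ κ ν ν G →
    ∃ a b, IsBranch θ κ ν F G a b ∧ P (limSup θ a) (limSup θ b)

theorem Pos.mono {θ κ ν : Ordinal.{u}} {P Q : Ordinal.{u} → Ordinal.{u} → Prop}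
    (h : Pos θ κ ν P) (hPQ : ∀ x y, P x y → Q x y) : Pos θ κ ν Q := by
  intro F G hF hG
  obtain ⟨a, b, hab, hP⟩ := h F G hF hG
  exact ⟨a, b, hab, hPQ _ _ hP⟩

theorem pos_true {θ κ ν : Ordinal.{u}} (hκ : θ.card < κ.cof) (hν : θ.card < ν.cof)
    (hκl : IsSuccLimit κ) (hνl : IsSuccLimit ν) :
    Pos θ κ ν (fun _ _ => True) := by
  classical
  intro F G hF hG
  obtain ⟨η, hη⟩ := exists_recursion ((0 : Ordinal.{u}), (0 : Ordinal.{u})) (fun m f =>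
    (succ (max (F m (fun j => (f j).1) (fun j => (f j).2)) (limSup m (fun j => (f j).1))),
     succ (max (G m (fun j => (f j).1) (fun j => (f j).2)) (limSup m (fun j => (f j).2)))))
  set a : Ordinal.{u} → Ordinal.{u} := fun m => (η m).1 with ha
  set b : Ordinal.{u} → Ordinal.{u} := fun m => (η m).2 with hb
  have e1 : ∀ m, (fun j => ((if j < m then η j else ((0 : Ordinal.{u}), (0 : Ordinal.{u}))).1)) = mask m a := by
    intro m; funext j; simp only [mask, ha]; split_ifs <;> rfl
  have e2 : ∀ m, (fun j => ((if j < m then η j else ((0 : Ordinal.{u}), (0 : Ordinal.{u}))).2)) = mask m b := by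
    intro m; funext j; simp only [mask, hb]; split_ifs <;> rfl
  have hη' : ∀ m, η m = (succ (max (F m (mask m a) (mask m b)) (limSup m (mask m a))),
      succ (max (G m (mask m a) (mask m b)) (limSup m (mask m b)))) := by
    intro m
    rw [← e1, ← e2]
    exact hη m
  have hav : ∀ m, a m = succ (max (F m (mask m a) (mask m b)) (limSup m (mask m a))) :=
    fun m => congrArg Prod.fst (hη' m)
  have hbv : ∀ m, b m = succ (max (G m (mask m a) (mask m b)) (limSup m (mask m b))) :=
    fun m => congrArg Prod.snd (hη' m)
  have hκ0 : 0 < κ := hκl.bot_lt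
  have hν0 : 0 < ν := hνl.bot_lt
  have hlt : ∀ m, m < θ → a m < κ ∧ b m < ν := by
    intro m
    induction m using WellFoundedLT.induction with
    | _ m ih =>
      intro hm
      have h1 : ∀ j, mask m a j < κ := fun j =>
        mask_lt hκ0 fun j hj => (ih j hj (hj.trans hm)).1
      have h2 : ∀ j, mask m b j < ν := fun j =>
        mask_lt hν0 fun j hj => (ih j hj (hj.trans hm)).2
      have hmc := (Ordinal.card_le_card hm.le)
      rw [hav, hbv]
      exact ⟨hκl.succ_lt (max_lt (hF m hm _ _ h1 h2) (limSup_lt (hmc.trans_lt hκ) fun j _ => h1 j)),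
        hνl.succ_lt (max_lt (hG m hm _ _ h1 h2) (limSup_lt (hmc.trans_lt hν) fun j _ => h2 j))⟩
  refine ⟨a, b, ⟨fun m hm => (hlt m hm).1, fun m hm => (hlt m hm).2, ?_, ?_, ?_, ?_⟩, trivial⟩
  · intro j m hjm _
    rw [hav m, lt_succ_iff, ← mask_of_lt (η := a) hjm]
    exact (le_limSup hjm).trans (le_max_right _ _)
  · intro j m hjm _
    rw [hbv m, lt_succ_iff, ← mask_of_lt (η := b) hjm]
    exact (le_limSup hjm).trans (le_max_right _ _)
  · intro m _
    rw [hav m]; exact lt_succ_of_le (le_max_left _ _)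
  · intro m _
    rw [hbv m]; exact lt_succ_of_le (le_max_left _ _)

/-- The tail of a sequence from `i` on. -/
def tail (i : Ordinal.{u}) (a : Ordinal.{u} → Ordinal.{u}) (j : Ordinal.{u}) : Ordinal.{u} :=
  a (i + j)

theorem mask_tail (i m : Ordinal.{u}) (a : Ordinal.{u} → Ordinal.{u}) :
    mask m (tail i a) = tail i (mask (i + m) a) := by
  funext j
  by_cases hj : j < m
  · rw [mask_of_lt hj, tail, tail, mask_of_lt (add_lt_add_right hj i)]
  · rw [mask_of_le (not_lt.1 hj), tail, mask_of_le (add_le_add_right (not_lt.1 hj) i)]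

theorem limSup_tail {θ i : Ordinal.{u}} {a : Ordinal.{u} → Ordinal.{u}}
    (hθ : ∀ j < θ, i + j < θ) (hmono : ∀ j m, j < m → m < θ → a j < a m) :
    limSup θ (tail i a) = limSup θ a := by
  refine (limSup_le fun j hj => le_limSup (hθ j hj)).antisymm (limSup_le fun j hj => ?_)
  refine le_trans ?_ (le_limSup (a := tail i a) hj)
  rcases (le_add_self : j ≤ i + j).eq_or_lt with h | h
  · rw [tail, ← h]
  · exact (hmono _ _ h (hθ j hj)).le

/-- A strictly increasing sequence of length `θ` with limit `δ`, if there is one. -/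
noncomputable def ladder (θ δ : Ordinal.{u}) : Ordinal.{u} → Ordinal.{u} :=
  open Classical in
  if h : ∃ a : Ordinal.{u} → Ordinal.{u}, (∀ j m, j < m → m < θ → a j < a m) ∧ limSup θ a = δ
  then h.choose else 0

theorem ladder_spec {θ : Ordinal.{u}} {a : Ordinal.{u} → Ordinal.{u}}
    (h : ∀ j m, j < m → m < θ → a j < a m) :
    (∀ j m, j < m → m < θ → ladder θ (limSup θ a) j < ladder θ (limSup θ a) m) ∧
      limSup θ (ladder θ (limSup θ a)) = limSup θ a := by
  have h' : ∃ b : Ordinal.{u} → Ordinal.{u}, (∀ j m, j < m → m < θ → b j < b m) ∧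
      limSup θ b = limSup θ a := ⟨a, h, rfl⟩
  rw [ladder, dif_pos h']
  exact h'.choose_spec

theorem ladder_lt {θ : Ordinal.{u}} (hθ : IsSuccLimit θ) {a : Ordinal.{u} → Ordinal.{u}}
    (h : ∀ j m, j < m → m < θ → a j < a m) {j : Ordinal.{u}} (hj : j < θ) :
    ladder θ (limSup θ a) j < limSup θ a := by
  have h1 := (ladder_spec h).1 j (succ j) (lt_succ j) (hθ.succ_lt hj)
  refine h1.trans_le ?_
  conv_rhs => rw [← (ladder_spec h).2]
  exact le_limSup (hθ.succ_lt hj)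

theorem exists_lt_ladder {θ : Ordinal.{u}} {a : Ordinal.{u} → Ordinal.{u}}
    (h : ∀ j m, j < m → m < θ → a j < a m) {x : Ordinal.{u}} (hx : x < limSup θ a) :
    ∃ j < θ, x < ladder θ (limSup θ a) j := by
  rw [← (ladder_spec h).2] at hx
  exact lt_limSup_iff.1 hx

theorem card_shrink_Iio_prod (i j k : Ordinal.{u}) :
    #(Shrink.{u} (Set.Iio i × Set.Iio j × Set.Iio k)) = i.card * (j.card * k.card) := by
  rw [← Cardinal.lift_inj.{u, u + 1}, Cardinal.lift_mk_shrink'']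
  simp [Cardinal.mk_Iio_ordinal]

theorem Pos.split {θ κ ν : Cardinal.{u}} (hθ : θ.IsRegular) (hκ : κ.IsRegular) (hν : ν.IsRegular)
    (hθκ : θ < κ) (hκν : κ ≤ ν) {P : Ordinal.{u} → Ordinal.{u} → Prop}
    (h : Pos θ.ord κ.ord ν.ord P) :
    ∃ j < θ.ord, ∀ e < κ.ord, ∃ e', e ≤ e' ∧ e' < κ.ord ∧
      Pos θ.ord κ.ord ν.ord (fun x y => P x y ∧ ladder θ.ord x j = e') := by
  by_contra! hc
  choose! e he hbad using hc
  have hθl : IsSuccLimit θ.ord := isSuccLimit_ord hθ.aleph0_le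
  have hκ0 : 0 < κ.ord := hκ.ord_pos
  have hν0 : 0 < ν.ord := hν.ord_pos
  have hθκ' : θ.ord.card < κ.ord.cof := by rw [card_ord, hκ.cof_ord]; exact hθκ
  have : ∀ j e', ∃ F G, BoundedBy θ.ord κ.ord ν.ord κ.ord F ∧ BoundedBy θ.ord κ.ord ν.ord ν.ord G ∧
      (j < θ.ord → e j ≤ e' → e' < κ.ord → ¬ ∃ a b, IsBranch θ.ord κ.ord ν.ord F G a b ∧
        (P (limSup θ.ord a) (limSup θ.ord b) ∧ ladder θ.ord (limSup θ.ord a) j = e')) := by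
    intro j e'
    by_cases hh : j < θ.ord ∧ e j ≤ e' ∧ e' < κ.ord
    · have := hbad j hh.1 e' hh.2.1 hh.2.2
      rw [Pos] at this
      push Not at this
      obtain ⟨F, G, hF, hG, h'⟩ := this
      refine ⟨F, G, hF, hG, fun _ _ _ => ?_⟩
      rintro ⟨a, b, hab, hP⟩
      exact h' a b hab hP.1 hP.2
    · refine ⟨fun _ _ _ => 0, fun _ _ _ => 0, fun _ _ _ _ _ _ => hκ0, fun _ _ _ _ _ _ => hν0,
        fun h1 h2 h3 => absurd ⟨h1, h2, h3⟩ hh⟩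
  choose Fs Gs hFs hGs hno using this
  obtain ⟨E, hE, hEe⟩ := exists_bound_Iio hθκ' e he
  let I : Ordinal.{u} → (Ordinal.{u} → Ordinal.{u}) → Type (u + 1) := fun m a =>
    Set.Iio (m + 1) × Set.Iio θ.ord × Set.Iio (limSup m a + 1)
  let F : Bound.{u} := fun m a b => max E (⨆ p : I m a,
    Fs p.2.1 p.2.2 (m - p.1) (tail p.1 a) (tail p.1 b))
  let G : Bound.{u} := fun m a b => ⨆ p : I m a,
    Gs p.2.1 p.2.2 (m - p.1) (tail p.1 a) (tail p.1 b)
  have hI : ∀ m < θ.ord, ∀ a : Ordinal.{u} → Ordinal.{u}, (∀ j, a j < κ.ord) →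
      #(Shrink.{u} (I m a)) < κ := by
    intro m hm a ha
    rw [card_shrink_Iio_prod]
    refine mul_lt_of_lt hκ.aleph0_le ?_ (mul_lt_of_lt hκ.aleph0_le ?_ ?_)
    · exact (lt_ord.1 (hθl.add_one_lt hm)).trans hθκ
    · rwa [card_ord]
    · refine lt_ord.1 ((isSuccLimit_ord hκ.aleph0_le).add_one_lt ?_)
      exact limSup_lt ((Ordinal.card_le_card hm.le).trans_lt hθκ') fun j _ => ha j
  have hsub : ∀ m < θ.ord, ∀ i, m - i < θ.ord := fun m hm i => (Ordinal.sub_le_self m i).trans_lt hm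
  have hF : BoundedBy θ.ord κ.ord ν.ord κ.ord F := by
    intro m hm a b ha hb
    refine max_lt hE ?_
    obtain ⟨B, hB, hB'⟩ := exists_bound (ι := I m a) (o := κ.ord)
      (by rw [hκ.cof_ord]; exact hI m hm a ha)
      (fun p => Fs p.2.1 p.2.2 (m - p.1) (tail p.1 a) (tail p.1 b))
      (fun p => hFs _ _ _ (hsub m hm _) _ _ (fun j => ha _) (fun j => hb _))
    exact (ciSup_le' fun p => (hB' p).le).trans_lt hB
  have hG : BoundedBy θ.ord κ.ord ν.ord ν.ord G := by
    intro m hm a b ha hb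
    obtain ⟨B, hB, hB'⟩ := exists_bound (ι := I m a) (o := ν.ord)
      (by rw [hν.cof_ord]; exact (hI m hm a ha).trans_le hκν)
      (fun p => Gs p.2.1 p.2.2 (m - p.1) (tail p.1 a) (tail p.1 b))
      (fun p => hGs _ _ _ (hsub m hm _) _ _ (fun j => ha _) (fun j => hb _))
    exact (ciSup_le' fun p => (hB' p).le).trans_lt hB
  obtain ⟨a, b, hab, hP⟩ := h F G hF hG
  have hE0 : E < limSup θ.ord a :=
    ((le_max_left _ _).trans_lt (hab.bound_left 0 hθ.ord_pos)).trans_le (le_limSup hθ.ord_pos)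
  obtain ⟨j, hj, hEj⟩ := exists_lt_ladder hab.mono_left hE0
  set e' := ladder θ.ord (limSup θ.ord a) j with he'
  have he'δ : e' < limSup θ.ord a := ladder_lt hθl hab.mono_left hj
  obtain ⟨i₀, hi₀, hei⟩ := lt_limSup_iff.1 he'δ
  have hi : i₀ + 1 < θ.ord := hθl.add_one_lt hi₀
  have hadd : ∀ m < θ.ord, i₀ + 1 + m < θ.ord := fun m hm =>
    (isPrincipal_add_ord hθ.aleph0_le) hi hm
  have hindex : ∀ m, e' ∈ Set.Iio (limSup (i₀ + 1 + m) (mask (i₀ + 1 + m) a) + 1) := by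
    intro m
    have h0 : i₀ < i₀ + 1 + m := (lt_add_one i₀).trans_le le_self_add
    refine lt_add_one_iff.2 (hei.le.trans ?_)
    rw [← mask_of_lt (η := a) h0]
    exact le_limSup h0
  refine hno j e' hj (hEe j hj |>.le.trans hEj.le) (he'δ.trans
    (limSup_lt hθκ' hab.lt_left)) ⟨tail (i₀ + 1) a, tail (i₀ + 1) b, ?_, ?_⟩
  · refine ⟨fun m hm => hab.lt_left _ (hadd m hm), fun m hm => hab.lt_right _ (hadd m hm),
      fun j m hjm hm => hab.mono_left _ _ (add_lt_add_right hjm _) (hadd m hm),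
      fun j m hjm hm => hab.mono_right _ _ (add_lt_add_right hjm _) (hadd m hm), ?_, ?_⟩
    · intro m hm
      refine lt_of_le_of_lt ?_ (hab.bound_left _ (hadd m hm))
      refine le_trans ?_ (le_max_right _ _)
      have := le_ciSup (f := fun p : I (i₀ + 1 + m) (mask (i₀ + 1 + m) a) =>
        Fs p.2.1 p.2.2 (i₀ + 1 + m - p.1) (tail p.1 (mask (i₀ + 1 + m) a))
          (tail p.1 (mask (i₀ + 1 + m) b))) Ordinal.bddAbove_of_small
          (⟨⟨i₀ + 1, Set.mem_Iio.2 (lt_add_one_iff.2 le_self_add)⟩, ⟨j, hj⟩, ⟨e', hindex m⟩⟩)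
      simpa only [Ordinal.add_sub_cancel, ← mask_tail] using this
    · intro m hm
      refine lt_of_le_of_lt ?_ (hab.bound_right _ (hadd m hm))
      have := le_ciSup (f := fun p : I (i₀ + 1 + m) (mask (i₀ + 1 + m) a) =>
        Gs p.2.1 p.2.2 (i₀ + 1 + m - p.1) (tail p.1 (mask (i₀ + 1 + m) a))
          (tail p.1 (mask (i₀ + 1 + m) b))) Ordinal.bddAbove_of_small
          (⟨⟨i₀ + 1, Set.mem_Iio.2 (lt_add_one_iff.2 le_self_add)⟩, ⟨j, hj⟩, ⟨e', hindex m⟩⟩)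
      simpa only [Ordinal.add_sub_cancel, ← mask_tail] using this
  · rw [limSup_tail hadd hab.mono_left, limSup_tail hadd hab.mono_right]
    exact ⟨hP, he'.symm⟩

theorem Pos.cylinder {θ κ ν : Cardinal.{u}} (hκ : κ.IsRegular)
    (hν : ν.IsRegular) (hθκ : θ < κ) {Y : Ordinal.{u} → Prop}
    (h : Pos θ.ord ν.ord ν.ord (fun x _ => Y x)) :
    Pos θ.ord κ.ord ν.ord (fun _ y => Y y) := by
  classical
  intro F G hF hG
  have hκ0 : 0 < κ.ord := hκ.ord_pos
  have hν0 : 0 < ν.ord := hν.ord_pos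
  have hκl := isSuccLimit_ord hκ.aleph0_le
  have hθκ' : θ.ord.card < κ.ord.cof := by rw [card_ord, hκ.cof_ord]; exact hθκ
  have hrec : ∀ b : Ordinal.{u} → Ordinal.{u}, ∃ a : Ordinal.{u} → Ordinal.{u}, ∀ m,
      a m = succ (max (F m (mask m a) (mask m b)) (limSup m (mask m a))) := fun b =>
    exists_recursion (0 : Ordinal.{u}) (fun m a => succ (max (F m a (mask m b)) (limSup m a)))
  choose can hcan using hrec
  have hloc : ∀ b b' : Ordinal.{u} → Ordinal.{u}, ∀ m, (∀ j < m, b j = b' j) →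
      ∀ j < m, can b j = can b' j := by
    intro b b' m hb j
    induction j using WellFoundedLT.induction with
    | _ j ih =>
      intro hj
      rw [hcan b, hcan b', mask_congr (fun i hi => hb i (hi.trans hj)),
        mask_congr (fun i hi => ih i hi (hi.trans hj))]
  have hlt : ∀ b : Ordinal.{u} → Ordinal.{u}, (∀ j < θ.ord, b j < ν.ord) → ∀ m < θ.ord,
      can b m < κ.ord := by
    intro b hb m
    induction m using WellFoundedLT.induction with
    | _ m ih =>
      intro hm
      have h1 : ∀ j, mask m (can b) j < κ.ord := fun j =>
        mask_lt hκ0 fun j hj => ih j hj (hj.trans hm)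
      rw [hcan]
      exact hκl.succ_lt (max_lt (hF m hm _ _ h1
        (fun j => mask_lt hν0 fun j hj => hb j (hj.trans hm)))
        (limSup_lt ((Ordinal.card_le_card hm.le).trans_lt hθκ') fun j _ => h1 j))
  obtain ⟨b, b', hb, hY⟩ := h (fun m b _ => G m (mask m (can b)) (mask m b)) (fun _ _ _ => 0)
    (fun m hm b _ hb _ => hG m hm _ _
      (fun j => mask_lt hκ0 fun j hj => hlt b (fun j _ => hb j) j (hj.trans hm))
      (fun j => mask_lt hν0 fun j _ => hb j))
    (fun _ _ _ _ _ _ => hν0)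
  refine ⟨can b, b, ⟨hlt b hb.lt_left, hb.lt_left, ?_, hb.mono_left, ?_, ?_⟩, hY⟩
  · intro j m hjm hm
    rw [hcan b m, lt_succ_iff, ← mask_of_lt (η := can b) hjm]
    exact (le_limSup hjm).trans (le_max_right _ _)
  · intro m hm
    conv_rhs => rw [hcan b m]
    exact lt_succ_of_le (le_max_left _ _)
  · intro m hm
    have := hb.bound_left m hm
    rw [mask_mask le_rfl, mask_congr (hloc (mask m b) b m fun j hj => mask_of_lt hj)] at this
    exact this

theorem exists_surj_of_unbounded {ν : Cardinal.{u}} (hν : ν.IsRegular) {E : Ordinal.{u} → Prop}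
    (hE : ∀ b < ν.ord, ∃ e, b ≤ e ∧ e < ν.ord ∧ E e) :
    ∃ f : Ordinal.{u} → Ordinal.{u}, ∀ b < ν.ord, ∃ e < ν.ord, E e ∧ f e = b := by
  let S : Set (Set.Iio ν.ord) := {e | E e}
  have hS : ν ≤ #(Shrink.{u} S) := by
    by_contra! hlt
    obtain ⟨b, hb, h⟩ := exists_bound (ι := S) (o := ν.ord) (by rwa [hν.cof_ord])
      (fun e => e.1.1) (fun e => e.1.2)
    obtain ⟨e, hbe, heν, he⟩ := hE b hb
    exact (h ⟨⟨e, heν⟩, he⟩).not_ge hbe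
  have hS' : #(ν.ord.ToType) ≤ #(Shrink.{u} S) := by rwa [mk_toType, card_ord]
  obtain ⟨g⟩ := Cardinal.le_def _ _ |>.1 hS'
  let G : Set.Iio ν.ord → S := fun b => (equivShrink S).symm (g (ToType.mk b))
  have hG : Function.Injective fun b => ((G b).1.1 : Ordinal.{u}) := by
    intro b b' h
    have h2 : G b = G b' := Subtype.ext (Subtype.ext h)
    exact ToType.mk.injective (g.injective ((equivShrink S).symm.injective h2))
  refine ⟨fun e => open Classical in if h : ∃ b, (G b).1.1 = e then h.choose.1 else 0, fun b hb => ?_⟩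
  refine ⟨(G ⟨b, hb⟩).1.1, (G ⟨b, hb⟩).1.2, (G ⟨b, hb⟩).2, ?_⟩
  have h : ∃ b', (G b').1.1 = (G ⟨b, hb⟩).1.1 := ⟨_, rfl⟩
  exact (dif_pos h).trans (congrArg Subtype.val (hG h.choose_spec))

/-- If every `e` in an unbounded set has a colour below `c`, where `c < ν`, then some colour is
used unboundedly often. -/
theorem exists_unbounded_colour {ν : Cardinal.{u}} (hν : ν.IsRegular) {c : Ordinal.{u}}
    (hc : c.card < ν) {E : Ordinal.{u} → Prop} {C : Ordinal.{u} → Ordinal.{u} → Prop}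
    (hE : ∀ b < ν.ord, ∃ e, b ≤ e ∧ e < ν.ord ∧ E e)
    (hC : ∀ e < ν.ord, E e → ∃ j < c, C e j) :
    ∃ j < c, ∀ b < ν.ord, ∃ e, b ≤ e ∧ e < ν.ord ∧ E e ∧ C e j := by
  by_contra! h
  choose! b hb h using h
  obtain ⟨B, hB, hbB⟩ := exists_bound_Iio (o := ν.ord) (by rwa [hν.cof_ord]) b hb
  obtain ⟨e, hBe, he, hEe⟩ := hE B hB
  obtain ⟨j, hj, hCj⟩ := hC e he hEe
  exact h j hj e ((hbB j hj).le.trans hBe) he hEe hCj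

theorem pos_top {θ κ ν : Cardinal.{u}} (hθκ : θ < κ) (hκ : κ.IsRegular) (hν : ν.IsRegular)
    (hκν : κ ≤ ν) : Pos θ.ord κ.ord ν.ord (fun _ _ => True) :=
  pos_true (by rw [card_ord, hκ.cof_ord]; exact hθκ)
    (by rw [card_ord, hν.cof_ord]; exact hθκ.trans_le hκν)
    (isSuccLimit_ord hκ.aleph0_le) (isSuccLimit_ord hν.aleph0_le)

theorem exists_regular_colouring {θ lam : Cardinal.{u}} (hθ : θ.IsRegular) (hlam : lam.IsRegular)
    (hθl : θ < lam) :
    ∃ t : Ordinal.{u} → Ordinal.{u}, ∀ b < lam.ord,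
      Pos θ.ord lam.ord lam.ord (fun x _ => t x = b) := by
  obtain ⟨j, -, h⟩ := (pos_top hθl hlam hlam le_rfl).split hθ hlam hlam hθl le_rfl
  obtain ⟨f, hf⟩ := exists_surj_of_unbounded hlam h
  refine ⟨fun x => f (ladder θ.ord x j), fun b hb => ?_⟩
  obtain ⟨e, -, he, rfl⟩ := hf b hb
  exact he.mono fun x _ hx => congrArg f hx.2

/-- For regular `θ < κ < ν` some `j`, `j'` are such that unboundedly many `v < κ` are limits of
pairs with unboundedly many values in the second coordinate. -/
theorem exists_split_pair {θ κ ν : Cardinal.{u}} (hθ : θ.IsRegular) (hκ : κ.IsRegular)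
    (hν : ν.IsRegular) (hθκ : θ < κ) (hκν : κ < ν) :
    ∃ j' < θ.ord, ∃ j < θ.ord, ∀ b < κ.ord, ∃ v, b ≤ v ∧ v < κ.ord ∧
      ∀ d < ν.ord, ∃ e, d ≤ e ∧ e < ν.ord ∧ Pos θ.ord κ.ord ν.ord (fun x y =>
        ladder θ.ord x j = v ∧ ladder θ.ord y j' = e) := by
  have hθν := hθκ.trans hκν
  obtain ⟨j', hj', h⟩ := (pos_top hθν hν hν le_rfl).split hθ hν hν hθν le_rfl
  refine ⟨j', hj', ?_⟩
  have h1 : ∀ d < ν.ord, ∃ e, d ≤ e ∧ e < ν.ord ∧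
      Pos θ.ord κ.ord ν.ord (fun _ y => ladder θ.ord y j' = e) := by
    intro d hd
    obtain ⟨e, hde, he, hP⟩ := h d hd
    exact ⟨e, hde, he, (hP.mono fun x y hx => hx.2).cylinder (Y := fun y => ladder θ.ord y j' = e)
      hκ hν hθκ⟩
  obtain ⟨j, hj, h2⟩ := exists_unbounded_colour hν (c := θ.ord) (by rwa [card_ord])
    (C := fun e j => ∀ b < κ.ord, ∃ v, b ≤ v ∧ v < κ.ord ∧ Pos θ.ord κ.ord ν.ord (fun x y =>
      ladder θ.ord y j' = e ∧ ladder θ.ord x j = v)) h1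
    (fun e he hP => hP.split hθ hκ hν hθκ hκν.le)
  refine ⟨j, hj, fun b hb => ?_⟩
  obtain ⟨v, hv, h3⟩ := exists_unbounded_colour hν (c := κ.ord) (by rwa [card_ord])
    (C := fun e v => b ≤ v ∧ Pos θ.ord κ.ord ν.ord (fun x y =>
      ladder θ.ord y j' = e ∧ ladder θ.ord x j = v)) h2
    (fun e he hP => by
      obtain ⟨v, hbv, hv, hP'⟩ := hP.2 b hb
      exact ⟨v, hv, hbv, hP'⟩)
  have hbv : b ≤ v := by
    obtain ⟨e, -, -, -, hbv, -⟩ := h3 0 hν.ord_pos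
    exact hbv
  refine ⟨v, hbv, hv, fun d hd => ?_⟩
  obtain ⟨e, hde, he, -, -, hP⟩ := h3 d hd
  exact ⟨e, hde, he, hP.mono fun x y hxy => ⟨hxy.2, hxy.1⟩⟩

theorem exists_singular_colouring {θ lam : Cardinal.{u}} (hθ : θ.IsRegular)
    (hlam : ℵ₀ ≤ lam) (hκ : lam.ord.cof < lam) (hθκ : θ < lam.ord.cof) :
    ∃ (μ : Ordinal.{u} → Cardinal.{u}) (t : Ordinal.{u} → Ordinal.{u} → Ordinal.{u}),
      (∀ i, (μ i).IsRegular ∧ lam.ord.cof < μ i ∧ μ i < lam) ∧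
      (∀ c < lam, ∃ i < lam.ord.cof.ord, c < μ i) ∧
      ∀ b < lam.ord, ∃ ν : Cardinal.{u}, ν.IsRegular ∧ lam.ord.cof < ν ∧ ν < lam ∧
        Pos θ.ord lam.ord.cof.ord ν.ord (fun x y => μ x = ν ∧ t x y = b) := by
  classical
  set κ := lam.ord.cof with hκdef
  have hκr : κ.IsRegular := isRegular_cof (isSuccLimit_ord hlam)
  have hlim : IsSuccLimit lam := by
    refine (IsSingular.of_not_isRegular hlam fun h => ?_).isSuccLimit
    exact (h.cof_ord ▸ hκ).false
  -- for every cardinal below `lam` there is a regular one above it with its splitting index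
  have hnu : ∀ c < lam, ∃ ν : Cardinal.{u}, ν.IsRegular ∧ κ < ν ∧ ν < lam ∧ c < ν := by
    intro c hc
    refine ⟨succ (max κ c), isRegular_succ (hκr.aleph0_le.trans (le_max_left _ _)),
      lt_succ_of_le (le_max_left _ _), hlim.succ_lt (max_lt hκ hc), lt_succ_of_le (le_max_right _ _)⟩
  -- a cofinal sequence in `lam` of length `κ`
  obtain ⟨g, hg⟩ := Ordinal.exists_isFundamentalSeq (o := lam.ord) (a := κ.ord) rfl
  let gc : Ordinal.{u} → Cardinal.{u} := fun i => if h : i < κ.ord then (g ⟨i, h⟩).1.card else 0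
  have hgc : ∀ i, gc i < lam := by
    intro i
    simp only [gc]
    split_ifs with h
    · exact lt_ord.1 (g ⟨i, h⟩).2
    · exact (aleph0_pos).trans_le hlam
  have hgcof : ∀ c < lam, ∃ i < κ.ord, ∀ k, i ≤ k → k < κ.ord → c ≤ gc k := by
    intro c hc
    obtain ⟨_, ⟨i, rfl⟩, hi⟩ := hg.isCofinal_range ⟨c.ord, ord_lt_ord.2 hc⟩
    refine ⟨i.1, i.2, fun k hik hk => ?_⟩
    simp only [gc, dif_pos hk]
    have h1 : g i ≤ g ⟨k, hk⟩ := hg.strictMono.monotone hik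
    have h2 : c.ord ≤ (g ⟨k, hk⟩).1 := le_trans (b := (g i).1) hi h1
    simpa using Ordinal.card_le_card h2
  choose! N hNr hκN hNl hcN using hnu
  have hspl : ∀ i, ∃ j' < θ.ord, ∃ j < θ.ord, ∀ b < κ.ord, ∃ v, b ≤ v ∧ v < κ.ord ∧
      ∀ d < (N (gc i)).ord, ∃ e, d ≤ e ∧ e < (N (gc i)).ord ∧
        Pos θ.ord κ.ord (N (gc i)).ord (fun x y =>
        ladder θ.ord x j = v ∧ ladder θ.ord y j' = e) := fun i =>
    exists_split_pair hθ hκr (hNr _ (hgc i)) hθκ (hκN _ (hgc i))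
  choose J' hJ' hspl using hspl
  obtain ⟨j, hj, hJ⟩ := exists_unbounded_colour hκr (c := θ.ord) (by rwa [card_ord])
    (E := fun _ => True) (C := fun i j => ∀ b < κ.ord, ∃ v, b ≤ v ∧ v < κ.ord ∧
      ∀ d < (N (gc i)).ord, ∃ e, d ≤ e ∧ e < (N (gc i)).ord ∧
        Pos θ.ord κ.ord (N (gc i)).ord (fun x y =>
        ladder θ.ord x j = v ∧ ladder θ.ord y (J' i) = e))
    (fun b hb => ⟨b, le_rfl, hb, trivial⟩) (fun i _ _ => hspl i)
  choose! r hir hrκ _ hr using hJ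
  -- distinct values
  have hstep : ∀ i < κ.ord, ∀ b < κ.ord, ∃ v, b ≤ v ∧ v < κ.ord ∧
      ∀ d < (N (gc (r i))).ord, ∃ e, d ≤ e ∧ e < (N (gc (r i))).ord ∧
        Pos θ.ord κ.ord (N (gc (r i))).ord (fun x y =>
        ladder θ.ord x j = v ∧ ladder θ.ord y (J' (r i)) = e) := fun i hi => hr i hi
  choose! V hbV hVκ hV using hstep
  obtain ⟨v, hv⟩ := exists_recursion (0 : Ordinal.{u}) (fun i f => V i (succ (limSup i f)))
  have hv' : ∀ i, v i = V i (succ (limSup i (mask i v))) := hv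
  have hκl := isSuccLimit_ord hκr.aleph0_le
  have hvb : ∀ i < κ.ord, succ (limSup i (mask i v)) < κ.ord := by
    intro i
    induction i using WellFoundedLT.induction with
    | _ i ih =>
      intro hi
      refine hκl.succ_lt (limSup_lt (by rw [hκr.cof_ord]; exact lt_ord.1 hi) fun k hk => ?_)
      rw [mask_of_lt hk, hv']
      exact hVκ k (hk.trans hi) _ (ih k hk (hk.trans hi))
  have hvmono : ∀ k i, k < i → i < κ.ord → v k < v i := by
    intro k i hki hi
    rw [hv' i]
    refine lt_of_lt_of_le ?_ (hbV i hi _ (hvb i hi))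
    rw [lt_succ_iff, ← mask_of_lt (η := v) hki]
    exact le_limSup hki
  have hvinj : ∀ k i, k < κ.ord → i < κ.ord → v k = v i → k = i := by
    intro k i hk hi h
    rcases lt_trichotomy k i with h1 | h1 | h1
    · exact absurd h (hvmono k i h1 hi).ne
    · exact h1
    · exact absurd h (hvmono i k h1 hk).ne'
  have hpos : ∀ i < κ.ord, ∃ f : Ordinal.{u} → Ordinal.{u}, ∀ b < (N (gc (r i))).ord,
      Pos θ.ord κ.ord (N (gc (r i))).ord (fun x y =>
        ladder θ.ord x j = v i ∧ f (ladder θ.ord y (J' (r i))) = b) := by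
    intro i hi
    have := hV i hi _ (hvb i hi)
    rw [← hv'] at this
    obtain ⟨f, hf⟩ := exists_surj_of_unbounded (hNr _ (hgc _)) this
    refine ⟨f, fun b hb => ?_⟩
    obtain ⟨e, -, he, rfl⟩ := hf b hb
    exact he.mono fun x y hxy => ⟨hxy.1, by rw [hxy.2]⟩
  choose! f hf using hpos
  let idx : Ordinal.{u} → Ordinal.{u} := fun x =>
    if h : ∃ i < κ.ord, ladder θ.ord x j = v i then h.choose else 0
  have hidx : ∀ x, ∀ i < κ.ord, ladder θ.ord x j = v i → idx x = i := by
    intro x i hi hx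
    have h : ∃ i < κ.ord, ladder θ.ord x j = v i := ⟨i, hi, hx⟩
    simp only [idx, dif_pos h]
    exact hvinj _ _ h.choose_spec.1 hi (h.choose_spec.2.symm.trans hx)
  have hmain : ∀ i < κ.ord, ∀ b < (N (gc (r i))).ord,
      Pos θ.ord κ.ord (N (gc (r i))).ord (fun x y => N (gc (r (idx x))) = N (gc (r i)) ∧
        f (idx x) (ladder θ.ord y (J' (r (idx x)))) = b) := by
    intro i hi b hb
    refine (hf i hi b hb).mono fun x y hxy => ?_
    rw [hidx x i hi hxy.1]
    exact ⟨rfl, hxy.2⟩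
  have hbig : ∀ c < lam, ∃ i < κ.ord, c < N (gc (r i)) := by
    intro c hc
    obtain ⟨i, hi, h⟩ := hgcof c hc
    exact ⟨i, hi, (h _ (hir i hi) (hrκ i hi)).trans_lt (hcN _ (hgc _))⟩
  refine ⟨fun x => N (gc (r (idx x))), fun x y => f (idx x) (ladder θ.ord y (J' (r (idx x)))),
    fun i => ⟨hNr _ (hgc _), hκN _ (hgc _), hNl _ (hgc _)⟩, ?_, ?_⟩
  · intro c hc
    obtain ⟨i, hi, hci⟩ := hbig c hc
    obtain ⟨a, b, hab, h1, -⟩ := hmain i hi 0 (hNr _ (hgc _)).ord_pos (fun _ _ _ => 0)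
      (fun _ _ _ => 0) (fun _ _ _ _ _ _ => hκr.ord_pos) (fun _ _ _ _ _ _ => (hNr _ (hgc _)).ord_pos)
    exact ⟨_, limSup_lt (by rw [card_ord, hκr.cof_ord]; exact hθκ) hab.lt_left, hci.trans_eq h1.symm⟩
  · intro b hb
    obtain ⟨i, hi, hci⟩ := hbig b.card (lt_ord.1 hb)
    exact ⟨N (gc (r i)), hNr _ (hgc _), hκN _ (hgc _), hNl _ (hgc _), hmain i hi b (lt_ord.2 hci)⟩

theorem ordLift_of_le {o i : Ordinal.{u}} {α : Type*} (f : o.ToType → α) (d : α) (h : o ≤ i) :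
    ordLift f d i = d := by
  rw [ordLift, dif_neg]
  rintro ⟨z, rfl⟩
  exact (ordVal_lt z).not_ge h

theorem exists_enum_zf (Z : ZFSet.{u}) : ∃ e : Ordinal.{u} → ZFSet.{u},
    (∀ ε, e ε ∈ Z ∨ e ε = ∅) ∧ ∀ z ∈ Z, ∃ ε < Z.card.ord, e ε = z := by
  have h : #(Z.card.ord.ToType) = #(Shrink.{u} Z) := by
    rw [mk_toType, card_ord]; rfl
  obtain ⟨g⟩ := Cardinal.eq.1 h
  refine ⟨ordLift (fun z => ((equivShrink Z).symm (g z)).1) ∅, fun ε => ?_, fun z hz => ?_⟩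
  · exact ordLift_mem (p := fun x => x ∈ Z ∨ x = ∅)
      (fun z => Or.inl ((equivShrink Z).symm (g z)).2) (Or.inr rfl) ε
  · refine ⟨ordVal (g.symm (equivShrink Z ⟨z, hz⟩)), ordVal_lt _, ?_⟩
    rw [ordLift_ordVal]
    simp

/-- A binary operation that lists the elements of `Z s`, for every `s` that is not an ordinal. -/
theorem exists_decoder {lam χ : Cardinal.{u}} (hχ : 0 < χ) (hχl : χ ≤ lam) (Z : ZFSet.{u} → ZFSet.{u})
    (hZ : ∀ s, ∀ z ∈ Z s, InH χ lam.ord z) (hc : ∀ s, (Z s).card < χ) :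
    ∃ F : ZFSet.{u} → ZFSet.{u} → ZFSet.{u}, (∀ x y, InH χ lam.ord (F x y)) ∧
      ∀ U : ZFSet.{u}, (∀ x ∈ U, ∀ y ∈ U, F x y ∈ U) →
        (∀ a b : Ordinal.{u}, a < b → b < χ.ord → b.toZFSet ∈ U → a.toZFSet ∈ U) →
        ∀ s ∈ U, (∀ o : Ordinal.{u}, s ≠ o.toZFSet) → Z s ⊆ U := by
  classical
  choose e he he' using fun s => exists_enum_zf (Z s)
  let F : ZFSet.{u} → ZFSet.{u} → ZFSet.{u} := fun x y =>
    if h : ∃ o : Ordinal.{u}, y = o.toZFSet then e x h.choose else (Z x).card.ord.toZFSet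
  have hF1 : ∀ x (o : Ordinal.{u}), F x o.toZFSet = e x o := by
    intro x o
    have h : ∃ o' : Ordinal.{u}, o.toZFSet = o'.toZFSet := ⟨o, rfl⟩
    simp only [F, dif_pos h]
    rw [← Ordinal.toZFSet_injective h.choose_spec]
  have hF2 : ∀ x y, (∀ o : Ordinal.{u}, y ≠ o.toZFSet) → F x y = (Z x).card.ord.toZFSet := by
    intro x y h
    exact dif_neg (by simpa using h)
  have hcχ : ∀ s, (Z s).card.ord < χ.ord := fun s => ord_lt_ord.2 (hc s)
  refine ⟨F, fun x y => ?_, fun U hU hord s hs hso z hz => ?_⟩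
  · by_cases h : ∃ o : Ordinal.{u}, y = o.toZFSet
    · obtain ⟨o, rfl⟩ := h
      rw [hF1]
      rcases he x o with h | h
      · exact hZ x _ h
      · rw [h]
        exact InH.set _ (fun y hy => absurd hy (ZFSet.notMem_empty y)) (by rwa [ZFSet.card_empty])
    · rw [hF2 x y (by simpa using h)]
      exact InH.ord _ ((hcχ x).trans_le (ord_le_ord.2 hχl))
  · have h1 : (Z s).card.ord.toZFSet ∈ U := hF2 s s hso ▸ hU s hs s hs
    obtain ⟨ε, hε, rfl⟩ := he' s z hz
    exact hF1 s ε ▸ hU s hs _ (hord ε _ hε (hcχ s) h1)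

theorem IsModelChain.restrict {lam χ : Cardinal.{u}} {δ δ' : Ordinal.{u}}
    {M : Ordinal.{u} → PreModel.{u}} {η : Ordinal.{u} → Ordinal.{u}} (h : IsModelChain lam χ δ M η)
    (hδ : δ' ≤ δ) : IsModelChain lam χ δ' M η :=
  ⟨fun i hi => h.adm i (hi.trans_le hδ), fun j i hj hi => h.mono j i hj (hi.trans_le hδ),
    fun i hi => h.cont_univ i (hi.trans_le hδ), fun i hi => h.cont_voc i (hi.trans_le hδ),
    fun i hi => h.models_mem i (hi.trans_le hδ), fun i hi => h.seq_mem i (hi.trans_le hδ)⟩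

theorem IsModelChain.card_lt_top {lam θ χ : Cardinal.{u}} {M : Ordinal.{u} → PreModel.{u}}
    {η : Ordinal.{u} → Ordinal.{u}} (hθ : ℵ₀ ≤ θ) (hχ : χ.IsRegular) (hθχ : θ < χ)
    (h : IsModelChain lam χ (θ.ord + 1) M η) : (M θ.ord).U.card < χ := by
  have hl := isSuccLimit_ord hθ
  have h1 := h.restrict (δ' := θ.ord) le_self_add
  have : (M θ.ord).U = ZFSet.iUnion (fun j : Set.Iio θ.ord => (M j).U) := by
    ext x
    rw [mem_iUnion_Iio (f := fun j => (M j).U)]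
    exact h.cont_univ _ (lt_add_one _) hl x
  rw [this]
  refine zf_card_iUnion_lt hχ ?_ _ fun j => h1.card_lt hl j.2
  rwa [card_shrink_Iio, card_ord]

/-- The bookkeeping by which the values of `η` at the places `q m` code the models of a chain. -/
structure Codebook (lam θ χ : Cardinal.{u}) where
  K : ZFSet.{u} → Ordinal.{u} → Ordinal.{u}
  cd : Ordinal.{u} → Ordinal.{u}
  p : Ordinal.{u} → Ordinal.{u}
  r : Ordinal.{u} → Ordinal.{u}
  coding : IsCoding lam θ χ K
  unbounded : ∀ a < lam.ord, ∀ b < lam.ord, ∃ x < lam.ord, b < x ∧ cd x = a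
  p_le : ∀ m, p m ≤ m
  surj : ∀ i < θ.ord, ∀ l < θ.ord, ∀ b < θ.ord, ∃ m < θ.ord, b < m ∧ p m = i ∧ r m = l

theorem exists_codebook {lam θ χ : Cardinal.{u}} (hθ : θ.IsRegular) (hχ : χ.IsRegular)
    (hθχ : θ < χ) (hχl : χ ≤ lam) (hpow : lam ^ θ = powerlt lam χ) :
    Nonempty (Codebook lam θ χ) := by
  obtain ⟨K, hK⟩ := exists_coding hθ hχ hθχ hχl hpow
  obtain ⟨cd, hcd⟩ := exists_unbounded_fibres (hχ.aleph0_le.trans hχl)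
  obtain ⟨p, r, hp, hr⟩ := exists_pairing hθ.aleph0_le
  exact ⟨⟨K, cd, p, r, hK, hcd, hp, hr⟩⟩

/-- A chain of length `θ + 1` whose models below `θ` are coded by `η`. -/
structure Codebook.Candidate {lam θ χ : Cardinal.{u}} (C : Codebook lam θ χ)
    (q : Ordinal.{u} → Ordinal.{u}) (M : Ordinal.{u} → PreModel.{u})
    (η : Ordinal.{u} → Ordinal.{u}) : Prop where
  chain : IsModelChain lam χ (θ.ord + 1) M η
  lt : ∀ i < θ.ord, η i < lam.ord
  coded : ∀ m < θ.ord, C.cd (η (q m)) = C.K (M (C.p m)).code (C.r m)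

section Candidate

variable {lam θ χ : Cardinal.{u}} {C : Codebook lam θ χ} {q : Ordinal.{u} → Ordinal.{u}}
  {M M' : Ordinal.{u} → PreModel.{u}} {η η' : Ordinal.{u} → Ordinal.{u}}

theorem Codebook.Candidate.inH (h : C.Candidate q M η) {i : Ordinal.{u}} (hi : i < θ.ord) :
    InH χ lam.ord (M i).code :=
  (h.chain.adm i (hi.trans_le le_self_add)).mem

theorem Codebook.Candidate.eq_of_agree (hθ : θ.IsRegular) (hq : ∀ m < θ.ord, q m < θ.ord)
    (h : C.Candidate q M η) (h' : C.Candidate q M' η') (hη : ∀ i < θ.ord, η i = η' i)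
    {i : Ordinal.{u}} (hi : i < θ.ord) : M i = M' i := by
  refine PreModel.code_injective (C.coding.inj _ _ (h.inH hi) (h'.inH hi) fun l hl => ?_)
  obtain ⟨m, hm, -, rfl, rfl⟩ := C.surj i hi l hl 0 (isSuccLimit_ord hθ.aleph0_le).bot_lt
  rw [← h.coded m hm, ← h'.coded m hm, hη _ (hq m hm)]

theorem Codebook.Candidate.exists_determined (hθ : θ.IsRegular) (hq : ∀ m < θ.ord, q m < θ.ord)
    (hpow : powerlt lam θ = powerlt lam χ) (h : C.Candidate q M η)
    {i : Ordinal.{u}} (hi : i < θ.ord) :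
    ∃ j < θ.ord, ∀ M' η', C.Candidate q M' η' → (∀ k < j, η k = η' k) → M i = M' i := by
  have h0 : 0 < θ.ord := (isSuccLimit_ord hθ.aleph0_le).bot_lt
  obtain ⟨l, hl, hdet⟩ := C.coding.bounded hpow _ (h.inH hi)
  have hm := fun l' (hl' : l' < l) => C.surj i hi l' (hl'.trans hl) 0 h0
  choose! m hm hm0 hmp hmr using hm
  obtain ⟨j, hj, hjm⟩ := exists_bound_Iio (o := θ.ord) (i := l)
    (by rw [hθ.cof_ord]; exact lt_ord.1 hl) (fun l' => q (m l')) fun l' hl' => hq _ (hm l' hl')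
  refine ⟨j, hj, fun M' η' h' hη => PreModel.code_injective (hdet _ (h'.inH hi) fun l' hl' => ?_)⟩
  have h1 := h.coded _ (hm l' hl')
  have h2 := h'.coded _ (hm l' hl')
  rw [hmp l' hl', hmr l' hl'] at h1 h2
  rw [← h1, ← h2, hη _ (hjm l' hl')]

end Candidate

/-- Every family of candidates, enumerated suitably, satisfies the clauses that do not depend on
whether `lam` is regular. -/
theorem exists_guesses {lam θ χ : Cardinal.{u}} (hθ : θ.IsRegular) (hχ : χ.IsRegular)
    (hθχ : θ < χ) (hχl : χ ≤ lam) (C : Codebook lam θ χ) {q : Ordinal.{u} → Ordinal.{u}}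
    (hq : ∀ m < θ.ord, q m < θ.ord)
    (Good : (Ordinal.{u} → PreModel.{u}) → (Ordinal.{u} → Ordinal.{u}) → Prop)
    (hG : ∀ M η, Good M η → C.Candidate q M η) (key : (Ordinal.{u} → Ordinal.{u}) → Ordinal.{u})
    (hkey : ∀ M η M' η', Good M η → Good M' η' →
      (∀ i < θ.ord, initSeg η i ∈ (M' θ.ord).U) → key η ≤ key η') :
    ∃ W : Guesses.{u}, (∀ α < W.len, Good (W.M α) (W.η α)) ∧
      (∀ M η, Good M η → (∀ i, θ.ord ≤ i → η i = 0) →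
        ∃ α < W.len, W.η α = η ∧ ∀ i < θ.ord, W.M α i = M i) ∧
      ClauseB0 θ W ∧
      (∀ α β, α < β → β < W.len → key (W.η α) ≤ key (W.η β)) ∧
      (∀ α < W.len, ∀ β < W.len, Trace θ W α β → α < β + (ltPow χ θ).ord) ∧
      ClauseB2 lam θ χ W := by
  classical
  have hθl := isSuccLimit_ord hθ.aleph0_le
  let ext : (θ.ord.ToType → lam.ord.ToType) → Ordinal.{u} → Ordinal.{u} := fun f =>
    ordLift (fun z => ordVal (f z)) 0
  have hext : ∀ f g, (∀ i < θ.ord, ext f i = ext g i) → f = g := by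
    intro f g h
    funext z
    have := h _ (ordVal_lt z)
    simp only [ext, ordLift_ordVal] at this
    exact ordVal_injective this
  let T : Type u := {f : θ.ord.ToType → lam.ord.ToType // ∃ M, Good M (ext f)}
  let η : T → Ordinal.{u} → Ordinal.{u} := fun a => ext a.1
  have hM : ∀ a : T, ∃ M, Good M (η a) := fun a => a.2
  choose M hM using hM
  have hinj : ∀ a b : T, (∀ i < θ.ord, η a i = η b i) → a = b := fun a b h =>
    Subtype.ext (hext _ _ h)
  let R : T → T → Prop := fun a b => ∀ i < θ.ord, initSeg (η a) i ∈ (M b θ.ord).U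
  have hbdd : BddAbove (Set.range fun μ : Set.Iio χ => (μ : Cardinal.{u}) ^ θ) :=
    bddAbove_of_small
  have hpowle : ∀ μ < χ, μ ^ θ ≤ ltPow χ θ := fun μ hμ => le_ciSup hbdd ⟨μ, hμ⟩
  have hτ : ℵ₀ ≤ ltPow χ θ := by
    refine (hθ.aleph0_le.trans (cantor θ).le).trans (hpowle 2 ?_)
    exact (natCast_lt_aleph0 (n := 2)).trans_le hχ.aleph0_le
  have hR : ∀ b, #{a // R a b} ≤ ltPow χ θ := by
    intro b
    refine le_trans ?_ (hpowle _ ((hG _ _ (hM b)).chain.card_lt_top hθ.aleph0_le hχ hθχ))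
    have h1 : #(θ.ord.ToType → Shrink.{u} (M b θ.ord).U) = (M b θ.ord).U.card ^ θ := by
      rw [← Cardinal.power_def, mk_toType, card_ord]; rfl
    rw [← h1]
    refine mk_le_of_injective (f := fun a z =>
      equivShrink (M b θ.ord).U ⟨initSeg (η a.1) (ordVal z), a.2 _ (ordVal_lt z)⟩) ?_
    intro a a' h
    refine Subtype.ext (hinj _ _ fun i hi => ?_)
    obtain ⟨z, hz⟩ := exists_ordVal_eq (hθl.add_one_lt hi)
    have h2 := congrArg Subtype.val ((equivShrink _).injective (congrFun h z))
    simp only [hz, initSeg_eq_iff] at h2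
    exact h2.2 i (lt_add_one i)
  obtain ⟨len, idx, hidx, hlen, hsurj, hmono, hRlt⟩ := exists_enumeration hτ hR (fun a => key (η a))
    fun a b hab => hkey _ _ _ _ (hM a) (hM b) hab
  obtain ⟨EM, hEM⟩ : ∃ E : Ordinal.{u} → Ordinal.{u} → PreModel.{u}, ∀ a, E (idx a) = M a :=
    ⟨Function.extend idx M fun _ _ => ⟨∅, ∅, ∅, ∅, ∅⟩, fun a => hidx.extend_apply _ _ a⟩
  obtain ⟨Eη, hEη⟩ : ∃ E : Ordinal.{u} → Ordinal.{u} → Ordinal.{u}, ∀ a, E (idx a) = η a :=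
    ⟨Function.extend idx η fun _ _ => 0, fun a => hidx.extend_apply _ _ a⟩
  let W : Guesses.{u} := ⟨len, EM, Eη⟩
  have hWM : ∀ a, W.M (idx a) = M a := hEM
  have hWη : ∀ a, W.η (idx a) = η a := hEη
  refine ⟨W, ?_, ?_, ?_, ?_, ?_, ?_⟩
  · intro α hα
    obtain ⟨a, rfl⟩ := hsurj α hα
    rw [hWM, hWη]
    exact hM a
  · intro M' η' h' h0
    have hlt := (hG _ _ h').lt
    choose f hf using fun z : θ.ord.ToType => exists_ordVal_eq (hlt _ (ordVal_lt z))
    have hfη : ext f = η' := by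
      funext i
      by_cases hi : i < θ.ord
      · obtain ⟨z, rfl⟩ := exists_ordVal_eq hi
        simp only [ext, ordLift_ordVal, hf]
      · simp only [ext, ordLift_of_le _ _ (not_lt.1 hi), h0 i (not_lt.1 hi)]
    let a : T := ⟨f, M', hfη ▸ h'⟩
    refine ⟨idx a, hlen a, (hWη a).trans hfη, fun i hi => ?_⟩
    rw [hWM]
    exact (hG _ _ (hM a)).eq_of_agree hθ hq (hG _ _ h') (fun i _ => congrFun hfη i) hi
  · intro α hα β hβ hne
    obtain ⟨a, rfl⟩ := hsurj α hα
    obtain ⟨b, rfl⟩ := hsurj β hβ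
    rw [hWη, hWη]
    by_contra! h
    exact hne (congrArg idx (hinj a b h))
  · intro α β hαβ hβ
    obtain ⟨a, rfl⟩ := hsurj α (hαβ.trans hβ)
    obtain ⟨b, rfl⟩ := hsurj β hβ
    rw [hWη, hWη]
    exact hmono a b hαβ
  · intro α hα β hβ h
    obtain ⟨a, rfl⟩ := hsurj α hα
    obtain ⟨b, rfl⟩ := hsurj β hβ
    refine hRlt a b fun i hi => ?_
    rw [← hWM, ← hWη]
    exact h i hi
  · intro hpow
    let Det : T → Ordinal.{u} → Prop := fun a j =>
      ∀ b : T, (∀ k < j, η a k = η b k) → M a (C.p j) = M b (C.p j)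
    let Code : ZFSet.{u} → T × Ordinal.{u} → Prop := fun s x =>
      x.2 < θ.ord ∧ s = initSeg (η x.1) x.2 ∧ Det x.1 x.2
    let Z : ZFSet.{u} → ZFSet.{u} := fun s => if h : ∃ x, Code s x then
      insert (M h.choose.1 (C.p h.choose.2)).code (M h.choose.1 (C.p h.choose.2)).U else ∅
    have hZ : ∀ s, Z s = ∅ ∨ ∃ a, ∃ i < θ.ord, Z s = insert (M a i).code (M a i).U := by
      intro s
      by_cases h : ∃ x, Code s x
      · exact Or.inr ⟨_, _, (C.p_le _).trans_lt h.choose_spec.1, dif_pos h⟩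
      · exact Or.inl (dif_neg h)
    have hZ' : ∀ a, ∀ j < θ.ord, Det a j →
        Z (initSeg (η a) j) = insert (M a (C.p j)).code (M a (C.p j)).U := by
      intro a j hj hd
      have h : ∃ x, Code (initSeg (η a) j) x := ⟨(a, j), hj, rfl, hd⟩
      obtain ⟨h1, h2, h3⟩ := h.choose_spec
      obtain ⟨h4, h5⟩ := initSeg_eq_iff.1 h2
      have h6 : M h.choose.1 (C.p h.choose.2) = M a (C.p j) := by
        rw [h3 a fun k hk => (h5 k (h4 ▸ hk)).symm, ← h4]
      simp only [Z, dif_pos h, h6]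
    have hadm : ∀ a, ∀ i < θ.ord, (M a i).Admissible lam χ := fun a i hi =>
      (hG _ _ (hM a)).chain.adm i (hi.trans_le le_self_add)
    obtain ⟨F, hF, hFU⟩ := exists_decoder hχ.pos hχl Z (by
        intro s z hz
        rcases hZ s with h | ⟨a, i, hi, h⟩
        · rw [h] at hz; exact absurd hz (ZFSet.notMem_empty z)
        · rw [h, ZFSet.mem_insert_iff] at hz
          rcases hz with rfl | hz
          exacts [(hadm a i hi).mem, (hadm a i hi).univ z hz]) (by
        intro s
        rcases hZ s with h | ⟨a, i, hi, h⟩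
        · rw [h, ZFSet.card_empty]; exact hχ.pos
        · rw [h]
          refine ZFSet.card_insert_le.trans_lt (add_lt_of_lt hχ.aleph0_le ?_
            (one_lt_aleph0.trans_le hχ.aleph0_le))
          exact ((hG _ _ (hM a)).chain.restrict le_self_add).card_lt hθl hi)
    refine ⟨F, fun x y _ _ => hF x y, fun α hα i hi => ?_⟩
    obtain ⟨a, rfl⟩ := hsurj α hα
    obtain ⟨j₀, hj₀, hdet⟩ := (hG _ _ (hM a)).exists_determined hθ hq hpow hi
    obtain ⟨j, hj, hj0, rfl, -⟩ := C.surj i hi 0 hθl.bot_lt j₀ hj₀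
    refine ⟨j, hj, fun β hβ hcl hmem => ?_⟩
    obtain ⟨b, rfl⟩ := hsurj β hβ
    rw [hWM] at hcl hmem ⊢
    rw [hWM]
    rw [hWη] at hmem
    have hZa := hZ' a j hj fun c hc => hdet _ _ (hG _ _ (hM c)) fun k hk => hc k (hk.trans hj0)
    have h1 := hFU _ hcl ((hG _ _ (hM b)).chain.adm _ (lt_add_one _)).inter_ordinal _ hmem
      (fun o => seqCode_ne_toZFSet (zero_le.trans_lt hj0) o)
    rw [hZa] at h1
    exact ⟨h1 (ZFSet.mem_insert_iff.2 (Or.inl rfl)),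
      fun x hx => h1 (ZFSet.mem_insert_iff.2 (Or.inr hx))⟩

theorem cof_limSup {θ : Cardinal.{u}} (hθ : θ.IsRegular) {a : Ordinal.{u} → Ordinal.{u}}
    (ha : ∀ j i, j < i → i < θ.ord → a j < a i) : (limSup θ.ord a).cof = θ := by
  have h : limSup θ.ord a = ⨆ i : Set.Iio θ.ord, a i := by
    rw [limSup, Set.image_eq_range]; rfl
  rw [h, Ordinal.cof_iSup_Iio (f := fun i : Set.Iio θ.ord => a i) (fun i j hij => ha i j hij j.2)
    (isSuccLimit_ord hθ.aleph0_le).isSuccPrelimit, hθ.cof_ord]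

/-- The ordinal `a` is in exactly one of `A`, `B`; the proposition `s` tells in which one. -/
structure PreModel.Separates (M : PreModel.{u}) (a : Ordinal.{u}) (s : Prop) : Prop where
  mem_U : a.toZFSet ∈ M.U
  mem_A : a.toZFSet ∈ M.A ↔ s
  mem_B : a.toZFSet ∈ M.B ↔ ¬ s

theorem PreModel.Separates.of_sub {M N : PreModel.{u}} {a : Ordinal.{u}} {s : Prop}
    (h : M.Separates a s) (hs : M.Sub N) : N.Separates a s :=
  ⟨hs.univ h.mem_U, (hs.A _ h.mem_U).symm.trans h.mem_A, (hs.B _ h.mem_U).symm.trans h.mem_B⟩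

theorem PreModel.Admissible.exists_separates {lam χ : Cardinal.{u}} {M : PreModel.{u}}
    (h : M.Admissible lam χ) : ∃ a < lam.ord, ∃ s, M.Separates a s := by
  by_contra! hcon
  refine h.ne (ZFSet.ext fun x => ⟨fun hx => ?_, fun hx => ?_⟩)
  · obtain ⟨hU, a, ha, rfl⟩ := h.A_sub x hx
    by_contra hB
    exact hcon a ha True ⟨hU, by simpa using hx, by simpa using hB⟩
  · obtain ⟨hU, a, ha, rfl⟩ := h.B_sub x hx
    by_contra hA
    exact hcon a ha False ⟨hU, by simpa using hA, by simpa using hx⟩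

theorem disagree_of_separates {θ : Cardinal.{u}} {W : Guesses.{u}} {α β a : Ordinal.{u}} {s : Prop}
    (hα : (W.M α θ.ord).Separates a s) (hβ : (W.M β θ.ord).Separates a s) : Disagree θ W α β := by
  have hX : a.toZFSet ∈ (W.M α θ.ord).U ∩ (W.M β θ.ord).U :=
    ZFSet.mem_inter.2 ⟨hα.mem_U, hβ.mem_U⟩
  constructor <;> intro h <;> have h1 := congrArg (a.toZFSet ∈ ·) h <;>
    simp only [ZFSet.mem_inter (x := (W.M α θ.ord).A), ZFSet.mem_inter (x := (W.M α θ.ord).B),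
      ZFSet.mem_inter (x := (W.M β θ.ord).A), ZFSet.mem_inter (x := (W.M β θ.ord).B), hX, and_true,
      hα.mem_A, hα.mem_B, hβ.mem_A, hβ.mem_B, eq_iff_iff] at h1 <;> tauto

theorem Strategy.play_congr (σ : Strategy.{u}) {γ γ' : Ordinal.{u} → Ordinal.{u}} {i : Ordinal.{u}}
    (h : ∀ j < i, γ j = γ' j) : σ.play γ i = σ.play γ' i :=
  congrArg (σ.move i) (funext fun j => h j j.2)

theorem Strategy.play_mask (σ : Strategy.{u}) {γ : Ordinal.{u} → Ordinal.{u}} {i m : Ordinal.{u}}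
    (h : i ≤ m) : σ.play (mask m γ) i = σ.play γ i :=
  σ.play_congr fun _ hj => mask_of_lt (hj.trans_le h)

theorem exists_rank_lt_of_mem {lam θ χ : Cardinal.{u}} {M : Ordinal.{u} → PreModel.{u}}
    {η : Ordinal.{u} → Ordinal.{u}} (hθ : ℵ₀ ≤ θ) (h : IsModelChain lam χ (θ.ord + 1) M η)
    {x : ZFSet.{u}} (hx : x ∈ (M θ.ord).U) : ∃ j < θ.ord, x ∈ (M j).U :=
  (h.cont_univ _ (lt_add_one _) (isSuccLimit_ord hθ) x).1 hx

/-- The guesses for regular `lam`; `d (t ζ)` lists `h` and what tells the sets `A` from the sets `B`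
of the guesses with limit `ζ`. -/
structure RegularGood {lam θ χ : Cardinal.{u}} (C : Codebook lam θ χ)
    (e : Ordinal.{u} → Ordinal.{u} × Ordinal.{u} × Prop) (M : Ordinal.{u} → PreModel.{u})
    (η : Ordinal.{u} → Ordinal.{u}) : Prop where
  cand : C.Candidate id M η
  mono : ∀ j i, j < i → i < θ.ord → η j < η i
  rank : ∀ i < θ.ord, (M i).code.rank < η i
  sep : (M 0).Separates (e (limSup θ.ord η)).2.1 (e (limSup θ.ord η)).2.2

theorem RegularGood.limSup_le {lam θ χ : Cardinal.{u}} (hθ : θ.IsRegular) {C : Codebook lam θ χ}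
    {e : Ordinal.{u} → Ordinal.{u} × Ordinal.{u} × Prop} {M' : Ordinal.{u} → PreModel.{u}}
    {η η' : Ordinal.{u} → Ordinal.{u}} (h' : RegularGood C e M' η')
    (htr : ∀ i < θ.ord, initSeg η i ∈ (M' θ.ord).U) : limSup θ.ord η ≤ limSup θ.ord η' := by
  refine BlackBox.limSup_le fun i hi => ?_
  obtain ⟨j, hj, hmem⟩ := exists_rank_lt_of_mem hθ.aleph0_le h'.cand.chain
    (htr _ ((isSuccLimit_ord hθ.aleph0_le).add_one_lt hi))
  exact (((rank_lt_initSeg (lt_add_one i)).trans (PreModel.rank_lt_code hmem)).trans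
    (h'.rank j hj)).le.trans (le_limSup hj)

theorem exists_coded_above {lam θ χ : Cardinal.{u}} (C : Codebook lam θ χ) :
    ∃ pick : Ordinal.{u} → Ordinal.{u} → Ordinal.{u}, ∀ v < lam.ord, ∀ b < lam.ord,
      pick v b < lam.ord ∧ b < pick v b ∧ C.cd (pick v b) = v := by
  have h := C.unbounded
  choose! pick h1 h2 h3 using h
  exact ⟨pick, fun v hv b hb => ⟨h1 v hv b hb, h2 v hv b hb, h3 v hv b hb⟩⟩

theorem regular_game {lam θ χ : Cardinal.{u}} (hlam : lam.IsRegular) (hθ : θ.IsRegular)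
    (hχ : χ.IsRegular) (hθχ : θ < χ) (hχl : χ ≤ lam) (C : Codebook lam θ χ)
    {e : Ordinal.{u} → Ordinal.{u} × Ordinal.{u} × Prop}
    (he : ∀ b < lam.ord, ∀ a < lam.ord, ∀ s, Pos θ.ord lam.ord lam.ord (fun x _ => e x = (b, a, s)))
    (σ : Strategy.{u}) (hbid : σ.bid < lam.ord)
    (hσ : ∀ γ : Ordinal.{u} → Ordinal.{u}, (∀ i < θ.ord, γ i < lam.ord) →
      IsModelChain lam χ θ.ord (σ.play γ) γ) :
    ∃ γ, (∀ i < θ.ord, γ i < lam.ord) ∧ (∀ i, θ.ord ≤ i → γ i = 0) ∧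
      RegularGood C e (closeChain θ (σ.play γ)) γ ∧ (e (limSup θ.ord γ)).1 = σ.bid := by
  have hθl := isSuccLimit_ord hθ.aleph0_le
  have hl0 : 0 < lam.ord := hlam.ord_pos
  have hθlam : θ < lam := hθχ.trans_le hχl
  obtain ⟨a₀, ha₀, s, hs⟩ := ((hσ (fun _ => 0) fun _ _ => hl0).adm 0 hθl.bot_lt).exists_separates
  obtain ⟨pick, hpick⟩ := exists_coded_above C
  have hrec : ∀ a : Ordinal.{u} → Ordinal.{u}, ∃ γ : Ordinal.{u} → Ordinal.{u}, ∀ m,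
      γ m = pick (C.K (σ.play (mask m γ) (C.p m)).code (C.r m))
        (max (a m) (σ.play (mask m γ) m).code.rank) := fun a =>
    exists_recursion (0 : Ordinal.{u}) (fun m γ => pick (C.K (σ.play γ (C.p m)).code (C.r m))
        (max (a m) (σ.play γ m).code.rank))
  choose gam hgam using hrec
  have hloc : ∀ a a' : Ordinal.{u} → Ordinal.{u}, ∀ m, (∀ j < m, a j = a' j) →
      ∀ j < m, gam a j = gam a' j := by
    intro a a' m h j
    induction j using WellFoundedLT.induction with
    | _ j ih =>
      intro hj
      rw [hgam a, hgam a', mask_congr (fun i hi => ih i hi (hi.trans hj)), h j hj]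
  have hstep : ∀ (γ : Ordinal.{u} → Ordinal.{u}), ∀ m < θ.ord, (∀ j < m, γ j < lam.ord) →
      (σ.play (mask m γ) m).code.rank < lam.ord := by
    intro γ m hm h
    exact ((hσ _ fun i _ => mask_lt hl0 h).adm m hm).mem.rank_lt (hlam.cof_ord.symm ▸ hχl)
  have hlt : ∀ a : Ordinal.{u} → Ordinal.{u}, ∀ n ≤ θ.ord, (∀ j < n, a j < lam.ord) → ∀ m < n,
      gam a m < lam.ord ∧ max (a m) (σ.play (mask m (gam a)) m).code.rank < gam a m ∧
        C.cd (gam a m) = C.K (σ.play (mask m (gam a)) (C.p m)).code (C.r m) := by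
    intro a n hn ha m
    induction m using WellFoundedLT.induction with
    | _ m ih =>
      intro hm
      have h := hpick (C.K (σ.play (mask m (gam a)) (C.p m)).code (C.r m)) (C.coding.lt _ _)
        (max (a m) (σ.play (mask m (gam a)) m).code.rank)
        (max_lt (ha m hm) (hstep _ m (hm.trans_le hn) fun j hj => (ih j hj (hj.trans hm)).1))
      rwa [← hgam a m] at h
  obtain ⟨a, b, hab, hP⟩ := he σ.bid hbid a₀ ha₀ s (fun m x _ => limSup m (gam x)) (fun _ _ _ => 0)
    (fun m hm x _ hx _ => limSup_lt (by rw [hlam.cof_ord]; exact (lt_ord.1 hm).trans hθlam)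
      fun j hj => (hlt x m hm.le (fun j _ => hx j) j hj).1)
    (fun _ _ _ _ _ _ => hl0)
  set γ := mask θ.ord (gam a) with hγ
  have hg := hlt a θ.ord le_rfl hab.lt_left
  have hγm : ∀ m < θ.ord, γ m = gam a m := fun m hm => mask_of_lt hm
  have hγa : ∀ j m, j < m → m < θ.ord → γ j < a m := by
    intro j m hj hm
    refine lt_of_le_of_lt ?_ (hab.bound_left m hm)
    rw [hγm j (hj.trans hm), hloc a (mask m a) m (fun i hi => (mask_of_lt hi).symm) j hj]
    exact le_limSup hj
  have hag : ∀ m < θ.ord, a m < γ m := fun m hm =>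
    hγm m hm ▸ (le_max_left _ _).trans_lt (hg m hm).2.1
  have hlim : limSup θ.ord γ = limSup θ.ord a :=
    (limSup_le fun j hj => (hγa j _ (lt_add_one j) (hθl.add_one_lt hj)).le.trans
      (le_limSup (hθl.add_one_lt hj))).antisymm
      (limSup_le fun j hj => (hag j hj).le.trans (le_limSup hj))
  have hplay : ∀ m < θ.ord, ∀ i ≤ m, σ.play (mask m (gam a)) i = σ.play γ i := by
    intro m hm i hi
    rw [σ.play_mask hi, σ.play_mask (hi.trans hm.le)]
  have hγlt : ∀ i < θ.ord, γ i < lam.ord := fun i hi => hγm i hi ▸ (hg i hi).1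
  have hch := (hσ γ hγlt).close hθ.aleph0_le hχ hθχ hχl
  rw [← hlim] at hP
  refine ⟨γ, hγlt, fun i hi => mask_of_le hi, ⟨⟨hch, hγlt, fun m hm => ?_⟩, fun j i hj hi =>
    (hγa j i hj hi).trans (hag i hi), fun i hi => ?_, ?_⟩, by rw [hP]⟩
  · rw [id, hγm m hm, (hg m hm).2.2, hplay m hm _ (C.p_le m),
      closeChain_of_lt ((C.p_le m).trans_lt hm)]
  · rw [closeChain_of_lt hi, ← hplay i hi i le_rfl, hγm i hi]
    exact (le_max_right _ _).trans_lt (hg i hi).2.1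
  · rw [hP, closeChain_of_lt (i := 0) hθl.bot_lt, σ.play_congr (γ' := fun _ => 0)
      fun j hj => absurd hj (not_lt_zero)]
    exact hs

theorem exists_regularBox {lam θ χ : Cardinal.{u}} (hlam : lam.IsRegular) (hθ : θ.IsRegular)
    (hχ : χ.IsRegular) (hθχ : θ < χ) (hχl : χ ≤ lam) (hpow : lam ^ θ = powerlt lam χ) :
    ∃ (W : Guesses.{u}) (ζ h : Ordinal.{u} → Ordinal.{u}), IsRegularBox lam θ χ W ζ h := by
  have hθl := isSuccLimit_ord hθ.aleph0_le
  obtain ⟨C⟩ := exists_codebook hθ hχ hθχ hχl hpow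
  obtain ⟨d, hd, hdsurj⟩ := exists_triple_surj hlam.aleph0_le
  obtain ⟨t, ht⟩ := exists_regular_colouring hθ hlam (hθχ.trans_le hχl)
  obtain ⟨W, hgood, hcomplete, h0, hmono, h1, h2⟩ := exists_guesses hθ hχ hθχ hχl C
    (q := id) (fun _ h => h) (RegularGood C fun x => d (t x)) (fun _ _ h => h.cand)
    (limSup θ.ord) fun _ _ _ _ _ h' htr => h'.limSup_le hθ htr
  have hle : ∀ α < W.len, ∀ β < W.len, Trace θ W α β →
      limSup θ.ord (W.η α) ≤ limSup θ.ord (W.η β) := fun α _ β hβ htr =>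
    (hgood β hβ).limSup_le hθ htr
  have hH : ∀ α < W.len, ∀ i < θ.ord, InH χ (W.η α i) (W.M α i).code := fun α hα i hi =>
    ((hgood α hα).cand.inH hi).of_rank_lt _ ((hgood α hα).rank i hi)
  refine ⟨W, fun α => limSup θ.ord (W.η α), fun α => (d (t (limSup θ.ord (W.η α)))).1, ?_⟩
  refine ⟨fun α hα => ⟨limSup_lt ?_ (hgood α hα).cand.lt, cof_limSup hθ (hgood α hα).mono⟩,
    fun α _ => hd _, fun α _ β _ h => by simp only [h], hmono, fun α hα => (hgood α hα).cand.chain,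
    hH, fun α hα i hi a _ ha => ?_, fun α hα => (hgood α hα).cand.lt,
    fun α hα => (hgood α hα).mono, fun α _ => isLUB_limSup hθl.bot_lt _, ?_, h0,
    fun α hα β hβ htr => ⟨h1 α hα β hβ htr, hle α hα β hβ htr⟩, h2, ?_⟩
  · rw [card_ord, hlam.cof_ord]; exact hθχ.trans_le hχl
  · have := (PreModel.rank_lt_code ha).trans ((hgood α hα).rank i hi)
    rwa [Ordinal.rank_toZFSet] at this
  · rintro ⟨σ, hbid, hσ⟩
    have hσ' := fun γ hγ => Classical.not_imp.1 (hσ γ hγ)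
    obtain ⟨γ, hγ, hγ0, hG, hb⟩ := regular_game hlam hθ hχ hθχ hχl C (e := fun x => d (t x))
      (fun b hb a ha s => by
        obtain ⟨v, hv, hdv⟩ := hdsurj b hb a ha s
        exact (ht v hv).mono fun x _ hx => by rw [hx, hdv]) σ hbid fun γ hγ => (hσ' γ hγ).1
    obtain ⟨α, hα, hη, hM⟩ := hcomplete _ _ hG hγ0
    refine (hσ' γ hγ).2 ⟨α, hα, fun i _ => by rw [hη], fun i hi => ?_, ?_⟩
    · rw [hM i hi, closeChain_of_lt hi]
    · simp only [hη, hb]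
  · intro α hα β hβ _ htr h
    have heq : limSup θ.ord (W.η α) = limSup θ.ord (W.η β) := by
      rcases h with h | h
      · exact (hle α hα β hβ htr).antisymm (hmono β α h hα)
      · exact h
    have hsub : ∀ α < W.len, (W.M α 0).Sub (W.M α θ.ord) := fun α hα =>
      (hgood α hα).cand.chain.mono 0 _ zero_le (lt_add_one _)
    have hα' := (hgood α hα).sep
    rw [heq] at hα'
    exact disagree_of_separates (hα'.of_sub (hsub α hα)) ((hgood β hβ).sep.of_sub (hsub β hβ))

theorem three_mul_add_lt {θ : Cardinal.{u}} (hθ : ℵ₀ ≤ θ) {i c : Ordinal.{u}} (hi : i < θ.ord)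
    (hc : c < 3) : 3 * i + c < θ.ord := by
  have hω : ω ≤ θ.ord := by rw [← ord_aleph0, ord_le_ord]; exact hθ
  have h3 : (3 : Ordinal.{u}) < θ.ord := (natCast_lt_omega0 3).trans_le hω
  exact Ordinal.isPrincipal_add_ord hθ (Ordinal.isPrincipal_mul_ord hθ h3 hi) (hc.trans h3)

theorem three_mul_lt {θ : Cardinal.{u}} (hθ : ℵ₀ ≤ θ) {i : Ordinal.{u}} (hi : i < θ.ord) :
    3 * i < θ.ord := by
  simpa using three_mul_add_lt hθ hi (c := 0) three_pos

theorem le_three_mul (i : Ordinal.{u}) : i ≤ 3 * i := Ordinal.le_mul_right i three_pos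

theorem three_mul_add_div (i : Ordinal.{u}) {c : Ordinal.{u}} (hc : c < 3) :
    (3 * i + c) / 3 = i := by
  rw [Ordinal.mul_add_div _ three_ne_zero, Ordinal.div_eq_zero_of_lt hc, add_zero]

theorem div_three_le (k : Ordinal.{u}) : k / 3 ≤ k :=
  Ordinal.div_le_of_le_mul (le_three_mul k)

theorem div_three_lt {k m : Ordinal.{u}} (h : k < 3 * m) : k / 3 < m :=
  (Ordinal.lt_mul_iff_div_lt three_ne_zero).1 h

theorem eq_three_mul_add (k : Ordinal.{u}) :
    k = 3 * (k / 3) ∨ k = 3 * (k / 3) + 1 ∨ k = 3 * (k / 3) + 2 := by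
  have h := Ordinal.div_add_mod k 3
  have hlt := Ordinal.mod_lt k (b := 3) three_ne_zero
  obtain ⟨n, hn⟩ := Ordinal.lt_omega0.1 (hlt.trans (Ordinal.natCast_lt_omega0 3))
  rw [hn] at h hlt
  have h3 : n < 3 := by exact_mod_cast hlt
  interval_cases n
  · exact Or.inl (by simpa using h.symm)
  · exact Or.inr (Or.inl (by simpa using h.symm))
  · exact Or.inr (Or.inr (by simpa using h.symm))

theorem one_lt_three_ord : (1 : Ordinal.{u}) < 3 := by exact_mod_cast (by norm_num : (1 : ℕ) < 3)

theorem two_lt_three_ord : (2 : Ordinal.{u}) < 3 := by exact_mod_cast (by norm_num : (2 : ℕ) < 3)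

/-- Every ordinal below `o` that is in `M`, or is a value of some sequence of length `< θ` in `M`,
is below `b`. -/
structure PreModel.BoundedBelow (M : PreModel.{u}) (θ : Cardinal.{u}) (o b : Ordinal.{u}) : Prop where
  ord : ∀ a < o, a.toZFSet ∈ M.U → a < b
  seq : ∀ f i, i < θ.ord → initSeg f i ∈ M.U → ∀ j < i, f j < o → f j < b

theorem PreModel.exists_boundedBelow {M : PreModel.{u}} {θ : Cardinal.{u}} {o : Ordinal.{u}}
    (hM : M.U.card < o.cof) (hθ : θ < o.cof) (ho : IsSuccLimit o) : ∃ b < o, M.BoundedBelow θ o b := by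
  classical
  have h0 : 0 < o := ho.bot_lt
  have h1 : ∀ x : ZFSet.{u}, ∃ b < o, (∀ a < o, x = a.toZFSet → a < b) ∧
      ∀ f i, i < θ.ord → x = initSeg f i → ∀ j < i, f j < o → f j < b := by
    intro x
    obtain ⟨b₁, hb₁, h₁⟩ : ∃ b < o, ∀ a < o, x = a.toZFSet → a < b := by
      by_cases hx : ∃ a < o, x = a.toZFSet
      · obtain ⟨a, ha, rfl⟩ := hx
        exact ⟨a + 1, ho.add_one_lt ha, fun a' _ h' => Ordinal.toZFSet_injective h' ▸ lt_add_one a⟩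
      · exact ⟨0, h0, fun a ha h => absurd ⟨a, ha, h⟩ hx⟩
    obtain ⟨b₂, hb₂, h₂⟩ : ∃ b < o, ∀ f i, i < θ.ord → x = initSeg f i → ∀ j < i, f j < o → f j < b := by
      by_cases hx : ∃ f i, i < θ.ord ∧ x = initSeg f i
      · obtain ⟨f, i, hi, rfl⟩ := hx
        obtain ⟨b, hb, h⟩ := exists_bound_Iio (o := o) (i := i) ((lt_ord.1 hi).trans hθ)
          (fun j => if f j < o then f j else 0) fun j _ => by
            split_ifs with hj
            exacts [hj, h0]
        refine ⟨b, hb, fun f' i' _ hff j hj hjo => ?_⟩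
        obtain ⟨rfl, hval⟩ := initSeg_eq_iff.1 hff
        have := h j hj
        rwa [hval j hj, if_pos hjo] at this
      · exact ⟨0, h0, fun f i hi h => absurd ⟨f, i, hi, h⟩ hx⟩
    exact ⟨max b₁ b₂, max_lt hb₁ hb₂, fun a ha h => (h₁ a ha h).trans_le (le_max_left _ _),
      fun f i hi h j hj hjo => (h₂ f i hi h j hj hjo).trans_le (le_max_right _ _)⟩
  choose g hg hg1 hg2 using h1
  obtain ⟨b, hb, h⟩ := exists_bound_zf hM g fun y _ => hg y
  exact ⟨b, hb, fun a ha hm => (hg1 _ a ha rfl).trans (h _ hm),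
    fun f i hi hm j hj hjo => (hg2 _ f i hi rfl j hj hjo).trans (h _ hm)⟩

/-- The sequence `v` increases to the supremum of the ordinals below `o` of the models `M i`,
`i < θ`. -/
structure Tracks (θ : Cardinal.{u}) (o : Ordinal.{u}) (M : Ordinal.{u} → PreModel.{u})
    (v : Ordinal.{u} → Ordinal.{u}) : Prop where
  mono : ∀ j i, j < i → i < θ.ord → v j < v i
  lt : ∀ i < θ.ord, v i < o
  bound : ∀ i < θ.ord, (M (3 * i)).BoundedBelow θ o (v i)
  cover : ∀ i < θ.ord, ∃ j < θ.ord, ∃ x < o, v i ≤ x ∧ x.toZFSet ∈ (M j).U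

section Tracks

variable {lam θ χ : Cardinal.{u}} {o : Ordinal.{u}} {M : Ordinal.{u} → PreModel.{u}}
  {η v : Ordinal.{u} → Ordinal.{u}}

theorem Tracks.lt_limSup (hθ : ℵ₀ ≤ θ) (h : Tracks θ o M v) {i : Ordinal.{u}} (hi : i < θ.ord) :
    v i < limSup θ.ord v :=
  (h.mono i _ (lt_add_one i) ((isSuccLimit_ord hθ).add_one_lt hi)).trans_le
    (le_limSup ((isSuccLimit_ord hθ).add_one_lt hi))

theorem IsModelChain.subset_three_mul (hθ : ℵ₀ ≤ θ) (hc : IsModelChain lam χ (θ.ord + 1) M η)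
    {i : Ordinal.{u}} (hi : i < θ.ord) : (M i).U ⊆ (M (3 * i)).U :=
  (hc.mono i _ (le_three_mul i) ((three_mul_lt hθ hi).trans_le le_self_add)).univ

theorem Tracks.supBelow_lt (hθ : ℵ₀ ≤ θ) (h : Tracks θ o M v)
    (hc : IsModelChain lam χ (θ.ord + 1) M η) {i : Ordinal.{u}} (hi : i < θ.ord) :
    (M i).supBelow o < limSup θ.ord v := by
  refine lt_of_le_of_lt (csSup_le' ?_) (h.lt_limSup hθ hi)
  rintro a ⟨ha, hm⟩
  exact ((h.bound i hi).ord a ha (hc.subset_three_mul hθ hi hm)).le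

theorem Tracks.supBelow_eq (hθ : ℵ₀ ≤ θ) (h : Tracks θ o M v)
    (hc : IsModelChain lam χ (θ.ord + 1) M η) : (M θ.ord).supBelow o = limSup θ.ord v := by
  refine le_antisymm (csSup_le' ?_) (limSup_le fun i hi => ?_)
  · rintro a ⟨ha, hm⟩
    obtain ⟨j, hj, hm⟩ := exists_rank_lt_of_mem hθ hc hm
    exact ((h.bound j hj).ord a ha (hc.subset_three_mul hθ hj hm)).le.trans (le_limSup hj)
  · obtain ⟨j, hj, x, hx, hvx, hm⟩ := h.cover i hi
    refine hvx.trans (le_csSup ⟨o, fun y hy => hy.1.le⟩ ⟨hx, ?_⟩)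
    exact (hc.mono j _ hj.le (lt_add_one _)).univ hm

theorem Tracks.lt_of_trace (hθ : ℵ₀ ≤ θ) (h : Tracks θ o M v)
    (hc : IsModelChain lam χ (θ.ord + 1) M η) {f : Ordinal.{u} → Ordinal.{u}}
    (htr : ∀ i < θ.ord, initSeg f i ∈ (M θ.ord).U) {k : Ordinal.{u}} (hk : k < θ.ord)
    (hfk : f k < o) : f k < limSup θ.ord v := by
  have hk1 := (isSuccLimit_ord hθ).add_one_lt hk
  obtain ⟨j, hj, hm⟩ := exists_rank_lt_of_mem hθ hc (htr _ hk1)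
  exact ((h.bound j hj).seq f _ hk1 (hc.subset_three_mul hθ hj hm) k (lt_add_one k) hfk).trans_le
    (le_limSup hj)

end Tracks

/-- The first limit attached to `η` in the singular case. -/
noncomputable def limZero (θ : Cardinal.{u}) (η : Ordinal.{u} → Ordinal.{u}) : Ordinal.{u} :=
  limSup θ.ord fun i => η (3 * i)

/-- The second limit attached to `η` in the singular case. -/
noncomputable def limOne (θ : Cardinal.{u}) (η : Ordinal.{u} → Ordinal.{u}) : Ordinal.{u} :=
  limSup θ.ord fun i => η (3 * i + 1)

/-- The guesses for singular `lam`; `e ζ ξ` lists `h` and what tells the sets `A` from the sets `B`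
of the guesses with limits `ζ` and `ξ`. -/
structure SingularGood {lam θ χ : Cardinal.{u}} (C : Codebook lam θ χ) (μ : Ordinal.{u} → Cardinal.{u})
    (e : Ordinal.{u} → Ordinal.{u} → Ordinal.{u} × Ordinal.{u} × Prop)
    (M : Ordinal.{u} → PreModel.{u}) (η : Ordinal.{u} → Ordinal.{u}) : Prop where
  cand : C.Candidate (fun m => 3 * m + 2) M η
  zero : Tracks θ lam.ord.cof.ord M fun i => η (3 * i)
  one : Tracks θ (μ (limZero θ η)).ord M fun i => η (3 * i + 1)
  rank : ∀ i < θ.ord, (M (3 * i + 2)).code.rank < η (3 * i + 2)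
  sep : (M 0).Separates (e (limZero θ η) (limOne θ η)).2.1 (e (limZero θ η) (limOne θ η)).2.2

section SingularGood

variable {lam θ χ : Cardinal.{u}} {C : Codebook lam θ χ} {μ : Ordinal.{u} → Cardinal.{u}}
  {e : Ordinal.{u} → Ordinal.{u} → Ordinal.{u} × Ordinal.{u} × Prop}
  {M M' : Ordinal.{u} → PreModel.{u}} {η η' : Ordinal.{u} → Ordinal.{u}}

theorem SingularGood.limZero_le (hθ : ℵ₀ ≤ θ) (h : SingularGood C μ e M η)
    (h' : SingularGood C μ e M' η') (htr : ∀ i < θ.ord, initSeg η i ∈ (M' θ.ord).U) :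
    limZero θ η ≤ limZero θ η' :=
  limSup_le fun i hi =>
    (h'.zero.lt_of_trace hθ h'.cand.chain htr (three_mul_lt hθ hi) (h.zero.lt i hi)).le

theorem SingularGood.limOne_le (hθ : ℵ₀ ≤ θ) (h : SingularGood C μ e M η)
    (h' : SingularGood C μ e M' η') (htr : ∀ i < θ.ord, initSeg η i ∈ (M' θ.ord).U)
    (heq : limZero θ η = limZero θ η') : limOne θ η ≤ limOne θ η' :=
  limSup_le fun i hi =>
    (h'.one.lt_of_trace hθ h'.cand.chain htr (three_mul_add_lt hθ hi one_lt_three_ord)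
      (heq ▸ h.one.lt i hi)).le

theorem SingularGood.limOne_lt (hμ : ∀ i, (μ i).IsRegular ∧ lam.ord.cof < μ i ∧ μ i < lam)
    (hθκ : θ < lam.ord.cof) (h : SingularGood C μ e M η) :
    limOne θ η < (μ (limZero θ η)).ord :=
  limSup_lt (by rw [card_ord, (hμ _).1.cof_ord]; exact hθκ.trans (hμ _).2.1) h.one.lt

end SingularGood

theorem mul_add_le_mul_add_iff {l z z' x x' : Ordinal.{u}} (hx : x < l) (hx' : x' < l) :
    l * z + x ≤ l * z' + x' ↔ z ≤ z' ∧ (z = z' → x ≤ x') := by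
  have key : ∀ {z z' x x' : Ordinal.{u}}, x < l → z < z' → l * z + x < l * z' + x' := by
    intro z z' x x' hx h
    calc l * z + x < l * z + l := by gcongr
      _ = l * (z + 1) := by rw [mul_add_one]
      _ ≤ l * z' := by gcongr; exact Order.add_one_le_of_lt h
      _ ≤ _ := le_self_add
  constructor
  · intro h
    refine ⟨not_lt.1 fun hlt => (key hx' hlt).not_ge h, ?_⟩
    rintro rfl
    simpa using h
  · rintro ⟨h1, h2⟩
    rcases h1.lt_or_eq with h | rfl
    · exact (key hx h).le
    · simpa using h2 rfl

theorem singular_game {lam θ χ : Cardinal.{u}} (hθ : θ.IsRegular)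
    (hχ : χ.IsRegular) (hθχ : θ < χ) (hχκ : χ ≤ lam.ord.cof) (C : Codebook lam θ χ)
    {μ : Ordinal.{u} → Cardinal.{u}}
    {e : Ordinal.{u} → Ordinal.{u} → Ordinal.{u} × Ordinal.{u} × Prop}
    (he : ∀ b < lam.ord, ∀ a < lam.ord, ∀ s, ∃ ν : Cardinal.{u}, ν.IsRegular ∧ lam.ord.cof < ν ∧
      ν < lam ∧ Pos θ.ord lam.ord.cof.ord ν.ord (fun x y => μ x = ν ∧ e x y = (b, a, s)))
    (σ : Strategy.{u}) (hbid : σ.bid < lam.ord)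
    (hσ : ∀ γ : Ordinal.{u} → Ordinal.{u}, (∀ i < θ.ord, γ i < lam.ord) →
      SingularDemand lam θ χ μ (σ.play γ) γ) :
    ∃ γ, (∀ i < θ.ord, γ i < lam.ord) ∧ (∀ i, θ.ord ≤ i → γ i = 0) ∧
      SingularGood C μ e (closeChain θ (σ.play γ)) γ ∧ (e (limZero θ γ) (limOne θ γ)).1 = σ.bid := by
  classical
  have hθ0 := hθ.aleph0_le
  have hθl := isSuccLimit_ord hθ0
  have hκlam : lam.ord.cof ≤ lam := cof_ord_le lam
  have hχl : χ ≤ lam := hχκ.trans hκlam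
  have hlaml := isSuccLimit_ord (hχ.aleph0_le.trans hχl)
  have hl0 : 0 < lam.ord := hlaml.bot_lt
  have hκr : lam.ord.cof.IsRegular := isRegular_cof hlaml
  have hθκ : θ < lam.ord.cof := hθχ.trans_le hχκ
  obtain ⟨a₀, ha₀, s, hs⟩ :=
    ((hσ (fun _ => 0) fun _ _ => hl0).1.adm 0 hθl.bot_lt).exists_separates
  obtain ⟨ν, hν, hκν, hνl, hP⟩ := he σ.bid hbid a₀ ha₀ s
  obtain ⟨pick, hpick⟩ := exists_coded_above C
  have hbnd : ∀ o : Ordinal.{u}, o.cof.IsRegular ∧ χ ≤ o.cof ∧ IsSuccLimit o → ∀ M : PreModel.{u},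
      M.U.card < χ → ∃ b < o, M.BoundedBelow θ o b := fun o ho M hM =>
    PreModel.exists_boundedBelow (hM.trans_le ho.2.1) (hθχ.trans_le ho.2.1) ho.2.2
  choose! bnd hbndlt hbnd using hbnd
  have hoκ : lam.ord.cof.ord.cof.IsRegular ∧ χ ≤ lam.ord.cof.ord.cof ∧ IsSuccLimit lam.ord.cof.ord := by
    rw [hκr.cof_ord]; exact ⟨hκr, hχκ, isSuccLimit_ord hκr.aleph0_le⟩
  have hoν : ν.ord.cof.IsRegular ∧ χ ≤ ν.ord.cof ∧ IsSuccLimit ν.ord := by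
    rw [hν.cof_ord]; exact ⟨hν, hχκ.trans hκν.le, isSuccLimit_ord hν.aleph0_le⟩
  have hrec : ∀ a b : Ordinal.{u} → Ordinal.{u}, ∃ γ : Ordinal.{u} → Ordinal.{u}, ∀ k,
      γ k = if k = 3 * (k / 3) then a (k / 3) else if k = 3 * (k / 3) + 1 then b (k / 3) else
        pick (C.K (σ.play (mask k γ) (C.p (k / 3))).code (C.r (k / 3)))
          (σ.play (mask k γ) k).code.rank := fun a b =>
    exists_recursion (0 : Ordinal.{u}) (fun k γ => if k = 3 * (k / 3) then a (k / 3) else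
      if k = 3 * (k / 3) + 1 then b (k / 3) else
        pick (C.K (σ.play γ (C.p (k / 3))).code (C.r (k / 3))) (σ.play γ k).code.rank)
  choose gam hgam using hrec
  have hgam0 : ∀ a b m, gam a b (3 * m) = a m := by
    intro a b m
    have h : (3 * m) / 3 = m := by
      rw [← add_zero (3 * m), three_mul_add_div m three_pos]
    rw [hgam, h, if_pos rfl]
  have hgam1 : ∀ a b m, gam a b (3 * m + 1) = b m := by
    intro a b m
    rw [hgam, three_mul_add_div m one_lt_three_ord, if_neg (by simp), if_pos rfl]
  have hgam2 : ∀ a b m, gam a b (3 * m + 2) =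
      pick (C.K (σ.play (mask (3 * m + 2) (gam a b)) (C.p m)).code (C.r m))
        (σ.play (mask (3 * m + 2) (gam a b)) (3 * m + 2)).code.rank := by
    intro a b m
    rw [hgam, three_mul_add_div m two_lt_three_ord, if_neg (by simp), if_neg (by simp)]
  have hloc : ∀ a a' b b' : Ordinal.{u} → Ordinal.{u}, ∀ m, (∀ j < m, a j = a' j) →
      (∀ j < m, b j = b' j) → ∀ k < 3 * m, gam a b k = gam a' b' k := by
    intro a a' b b' m ha hb k
    induction k using WellFoundedLT.induction with
    | _ k ih =>
      intro hk
      rw [hgam a b, hgam a' b', mask_congr (fun i hi => ih i hi (hi.trans hk)),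
        ha _ (div_three_lt hk), hb _ (div_three_lt hk)]
  have hstep : ∀ (γ : Ordinal.{u} → Ordinal.{u}), ∀ k < θ.ord, (∀ j < k, γ j < lam.ord) →
      (σ.play (mask k γ) k).code.rank < lam.ord := fun γ k hk h =>
    ((hσ _ fun i _ => mask_lt hl0 h).1.adm k hk).mem.rank_lt hχκ
  have hlt : ∀ a b : Ordinal.{u} → Ordinal.{u}, (∀ j < θ.ord, a j < lam.ord.cof.ord) →
      (∀ j < θ.ord, b j < ν.ord) → ∀ k < θ.ord, gam a b k < lam.ord := by
    intro a b ha hb k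
    induction k using WellFoundedLT.induction with
    | _ k ih =>
      intro hk
      have hk3 := (div_three_le k).trans_lt hk
      rcases eq_three_mul_add k with h | h | h
      · rw [h, hgam0]
        exact (ha _ hk3).trans_le (ord_le_ord.2 hκlam)
      · rw [h, hgam1]
        exact (hb _ hk3).trans (ord_lt_ord.2 hνl)
      · rw [h, hgam2, ← h]
        exact (hpick _ (C.coding.lt _ _) _ (hstep _ k hk fun j hj => ih j hj (hj.trans hk))).1
  have hcard : ∀ γ : Ordinal.{u} → Ordinal.{u}, (∀ i < θ.ord, γ i < lam.ord) → ∀ k < θ.ord,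
      (σ.play γ k).U.card < χ := fun γ hγ k hk => (hσ γ hγ).1.card_lt hθl hk
  obtain ⟨a, b, hab, hμ, hev⟩ := hP
    (fun m x y => bnd lam.ord.cof.ord (σ.play (gam x y) (3 * m)))
    (fun m x y => bnd ν.ord (σ.play (gam x y) (3 * m)))
    (fun m hm x y hx hy => hbndlt _ hoκ _
      (hcard _ (hlt x y (fun j _ => hx j) fun j _ => hy j) _ (three_mul_lt hθ0 hm)))
    (fun m hm x y hx hy => hbndlt _ hoν _
      (hcard _ (hlt x y (fun j _ => hx j) fun j _ => hy j) _ (three_mul_lt hθ0 hm)))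
  set γ := mask θ.ord (gam a b) with hγ
  have hγk : ∀ k < θ.ord, γ k = gam a b k := fun k hk => mask_of_lt hk
  have hγlt : ∀ k < θ.ord, γ k < lam.ord := fun k hk =>
    hγk k hk ▸ hlt a b hab.lt_left hab.lt_right k hk
  have hγ0 : ∀ m < θ.ord, γ (3 * m) = a m := fun m hm =>
    (hγk _ (three_mul_lt hθ0 hm)).trans (hgam0 a b m)
  have hγ1 : ∀ m < θ.ord, γ (3 * m + 1) = b m := fun m hm =>
    (hγk _ (three_mul_add_lt hθ0 hm one_lt_three_ord)).trans (hgam1 a b m)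
  have hplay : ∀ k < θ.ord, ∀ i ≤ k, σ.play (mask k (gam a b)) i = σ.play γ i := by
    intro k hk i hi
    rw [σ.play_mask hi, σ.play_mask (hi.trans hk.le)]
  have hplay3 : ∀ m < θ.ord, σ.play (gam (mask m a) (mask m b)) (3 * m) = σ.play γ (3 * m) := by
    intro m hm
    rw [hγ, σ.play_mask (three_mul_lt hθ0 hm).le]
    exact σ.play_congr (hloc _ _ _ _ m (fun j hj => mask_of_lt hj) fun j hj => mask_of_lt hj)
  have hγ2 : ∀ m < θ.ord, (σ.play γ (3 * m + 2)).code.rank < γ (3 * m + 2) ∧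
      C.cd (γ (3 * m + 2)) = C.K (σ.play γ (C.p m)).code (C.r m) := by
    intro m hm
    have hk := three_mul_add_lt hθ0 hm two_lt_three_ord
    have hp : C.p m ≤ 3 * m + 2 := ((C.p_le m).trans (le_three_mul m)).trans le_self_add
    have h := hpick _ (C.coding.lt (σ.play γ (C.p m)).code (C.r m)) _ (hstep (gam a b) _ hk
      fun j hj => hlt a b hab.lt_left hab.lt_right j (hj.trans hk))
    rw [hplay _ hk _ le_rfl] at h
    have h2 := hgam2 a b m
    rw [hplay _ hk _ le_rfl, hplay _ hk _ hp, ← hγk _ hk] at h2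
    rw [← h2] at h
    exact h.2
  have hz : limZero θ γ = limSup θ.ord a := limSup_congr hγ0
  have ho : limOne θ γ = limSup θ.ord b := limSup_congr hγ1
  have hμz : μ (limZero θ γ) = ν := by rw [hz, hμ]
  have hez : e (limZero θ γ) (limOne θ γ) = (σ.bid, a₀, s) := by rw [hz, ho, hev]
  obtain ⟨hch, hc0, hc1⟩ := hσ γ hγlt
  have hcover : ∀ o x : Ordinal.{u}, x < o → Covers θ (σ.play γ) o x → ∃ j < θ.ord, ∃ y < o, x ≤ y ∧
      y.toZFSet ∈ (closeChain θ (σ.play γ) j).U := by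
    intro o x hx h
    obtain ⟨j, hj, y, hy, hxy, hm⟩ := h hx
    exact ⟨j, hj, y, hy, hxy, by rwa [closeChain_of_lt hj]⟩
  refine ⟨γ, hγlt, fun i hi => mask_of_le hi,
    ⟨⟨hch.close hθ0 hχ hθχ hχl, hγlt, fun m hm => ?_⟩,
      ⟨fun j i hj hi => ?_, fun i hi => ?_, fun i hi => ?_, fun i hi => ?_⟩,
      ⟨fun j i hj hi => ?_, fun i hi => ?_, fun i hi => ?_, fun i hi => ?_⟩, fun i hi => ?_, ?_⟩,
    by rw [hez]⟩
  · rw [(hγ2 m hm).2, closeChain_of_lt ((C.p_le m).trans_lt hm)]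
  · simp only [hγ0 j (hj.trans hi), hγ0 i hi]
    exact hab.mono_left j i hj hi
  · simp only [hγ0 i hi]
    exact hab.lt_left i hi
  · have h3 := three_mul_lt hθ0 hi
    have h := hbnd _ hoκ _ (hcard γ hγlt _ h3)
    have hlt := hab.bound_left i hi
    rw [hplay3 i hi] at hlt
    simp only [hγ0 i hi]
    rw [closeChain_of_lt h3]
    exact ⟨fun x hx hm => (h.ord x hx hm).trans hlt,
      fun f n hn hm j hj hf => (h.seq f n hn hm j hj hf).trans hlt⟩
  · refine hcover _ _ ?_ (hc0 i hi)
    rw [hγ0 i hi]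
    exact hab.lt_left i hi
  · simp only [hγ1 j (hj.trans hi), hγ1 i hi]
    exact hab.mono_right j i hj hi
  · simp only [hγ1 i hi, hμz]
    exact hab.lt_right i hi
  · have h3 := three_mul_lt hθ0 hi
    have h := hbnd _ hoν _ (hcard γ hγlt _ h3)
    have hlt := hab.bound_right i hi
    rw [hplay3 i hi] at hlt
    simp only [hγ1 i hi, hμz]
    rw [closeChain_of_lt h3]
    exact ⟨fun x hx hm => (h.ord x hx hm).trans hlt,
      fun f n hn hm j hj hf => (h.seq f n hn hm j hj hf).trans hlt⟩
  · refine hcover _ _ ?_ (hc1 i hi)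
    rw [hγ1 i hi, hμz]
    exact hab.lt_right i hi
  · rw [closeChain_of_lt (three_mul_add_lt hθ0 hi two_lt_three_ord)]
    exact (hγ2 i hi).1
  · rw [hez, closeChain_of_lt (i := 0) hθl.bot_lt, σ.play_congr (γ' := fun _ => 0)
      fun j hj => absurd hj (not_lt_zero)]
    exact hs

theorem exists_singularBox {lam θ χ : Cardinal.{u}} (hlam : ¬ lam.IsRegular) (hθ : θ.IsRegular)
    (hχ : χ.IsRegular) (hθχ : θ < χ) (hcof : χ + Order.succ θ ≤ lam.ord.cof)
    (hpow : lam ^ θ = powerlt lam χ) :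
    ∃ (μ : Ordinal.{u} → Cardinal.{u}) (W : Guesses.{u}) (ζ ξ h : Ordinal.{u} → Ordinal.{u}),
      IsSingularBox lam θ χ μ W ζ ξ h := by
  have hθ0 := hθ.aleph0_le
  have hθl := isSuccLimit_ord hθ0
  have hχκ : χ ≤ lam.ord.cof := le_self_add.trans hcof
  have hχl : χ ≤ lam := hχκ.trans (cof_ord_le lam)
  have hlam0 : ℵ₀ ≤ lam := hχ.aleph0_le.trans hχl
  have hκlam : lam.ord.cof < lam := by
    refine (cof_ord_le lam).lt_of_ne fun h => hlam ?_
    rw [← h]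
    exact isRegular_cof (isSuccLimit_ord hlam0)
  have hκr : lam.ord.cof.IsRegular := isRegular_cof (isSuccLimit_ord hlam0)
  have hθκ : θ < lam.ord.cof := hθχ.trans_le hχκ
  obtain ⟨C⟩ := exists_codebook hθ hχ hθχ hχl hpow
  obtain ⟨d, hd, hdsurj⟩ := exists_triple_surj hlam0
  obtain ⟨μ, t, hμ, hμsup, ht⟩ := exists_singular_colouring hθ hlam0 hκlam hθκ
  set e : Ordinal.{u} → Ordinal.{u} → Ordinal.{u} × Ordinal.{u} × Prop := fun x y => d (t x y)
    with he
  have hone : ∀ M η, SingularGood C μ e M η → limOne θ η < lam.ord := fun M η h =>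
    (h.limOne_lt hμ hθκ).trans (ord_lt_ord.2 (hμ _).2.2)
  obtain ⟨W, hgood, hcomplete, h0, hmono, h1, h2⟩ := exists_guesses hθ hχ hθχ hχl C
    (q := fun m => 3 * m + 2) (fun m hm => three_mul_add_lt hθ0 hm two_lt_three_ord)
    (SingularGood C μ e) (fun _ _ h => h.cand)
    (fun η => lam.ord * limZero θ η + limOne θ η) fun _ _ _ _ h h' htr =>
      (mul_add_le_mul_add_iff (hone _ _ h) (hone _ _ h')).2
        ⟨h.limZero_le hθ0 h' htr, h.limOne_le hθ0 h' htr⟩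
  have hmono' : ∀ α β, α < β → β < W.len → limZero θ (W.η α) ≤ limZero θ (W.η β) ∧
      (limZero θ (W.η α) = limZero θ (W.η β) → limOne θ (W.η α) ≤ limOne θ (W.η β)) :=
    fun α β hαβ hβ => (mul_add_le_mul_add_iff (hone _ _ (hgood α (hαβ.trans hβ)))
      (hone _ _ (hgood β hβ))).1 (hmono α β hαβ hβ)
  refine ⟨μ, W, fun α => limZero θ (W.η α), fun α => limOne θ (W.η α),
    fun α => (e (limZero θ (W.η α)) (limOne θ (W.η α))).1, ?_⟩
  refine
    { mu_reg := fun i _ => ⟨(hμ i).1, hcof.trans_lt (hμ i).2.1, (hμ i).2.2⟩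
      mu_sup := hμsup
      zeta_lt := fun α hα => limSup_lt (by rw [card_ord, hκr.cof_ord]; exact hθκ)
        (hgood α hα).zero.lt
      h_lt := fun α _ => hd _
      h_dep := fun α _ β _ h h' => by simp only [h, h']
      zeta_mono := fun α β hαβ hβ => (hmono' α β hαβ hβ).1
      xi_mono := fun α β hαβ hβ => (hmono' α β hαβ hβ).2
      xi_lt := fun α hα => (hgood α hα).limOne_lt hμ hθκ
      chain := fun α hα => (hgood α hα).cand.chain
      mem_H := fun α hα i hi => ((hgood α hα).cand.inH
        (three_mul_add_lt hθ0 hi two_lt_three_ord)).of_rank_lt _ ((hgood α hα).rank i hi)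
      inter_lam := fun α hα i hi a _ ha => ?_
      eta_lt := fun α hα => (hgood α hα).cand.lt
      eta_mono_zero := fun α hα => (hgood α hα).zero.mono
      eta_lim_zero := fun α _ => isLUB_limSup hθl.bot_lt _
      eta_mono_one := fun α hα => (hgood α hα).one.mono
      eta_lim_one := fun α _ => isLUB_limSup hθl.bot_lt _
      sup_xi_lt := fun α hα i hi => (hgood α hα).one.supBelow_lt hθ0 (hgood α hα).cand.chain hi
      sup_xi := fun α hα => (hgood α hα).one.supBelow_eq hθ0 (hgood α hα).cand.chain
      sup_zeta_lt := fun α hα i hi =>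
        (hgood α hα).zero.supBelow_lt hθ0 (hgood α hα).cand.chain hi
      sup_zeta := fun α hα => (hgood α hα).zero.supBelow_eq hθ0 (hgood α hα).cand.chain
      game := ?_
      b0 := h0
      b1 := fun α hα β hβ htr =>
        ⟨h1 α hα β hβ htr, (hgood α hα).limZero_le hθ0 (hgood β hβ) htr⟩
      b2 := h2
      b1' := ?_ }
  · have := (PreModel.rank_lt_code ha).trans ((hgood α hα).rank i hi)
    rwa [Ordinal.rank_toZFSet] at this
  · rintro ⟨σ, hbid, hσ⟩
    have hσ' := fun γ hγ => Classical.not_imp.1 (hσ γ hγ)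
    obtain ⟨γ, hγ, hγ0, hG, hb⟩ := singular_game hθ hχ hθχ hχκ C (μ := μ) (e := e)
      (fun b hb a ha s => by
        obtain ⟨v, hv, hdv⟩ := hdsurj b hb a ha s
        obtain ⟨ν, h1, h2, h3, h4⟩ := ht v hv
        exact ⟨ν, h1, h2, h3, h4.mono fun x y hx => ⟨hx.1, by rw [he, ← hdv, ← hx.2]⟩⟩)
      σ hbid fun γ hγ => (hσ' γ hγ).1
    obtain ⟨α, hα, hη, hM⟩ := hcomplete _ _ hG hγ0
    refine (hσ' γ hγ).2 ⟨α, hα, fun i _ => by rw [hη], fun i hi => ?_, ?_⟩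
    · rw [hM i hi, closeChain_of_lt hi]
    · simp only [hη, hb]
  · intro α hα β hβ _ htr h
    have heq : limZero θ (W.η α) = limZero θ (W.η β) ∧ limOne θ (W.η α) = limOne θ (W.η β) := by
      rcases h with h | h
      · have hz := ((hgood α hα).limZero_le hθ0 (hgood β hβ) htr).antisymm (hmono' β α h hα).1
        exact ⟨hz, ((hgood α hα).limOne_le hθ0 (hgood β hβ) htr hz).antisymm
          ((hmono' β α h hα).2 hz.symm)⟩
      · exact h
    have hsub : ∀ α < W.len, (W.M α 0).Sub (W.M α θ.ord) := fun α hα =>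
      (hgood α hα).cand.chain.mono 0 _ zero_le (lt_add_one _)
    have hα' := (hgood α hα).sep
    rw [heq.1, heq.2] at hα'
    exact disagree_of_separates (hα'.of_sub (hsub α hα)) ((hgood β hβ).sep.of_sub (hsub β hβ))

end BlackBox

theorem mainTheorem11 (lam θ χ : Cardinal.{u})
    (hpow : lam ^ θ = Cardinal.powerlt lam χ)
    (hcof : χ + Order.succ θ ≤ lam.ord.cof)
    (hθ : θ.IsRegular) (hχ : χ.IsRegular) (hθχ : θ < χ) :
    (lam.IsRegular →
      ∃ (W : BlackBox.Guesses.{u}) (ζ h : Ordinal.{u} → Ordinal.{u}),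
        BlackBox.IsRegularBox lam θ χ W ζ h) ∧
    (¬ lam.IsRegular →
      ∃ (μ : Ordinal.{u} → Cardinal.{u}) (W : BlackBox.Guesses.{u})
        (ζ ξ h : Ordinal.{u} → Ordinal.{u}),
        BlackBox.IsSingularBox lam θ χ μ W ζ ξ h) := by
  have hχκ : χ ≤ lam.ord.cof := le_self_add.trans hcof
  refine ⟨fun hlam => ?_, fun hlam => ?_⟩
  · exact BlackBox.exists_regularBox hlam hθ hχ hθχ (hχκ.trans (Ordinal.cof_ord_le lam)) hpow
  · exact BlackBox.exists_singularBox hlam hθ hχ hθχ hcof hpow
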